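/- Let $M$ be an oriented smooth manifold of dimension $4$ (Hausdorff, second countable), with an atlas of positively oriented coordinates $x^\mu$, $\mu=0,\dots,3$. Let $\pi:E\to M$ be the bundle whose sections are the pairs $(g,\phi)$ of a Lorentzian metric $g$ of signature $(-,+,+,+)$ and a function $\phi$, and let $J^k\pi$ be its $k$-th jet bundle, with coordinates $x^\mu,\ y^c_I$ ($|I|\le k$), where $c$ runs over the components $g_{\alpha\beta}$ ($\alpha\le\beta$) and $\phi$, and $y^c_I$ stands for the partial derivative of the component $c$ with multi-index $I$. Let $G>0$, and let $G_2,G_3:\mathbb R^2\to\mathbb R$ be smooth functions of $(\phi,X)$ with $\partial G_3/\partial X=0$. Consider the cubic Horndeski Lagrangian density $L\,d^4x$ on $J^2\pi$, $$L=\frac{1}{16\pi G}\sqrt{|\det g|}\,\Bigl[R+X+G_2(\phi,X)+G_3(\phi,X)\,\square\phi\Bigr],\qquad X=-\tfrac12 g^{\mu\nu}\phi_{,\mu}\phi_{,\nu},\quad \square\phi=g^{\mu\nu}\nabla_\mu\nabla_\nu\phi ,$$ where $R$ is the scalar curvature of $g$ and $\nabla$ its Levi-Civita connection. Let $J^2\pi^\ddagger\to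 J^1\pi$ be the restricted $2$-symmetric multimomentum bundle. It has coordinates $x^\mu, y^c, y^c_\mu, p_c^\mu, p_c^{\mu\nu}$ ($\mu\le\nu$), and a point of it over $j\in J^1\pi$ is the multimomentum $p_c^\mu\,dy^c\wedge d^3x_\mu+\frac{1}{n(\mu\nu)}p_c^{\mu\nu}\,dy^c_\mu\wedge d^3x_\nu$ on vertical vectors, where $p_c^{\mu\nu}=p_c^{\nu\mu}$, $d^3x_\mu=i_{\partial/\partial x^\mu}d^4x$, and $n(\mu\nu)=1$ if $\mu=\nu$ and $2$ otherwise. The restricted Legendre map $\mathcal{FL}:J^3\pi\to J^2\pi^\ddagger$ is the bundle map over $J^1\pi$ given by $$p_c^{\mu\nu}=\frac{\partial L}{\partial y^c_{\mu\nu}},\qquad p_c^\mu=\frac{\partial L}{\partial y^c_\mu}-\sum_\nu\frac1{n(\mu\nu)}\,D_\nu\frac{\partial L}{\partial y^c_{\mu\nu}},$$ where $D_\nu$ is the total derivative. Put $\mathcal P=\mathcal{FL}(J^3\pi)$. Then the Lagrangian is almost-regular, that is: $\mathcal P$ is a closed (embedded, smooth) submanifold of $J^2\pi^\ddagger$; $\mathcal{FL}$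 is a submersion onto $\mathcal P$; and for every $j\in J^3\pi$ the fibre $\mathcal{FL}^{-1}(\mathcal{FL}(j))$ is a connected submanifold of $J^3\pi$. Moreover, $\mathcal P$ is diffeomorphic to $J^1\pi$. -/

import Mathlib

open Bundle Set Manifold
open scoped Manifold ContDiff Topology Bundle

namespace Horndeski

noncomputable section

/-! ### Coordinates and multi-indices -/

/-- The coordinate space of a four-dimensional manifold: coordinates `x^μ`, `μ = 0, 1, 2, 3`. -/
abbrev Coord : Type := EuclideanSpace ℝ (Fin 4)

/-- The coordinate vector `∂/∂x^μ`. -/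
def dir (μ : Fin 4) : Coord := EuclideanSpace.single μ (1 : ℝ)

/-- Ordered pairs of indices `α ≤ β`. -/
abbrev SymIdx : Type := {p : Fin 4 × Fin 4 // p.1 ≤ p.2}

/-- The ordered pair `{μ, ν}`. -/
def sym (μ ν : Fin 4) : SymIdx := ⟨(min μ ν, max μ ν), min_le_max⟩

/-- The components of the field `(g, φ)`: `inl ⟨(α, β), _⟩` stands for `g_{αβ}`, `α ≤ β`, and
`inr ()` stands for `φ`. -/
abbrev Comp : Type := SymIdx ⊕ Unit

/-- Multi-indices of order at most `k`; `I μ` counts the derivatives with respect to `x^μ`. -/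
abbrev MultiIdx (k : ℕ) : Type := {I : Fin 4 → ℕ // ∑ μ, I μ ≤ k}

instance (k : ℕ) : Finite (MultiIdx k) :=
  Finite.of_injective
    (fun (I : MultiIdx k) (μ : Fin 4) => (⟨I.1 μ, Nat.lt_succ_of_le
      ((Finset.single_le_sum (f := I.1) (fun _ _ => Nat.zero_le _) (Finset.mem_univ μ)).trans
        I.2)⟩ : Fin (k + 1)))
    (fun _ _ h => Subtype.ext (funext fun μ => congrArg Fin.val (congrFun h μ)))

instance (k : ℕ) : Fintype (MultiIdx k) := Fintype.ofFinite _

/-- The multi-index of order one which counts the single index `μ`. -/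
def one (μ : Fin 4) : Fin 4 → ℕ := Pi.single μ 1

/-- The combinatorial factor `n(μν)`: one on the diagonal and two off it. -/
def nfac (μ ν : Fin 4) : ℝ := if μ = ν then 1 else 2

/-- Fibre coordinates of `k`-jets: `v (I, c)` is the coordinate `y^c_I`, that is
`g_{αβ}, φ, g_{αβ,μ}, φ_{,μ}, g_{αβ,μν}, φ_{,μν}, …`, one for each multi-index of order `≤ k`. -/
abbrev JetFib (k : ℕ) : Type := MultiIdx k × Comp → ℝ

/-- The coordinate `y^c_I` of a jet (zero if the order of `I` exceeds the order of the jet). -/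
def JetFib.at {k : ℕ} (v : JetFib k) (I : Fin 4 → ℕ) (c : Comp) : ℝ :=
  if h : ∑ μ, I μ ≤ k then v (⟨I, h⟩, c) else 0

/-- The coordinate vector `∂/∂y^c_I`. -/
def unit (k : ℕ) (I : Fin 4 → ℕ) (c : Comp) : JetFib k :=
  fun q => if q.1.1 = I ∧ q.2 = c then 1 else 0

/-- The projection `π^k_l`, in fibre coordinates. -/
def trunc {k : ℕ} (l : ℕ) (v : JetFib k) : JetFib l := fun q => v.at q.1.1 q.2

/-! ### Jets of sections in coordinates -/

/-- The partial derivative `∂/∂x^μ`. -/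
def pd (μ : Fin 4) (f : Coord → ℝ) : Coord → ℝ := fun z => fderiv ℝ f z (dir μ)

/-- The iterated partial derivative with multi-index `I`. -/
def iterPD (I : Fin 4 → ℕ) (f : Coord → ℝ) : Coord → ℝ :=
  (pd 0)^[I 0] ((pd 1)^[I 1] ((pd 2)^[I 2] ((pd 3)^[I 3] f)))

/-- The coordinates `y^c_I = ∂_I s^c (z)` of the `k`-jet at `z` of a local section `s = (g, φ)`,
given in coordinates. -/
def jet (k : ℕ) (s : Coord → Comp → ℝ) (z : Coord) : JetFib k :=
  fun q => iterPD q.1.1 (fun w => s w q.2) z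

/-- The polynomial section `w ↦ ∑_I v_I (w - x)^I / I!`. -/
def poly {k : ℕ} (x : Coord) (v : JetFib k) : Coord → Comp → ℝ :=
  fun w c => ∑ J : MultiIdx k, v (J, c) * ∏ μ, (w μ - x μ) ^ J.1 μ / ((J.1 μ).factorial : ℝ)

/-- The coordinate expression in the coordinates `w` of the field `(g, φ)` whose expression in the
coordinates `σ w` is `s`: `g` transforms as a covariant two-tensor and `φ` as a scalar. -/
def pull (σ : Coord → Coord) (s : Coord → Comp → ℝ) : Coord → Comp → ℝ := fun w c =>
  match c with
  | Sum.inl q => ∑ κ, ∑ l, fderiv ℝ σ w (dir q.1.1) κ * fderiv ℝ σ w (dir q.1.2) l *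
      s (σ w) (Sum.inl (sym κ l))
  | Sum.inr u => s (σ w) (Sum.inr u)

/-- The linear map with prescribed values on the standard basis. -/
def ofColumns {ι ι' : Type} [Fintype ι] [Fintype ι'] (c : ι → ι' → ℝ) :
    (ι → ℝ) →L[ℝ] (ι' → ℝ) :=
  LinearMap.toContinuousLinearMap (Fintype.linearCombination ℝ c)

/-- The change of the fibre coordinates of `k`-jets of fields at the point with new coordinates
`z`: the jet `v` at `σ z` is represented by a section, this section is expressed in the
new coordinates, and its derivatives at `z` are taken. The result is linear in `v`. -/
def jetChange (k : ℕ) (σ : Coord → Coord) (z : Coord) : JetFib k →L[ℝ] JetFib k :=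
  ofColumns fun q => jet k (pull σ (poly (σ z) (Pi.single q 1))) z

/-- Fibre coordinates of multimomenta: `P (inl μ, c)` is the coordinate `p_c^μ`, and
`P (inr ⟨(μ, ν), _⟩, c)` is the coordinate `p_c^{μν}`, `μ ≤ ν`. -/
abbrev MomFib : Type := (Fin 4 ⊕ SymIdx) × Comp → ℝ

/-- The components `w^μ` of the three-form `w^μ d³x_μ` obtained by contracting the
multimomentum `p_c^μ dy^c ∧ d³x_μ + (1/n(μν)) p_c^{μν} dy^c_μ ∧ d³x_ν` with the
vertical tangent vector `v` of the first jet bundle. -/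
def pairing (P : MomFib) (v : JetFib 1) (μ : Fin 4) : ℝ :=
  ∑ c, (P (Sum.inl μ, c) * v.at 0 c +
    ∑ ν, (nfac ν μ)⁻¹ * P (Sum.inr (sym ν μ), c) * v.at (one ν) c)

/-- The components of the three-form in `pairing` in new coordinates, at the point with new
coordinates `z`, evaluated on the vertical vector with new coordinates `v`. Old and new coordinates
are related by `x = σ w` and `w = τ x`. -/
def pairingChange (σ τ : Coord → Coord) (z : Coord) (P : MomFib) (v : JetFib 1) (μ : Fin 4) : ℝ :=
  (fderiv ℝ σ z).det *
    ∑ κ, fderiv ℝ τ (σ z) (dir κ) μ * pairing P (jetChange 1 τ (σ z) v) κ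

/-- The change of the fibre coordinates of multimomenta: the new coordinates are the coefficients
of the three-form of `pairing`, expressed in the new coordinates. -/
def momChange (σ τ : Coord → Coord) (z : Coord) : MomFib →L[ℝ] MomFib :=
  ofColumns fun q r =>
    match r with
    | (Sum.inl μ, c) => pairingChange σ τ z (Pi.single q 1) (unit 1 0 c) μ
    | (Sum.inr m, c) => nfac m.1.1 m.1.2 *
        pairingChange σ τ z (Pi.single q 1) (unit 1 (one m.1.1) c) m.1.2


/-! ### Calculus of iterated partial derivatives -/

theorem pd_contDiffOn {U : Set Coord} (hU : IsOpen U) {f : Coord → ℝ} (hf : ContDiffOn ℝ ∞ f U)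
    (μ : Fin 4) : ContDiffOn ℝ ∞ (pd μ f) U :=
  (hf.fderiv_of_isOpen hU (by simp)).clm_apply contDiffOn_const

theorem pd_congr {U : Set Coord} (hU : IsOpen U) {f g : Coord → ℝ} (h : EqOn f g U) (μ : Fin 4) :
    EqOn (pd μ f) (pd μ g) U := fun z hz => by
  unfold pd
  rw [Filter.EventuallyEq.fderiv_eq (h.eventuallyEq_of_mem (hU.mem_nhds hz))]

theorem pd_comm {U : Set Coord} (hU : IsOpen U) {f : Coord → ℝ} (hf : ContDiffOn ℝ ∞ f U)
    (μ ν : Fin 4) : EqOn (pd μ (pd ν f)) (pd ν (pd μ f)) U := fun z hz => by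
  have hs : IsSymmSndFDerivAt ℝ f z :=
    (hf.contDiffAt (hU.mem_nhds hz)).isSymmSndFDerivAt (by
      simpa only [minSmoothness_of_isRCLikeNormedField] using ENat.LEInfty.out)
  have hd : DifferentiableAt ℝ (fderiv ℝ f) z :=
    ((hf.fderiv_of_isOpen hU (m := ∞) (by simp)).contDiffAt (hU.mem_nhds hz)).differentiableAt
      (by simp)
  have key : ∀ α β : Fin 4, pd α (pd β f) z = fderiv ℝ (fderiv ℝ f) z (dir α) (dir β) := by
    intro α β
    unfold pd
    rw [fderiv_clm_apply hd (differentiableAt_const _)]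
    simp
  rw [key, key]
  exact hs.eq _ _

theorem pdn_contDiffOn {U : Set Coord} (hU : IsOpen U) (μ : Fin 4) (n : ℕ) :
    ∀ {f : Coord → ℝ}, ContDiffOn ℝ ∞ f U → ContDiffOn ℝ ∞ ((pd μ)^[n] f) U := by
  induction n with
  | zero => exact fun hf => hf
  | succ n ih => exact fun hf => ih (pd_contDiffOn hU hf μ)

theorem pdn_congr {U : Set Coord} (hU : IsOpen U) (μ : Fin 4) (n : ℕ) :
    ∀ {f g : Coord → ℝ}, EqOn f g U → EqOn ((pd μ)^[n] f) ((pd μ)^[n] g) U := by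
  induction n with
  | zero => exact fun hf => hf
  | succ n ih => exact fun hf => ih (pd_congr hU hf μ)

theorem pdn_comm {U : Set Coord} (hU : IsOpen U) (μ ν : Fin 4) (n : ℕ) :
    ∀ {f : Coord → ℝ}, ContDiffOn ℝ ∞ f U →
      EqOn ((pd μ)^[n] (pd ν f)) (pd ν ((pd μ)^[n] f)) U := by
  induction n with
  | zero => exact fun _ _ _ => rfl
  | succ n ih =>
    exact fun hf => (pdn_congr hU μ n (pd_comm hU hf μ ν)).trans (ih (pd_contDiffOn hU hf μ))

theorem iterPD_contDiffOn {U : Set Coord} (hU : IsOpen U) (I : Fin 4 → ℕ) {f : Coord → ℝ}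
    (hf : ContDiffOn ℝ ∞ f U) : ContDiffOn ℝ ∞ (iterPD I f) U :=
  pdn_contDiffOn hU _ _ (pdn_contDiffOn hU _ _ (pdn_contDiffOn hU _ _ (pdn_contDiffOn hU _ _ hf)))

theorem iterPD_congr {U : Set Coord} (hU : IsOpen U) (I : Fin 4 → ℕ) {f g : Coord → ℝ}
    (h : EqOn f g U) : EqOn (iterPD I f) (iterPD I g) U :=
  pdn_congr hU _ _ (pdn_congr hU _ _ (pdn_congr hU _ _ (pdn_congr hU _ _ h)))

theorem iterPD_pd {U : Set Coord} (hU : IsOpen U) (I : Fin 4 → ℕ) (μ : Fin 4) {f : Coord → ℝ}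
    (hf : ContDiffOn ℝ ∞ f U) : EqOn (iterPD I (pd μ f)) (iterPD (I + one μ) f) U := by
  have h3 := pdn_contDiffOn hU 3 (I 3) hf
  have h2 := pdn_contDiffOn hU 2 (I 2) h3
  have h1 := pdn_contDiffOn hU 1 (I 1) h2
  fin_cases μ
  · have e : iterPD (I + one 0) f =
        (pd 0)^[I 0] (pd 0 ((pd 1)^[I 1] ((pd 2)^[I 2] ((pd 3)^[I 3] f)))) := by
      simp [iterPD, one]
    show EqOn (iterPD I (pd 0 f)) (iterPD (I + one 0) f) U
    rw [e]
    exact pdn_congr hU _ _ ((pdn_congr hU _ _ ((pdn_congr hU _ _ (pdn_comm hU 3 0 _ hf)).trans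
      (pdn_comm hU 2 0 _ h3))).trans (pdn_comm hU 1 0 _ h2))
  · have e : iterPD (I + one 1) f =
        (pd 0)^[I 0] ((pd 1)^[I 1] (pd 1 ((pd 2)^[I 2] ((pd 3)^[I 3] f)))) := by
      simp [iterPD, one]
    show EqOn (iterPD I (pd 1 f)) (iterPD (I + one 1) f) U
    rw [e]
    exact pdn_congr hU _ _ (pdn_congr hU _ _ ((pdn_congr hU _ _ (pdn_comm hU 3 1 _ hf)).trans
      (pdn_comm hU 2 1 _ h3)))
  · have e : iterPD (I + one 2) f =
        (pd 0)^[I 0] ((pd 1)^[I 1] ((pd 2)^[I 2] (pd 2 ((pd 3)^[I 3] f)))) := by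
      simp [iterPD, one]
    show EqOn (iterPD I (pd 2 f)) (iterPD (I + one 2) f) U
    rw [e]
    exact pdn_congr hU _ _ (pdn_congr hU _ _ (pdn_congr hU _ _ (pdn_comm hU 3 2 _ hf)))
  · have e : iterPD (I + one 3) f =
        (pd 0)^[I 0] ((pd 1)^[I 1] ((pd 2)^[I 2] ((pd 3)^[I 3] (pd 3 f)))) := by
      simp [iterPD, one]
    show EqOn (iterPD I (pd 3 f)) (iterPD (I + one 3) f) U
    rw [e]
    exact fun _ _ => rfl

/-- All partial derivatives of order at most `k`, in any order of differentiation, vanish. -/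
def Flat : ℕ → (Coord → ℝ) → Coord → Prop
  | 0, f, z => f z = 0
  | k + 1, f, z => f z = 0 ∧ ∀ μ, Flat k (pd μ f) z

theorem Flat.zero {k : ℕ} {f : Coord → ℝ} {z : Coord} (h : Flat k f z) : f z = 0 := by
  cases k with
  | zero => exact h
  | succ k => exact h.1

theorem Flat.pred {k : ℕ} : ∀ {f : Coord → ℝ} {z : Coord}, Flat (k + 1) f z → Flat k f z := by
  induction k with
  | zero => exact fun h => h.1
  | succ k ih => exact fun h => ⟨h.1, fun μ => ih (h.2 μ)⟩

theorem Flat.congr {U : Set Coord} (hU : IsOpen U) {k : ℕ} :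
    ∀ {f g : Coord → ℝ} {z : Coord}, z ∈ U → EqOn f g U → Flat k f z → Flat k g z := by
  induction k with
  | zero => exact fun hz h hf => (h hz).symm.trans hf
  | succ k ih => exact fun hz h hf => ⟨(h hz).symm.trans hf.1,
      fun μ => ih hz (pd_congr hU h μ) (hf.2 μ)⟩

theorem pd_add {U : Set Coord} (hU : IsOpen U) {f g : Coord → ℝ} (hf : ContDiffOn ℝ ∞ f U)
    (hg : ContDiffOn ℝ ∞ g U) (μ : Fin 4) :
    EqOn (pd μ (fun w => f w + g w)) (fun w => pd μ f w + pd μ g w) U := fun z hz => by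
  have h1 := (hf.contDiffAt (hU.mem_nhds hz)).differentiableAt (by simp)
  have h2 := (hg.contDiffAt (hU.mem_nhds hz)).differentiableAt (by simp)
  simp only [pd]
  rw [fderiv_fun_add h1 h2]
  rfl

theorem pd_mul {U : Set Coord} (hU : IsOpen U) {f g : Coord → ℝ} (hf : ContDiffOn ℝ ∞ f U)
    (hg : ContDiffOn ℝ ∞ g U) (μ : Fin 4) :
    EqOn (pd μ (fun w => f w * g w)) (fun w => f w * pd μ g w + pd μ f w * g w) U := fun z hz => by
  have h1 := (hf.contDiffAt (hU.mem_nhds hz)).differentiableAt (by simp)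
  have h2 := (hg.contDiffAt (hU.mem_nhds hz)).differentiableAt (by simp)
  simp only [pd]
  rw [fderiv_fun_mul h1 h2]
  simp [mul_comm]

theorem Flat.add {U : Set Coord} (hU : IsOpen U) {k : ℕ} :
    ∀ {f g : Coord → ℝ} {z : Coord}, z ∈ U → ContDiffOn ℝ ∞ f U → ContDiffOn ℝ ∞ g U →
      Flat k f z → Flat k g z → Flat k (fun w => f w + g w) z := by
  induction k with
  | zero =>
    intro f g z _ _ _ h1 h2
    simp only [Flat] at *
    simp [h1, h2]
  | succ k ih =>
    intro f g z hz hf hg h1 h2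
    refine ⟨by simp [h1.1, h2.1], fun μ => ?_⟩
    exact Flat.congr hU hz (pd_add hU hf hg μ).symm
      (ih hz (pd_contDiffOn hU hf μ) (pd_contDiffOn hU hg μ) (h1.2 μ) (h2.2 μ))

theorem Flat.mul {U : Set Coord} (hU : IsOpen U) {k : ℕ} :
    ∀ {a f : Coord → ℝ} {z : Coord}, z ∈ U → ContDiffOn ℝ ∞ a U → ContDiffOn ℝ ∞ f U →
      Flat k f z → Flat k (fun w => a w * f w) z := by
  induction k with
  | zero =>
    intro a f z _ _ _ h
    simp only [Flat] at *
    simp [h]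
  | succ k ih =>
    intro a f z hz ha hf h
    refine ⟨by simp [h.1], fun μ => ?_⟩
    have h1 := ih hz ha (pd_contDiffOn hU hf μ) (h.2 μ)
    have h2 := ih hz (pd_contDiffOn hU ha μ) hf h.pred
    exact Flat.congr hU hz (pd_mul hU ha hf μ).symm
      (Flat.add hU hz (ha.mul (pd_contDiffOn hU hf μ)) ((pd_contDiffOn hU ha μ).mul hf) h1 h2)

theorem Flat.const_zero (k : ℕ) : ∀ z, Flat k (fun _ => 0) z := by
  induction k with
  | zero => exact fun _ => rfl
  | succ k ih =>
    refine fun z => ⟨rfl, fun μ => ?_⟩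
    have : pd μ (fun _ => (0 : ℝ)) = fun _ => 0 := by
      funext w
      simp [pd]
    rw [this]
    exact ih z

theorem Flat.sum {U : Set Coord} (hU : IsOpen U) {k : ℕ} {ι : Type} (s : Finset ι)
    {f : ι → Coord → ℝ} {z : Coord} (hz : z ∈ U) (hf : ∀ i, ContDiffOn ℝ ∞ (f i) U)
    (h : ∀ i, Flat k (f i) z) : Flat k (fun w => ∑ i ∈ s, f i w) z := by
  classical
  induction s using Finset.induction_on with
  | empty => simpa using Flat.const_zero k z
  | insert a s ha ih =>
    simp only [Finset.sum_insert ha]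
    exact Flat.add hU hz (hf a) (ContDiffOn.sum fun i _ => hf i) (h a) ih

theorem eq_sum_dir (v : Coord) : v = ∑ ν, v ν • dir ν := by
  ext i
  simp [dir, Pi.single_apply]

theorem coord_contDiffOn {U : Set Coord} {σ : Coord → Coord} (hσ : ContDiffOn ℝ ∞ σ U)
    (ν : Fin 4) : ContDiffOn ℝ ∞ (fun w => σ w ν) U :=
  contDiffOn_euclidean.1 hσ ν

theorem fderiv_contDiffOn {U : Set Coord} (hU : IsOpen U) {σ : Coord → Coord}
    (hσ : ContDiffOn ℝ ∞ σ U) (μ ν : Fin 4) :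
    ContDiffOn ℝ ∞ (fun w => fderiv ℝ σ w (dir μ) ν) U :=
  contDiffOn_euclidean.1
    ((hσ.fderiv_of_isOpen hU (m := ∞) (by simp)).clm_apply contDiffOn_const) ν

theorem pd_comp {U W : Set Coord} (hU : IsOpen U) (hW : IsOpen W) {σ : Coord → Coord}
    (hσ : ContDiffOn ℝ ∞ σ U) (hm : MapsTo σ U W) {f : Coord → ℝ} (hf : ContDiffOn ℝ ∞ f W)
    (μ : Fin 4) :
    EqOn (pd μ (fun w => f (σ w))) (fun w => ∑ ν, fderiv ℝ σ w (dir μ) ν * pd ν f (σ w)) U :=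
  fun z hz => by
  have h1 := (hσ.contDiffAt (hU.mem_nhds hz)).differentiableAt (by simp)
  have h2 := (hf.contDiffAt (hW.mem_nhds (hm hz))).differentiableAt (by simp)
  simp only [pd]
  have := fderiv_comp z h2 h1
  change (fderiv ℝ (f ∘ σ) z) (dir μ) = _
  rw [this, ContinuousLinearMap.comp_apply, eq_sum_dir (fderiv ℝ σ z (dir μ))]
  simp only [map_sum, map_smul, smul_eq_mul]
  simp [← eq_sum_dir]

theorem Flat.comp {U W : Set Coord} (hU : IsOpen U) (hW : IsOpen W) {σ : Coord → Coord}
    (hσ : ContDiffOn ℝ ∞ σ U) (hm : MapsTo σ U W) {k : ℕ} :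
    ∀ {f : Coord → ℝ} {z : Coord}, z ∈ U → ContDiffOn ℝ ∞ f W → Flat k f (σ z) →
      Flat k (fun w => f (σ w)) z := by
  induction k with
  | zero => exact fun _ _ h => h
  | succ k ih =>
    intro f z hz hf h
    refine ⟨h.1, fun μ => Flat.congr hU hz (pd_comp hU hW hσ hm hf μ).symm ?_⟩
    refine Flat.sum hU _ hz (fun ν => (fderiv_contDiffOn hU hσ μ ν).mul
      ((pd_contDiffOn hW hf ν).comp hσ hm)) fun ν => ?_
    exact Flat.mul hU hz (fderiv_contDiffOn hU hσ μ ν) ((pd_contDiffOn hW hf ν).comp hσ hm)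
      (ih hz (pd_contDiffOn hW hf ν) (h.2 ν))

theorem flat_of_iterPD {U : Set Coord} (hU : IsOpen U) {z : Coord} (hz : z ∈ U) {k : ℕ} :
    ∀ {f : Coord → ℝ}, ContDiffOn ℝ ∞ f U → (∀ I : Fin 4 → ℕ, ∑ μ, I μ ≤ k → iterPD I f z = 0) →
      Flat k f z := by
  induction k with
  | zero => exact fun _ h => h 0 (by simp)
  | succ k ih =>
    refine fun hf h => ⟨h 0 (by simp), fun μ => ih (pd_contDiffOn hU hf μ) fun I hI => ?_⟩
    rw [iterPD_pd hU I μ hf hz]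
    refine h _ ?_
    simpa [Finset.sum_add_distrib, one] using hI

theorem Flat.pdn {n : ℕ} (μ : Fin 4) :
    ∀ {k : ℕ} {f : Coord → ℝ} {z : Coord}, Flat (k + n) f z → Flat k ((pd μ)^[n] f) z := by
  induction n with
  | zero => exact fun h => h
  | succ n ih => exact fun h => ih (h.2 μ)

theorem Flat.mono {k l : ℕ} (hkl : k ≤ l) {f : Coord → ℝ} {z : Coord} (h : Flat l f z) :
    Flat k f z := by
  induction hkl with
  | refl => exact h
  | step _ ih => exact ih h.pred

theorem Flat.iterPD {k : ℕ} {f : Coord → ℝ} {z : Coord} (h : Flat k f z) {I : Fin 4 → ℕ}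
    (hI : ∑ μ, I μ ≤ k) : iterPD I f z = 0 := by
  have h' : Flat (0 + I 0 + I 1 + I 2 + I 3) f z := Flat.mono (by
    rw [Fin.sum_univ_four] at hI
    omega) h
  exact (((h'.pdn 3).pdn 2).pdn 1).pdn 0


theorem pd_sum {U : Set Coord} (hU : IsOpen U) {ι : Type} (s : Finset ι) (a : ι → ℝ)
    {f : ι → Coord → ℝ} (hf : ∀ i, ContDiffOn ℝ ∞ (f i) U) (μ : Fin 4) :
    EqOn (pd μ (fun w => ∑ i ∈ s, a i * f i w)) (fun w => ∑ i ∈ s, a i * pd μ (f i) w) U :=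
  fun z hz => by
  have h : ∀ i ∈ s, DifferentiableAt ℝ (fun w => a i * f i w) z := fun i _ =>
    (((hf i).contDiffAt (hU.mem_nhds hz)).differentiableAt (by simp)).const_mul _
  simp only [pd]
  rw [fderiv_fun_sum h, _root_.sum_apply]
  refine Finset.sum_congr rfl fun i _ => ?_
  rw [fderiv_const_mul (((hf i).contDiffAt (hU.mem_nhds hz)).differentiableAt (by simp))]
  simp

theorem pdn_sum {U : Set Coord} (hU : IsOpen U) {ι : Type} (s : Finset ι) (a : ι → ℝ)
    (μ : Fin 4) (n : ℕ) : ∀ {f : ι → Coord → ℝ}, (∀ i, ContDiffOn ℝ ∞ (f i) U) →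
    EqOn ((pd μ)^[n] (fun w => ∑ i ∈ s, a i * f i w))
      (fun w => ∑ i ∈ s, a i * (pd μ)^[n] (f i) w) U := by
  induction n with
  | zero => exact fun _ _ _ => rfl
  | succ n ih =>
    exact fun hf => (pdn_congr hU μ n (pd_sum hU s a hf μ)).trans
      (ih fun i => pd_contDiffOn hU (hf i) μ)

theorem iterPD_sum {U : Set Coord} (hU : IsOpen U) {ι : Type} (s : Finset ι) (a : ι → ℝ)
    {f : ι → Coord → ℝ} (hf : ∀ i, ContDiffOn ℝ ∞ (f i) U) (I : Fin 4 → ℕ) :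
    EqOn (iterPD I (fun w => ∑ i ∈ s, a i * f i w))
      (fun w => ∑ i ∈ s, a i * iterPD I (f i) w) U := by
  have h3 := fun i => pdn_contDiffOn hU 3 (I 3) (hf i)
  have h2 := fun i => pdn_contDiffOn hU 2 (I 2) (h3 i)
  have h1 := fun i => pdn_contDiffOn hU 1 (I 1) (h2 i)
  refine (pdn_congr hU _ _ ((pdn_congr hU _ _ ((pdn_congr hU _ _
    (pdn_sum hU s a 3 _ hf)).trans (pdn_sum hU s a 2 _ h3))).trans (pdn_sum hU s a 1 _ h2))).trans
    (pdn_sum hU s a 0 _ h1)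

theorem iterPD_sub {U : Set Coord} (hU : IsOpen U) {f g : Coord → ℝ} (hf : ContDiffOn ℝ ∞ f U)
    (hg : ContDiffOn ℝ ∞ g U) (I : Fin 4 → ℕ) :
    EqOn (iterPD I (fun w => f w - g w)) (fun w => iterPD I f w - iterPD I g w) U := by
  have h := iterPD_sum hU (Finset.univ : Finset (Fin 2)) ![1, -1] (f := ![f, g])
    (by intro i; fin_cases i <;> assumption) I
  simpa [← sub_eq_add_neg] using h

/-- Divided powers with integer exponents, zero for negative exponents. -/
def dpow (n : ℤ) (t : ℝ) : ℝ := if n < 0 then 0 else t ^ n.toNat / (n.toNat.factorial : ℝ)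

theorem dpow_nat (n : ℕ) (t : ℝ) : dpow n t = t ^ n / (n.factorial : ℝ) := by
  simp [dpow]

theorem dpow_zero (n : ℤ) : dpow n 0 = if n = 0 then 1 else 0 := by
  rcases lt_trichotomy n 0 with h | h | h
  · simp [dpow, h, h.ne]
  · simp [dpow, h]
  · have : n.toNat ≠ 0 := by omega
    simp [dpow, h.not_gt, h.ne', this]

theorem hasDerivAt_dpow (n : ℤ) (t : ℝ) : HasDerivAt (dpow n) (dpow (n - 1) t) t := by
  rcases lt_trichotomy n 0 with h | h | h
  · have e : dpow n = fun _ => 0 := by funext s; simp [dpow, h]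
    have e' : dpow (n - 1) t = 0 := by simp [dpow, h.trans_le' (by omega : n - 1 ≤ n)]
    rw [e, e']
    exact hasDerivAt_const _ _
  · subst h
    have e : dpow 0 = fun _ => 1 := by funext s; simp [dpow]
    have e' : dpow (0 - 1) t = 0 := by simp [dpow]
    rw [e, e']
    exact hasDerivAt_const _ _
  · obtain ⟨m, rfl⟩ : ∃ m : ℕ, n = (m : ℤ) + 1 := ⟨(n - 1).toNat, by omega⟩
    have e : dpow ((m : ℤ) + 1) = fun s => s ^ (m + 1) / ((m + 1).factorial : ℝ) := by
      funext s
      exact_mod_cast dpow_nat (m + 1) s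
    rw [e, add_sub_cancel_right, dpow_nat]
    have := (hasDerivAt_pow (m + 1) t).div_const ((m + 1).factorial : ℝ)
    have e2 : ((m + 1 : ℕ) : ℝ) * t ^ (m + 1 - 1) / ((m + 1).factorial : ℝ) =
        t ^ m / (m.factorial : ℝ) := by
      rw [Nat.factorial_succ, Nat.add_sub_cancel]
      push_cast
      have h1 : ((m : ℝ) + 1) ≠ 0 := by positivity
      have h2 : (m.factorial : ℝ) ≠ 0 := by positivity
      field_simp
    rwa [e2] at this

/-- The divided power `(w - x)^J / J!`, with integer exponents. -/
def mono (x : Coord) (J : Fin 4 → ℤ) (w : Coord) : ℝ := ∏ μ, dpow (J μ) (w μ - x μ)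

theorem mono_contDiff (x : Coord) (J : Fin 4 → ℤ) : ContDiff ℝ ∞ (mono x J) := by
  unfold mono
  refine contDiff_prod fun μ _ => ?_
  by_cases h : J μ < 0
  · simp only [dpow, h, if_true]
    exact contDiff_const
  · simp only [dpow, h, if_false]
    fun_prop

theorem pd_mono (μ : Fin 4) (x : Coord) (J : Fin 4 → ℤ) :
    pd μ (mono x J) = mono x (J - Pi.single μ 1) := by
  funext w
  have h : HasFDerivAt (mono x J) (∑ ν, (∏ κ ∈ Finset.univ.erase ν, dpow (J κ) (w κ - x κ)) •
      (dpow (J ν - 1) (w ν - x ν) • (EuclideanSpace.proj ν : Coord →L[ℝ] ℝ))) w := by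
    unfold mono
    refine HasFDerivAt.finsetProd fun ν _ => ?_
    have h1 : HasFDerivAt (fun y : Coord => y ν - x ν) (EuclideanSpace.proj ν : Coord →L[ℝ] ℝ) w :=
      (EuclideanSpace.proj ν : Coord →L[ℝ] ℝ).hasFDerivAt.sub_const _
    exact HasDerivAt.comp_hasFDerivAt (h₂ := dpow (J ν)) (f := fun y : Coord => y ν - x ν) w
      (hasDerivAt_dpow (J ν) (w ν - x ν)) h1
  unfold pd
  rw [h.fderiv, _root_.sum_apply, Finset.sum_eq_single μ]
  · simp only [mono, dir]
    rw [← Finset.mul_prod_erase _ _ (Finset.mem_univ μ)]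
    simp
    rw [mul_comm]
    congr 1
    exact Finset.prod_congr rfl fun κ hκ => by simp [Finset.ne_of_mem_erase hκ]
  · intro ν _ hν
    simp [dir, hν]
  · simp

theorem pdn_mono (μ : Fin 4) (x : Coord) (n : ℕ) :
    ∀ J : Fin 4 → ℤ, (pd μ)^[n] (mono x J) = mono x (J - Pi.single μ (n : ℤ)) := by
  induction n with
  | zero => intro J; simp
  | succ n ih =>
    intro J
    rw [Function.iterate_succ_apply, pd_mono, ih]
    congr 1
    funext ν
    by_cases h : ν = μ
    · subst h; simp; ring
    · simp [h]

theorem iterPD_mono (I : Fin 4 → ℕ) (x : Coord) (J : Fin 4 → ℤ) :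
    iterPD I (mono x J) = mono x (fun μ => J μ - I μ) := by
  simp only [iterPD, pdn_mono]
  congr 1
  funext ν
  fin_cases ν <;> simp

theorem poly_eq {k : ℕ} (x : Coord) (v : JetFib k) (w : Coord) (c : Comp) :
    poly x v w c = ∑ J : MultiIdx k, v (J, c) * mono x (fun μ => (J.1 μ : ℤ)) w := by
  simp [poly, mono, dpow_nat]

theorem poly_contDiff {k : ℕ} (x : Coord) (v : JetFib k) (c : Comp) :
    ContDiff ℝ ∞ (fun w => poly x v w c) := by
  simp only [poly_eq]
  exact ContDiff.sum fun J _ => contDiff_const.mul (mono_contDiff _ _)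

theorem jet_poly {k : ℕ} (x : Coord) (v : JetFib k) : jet k (poly x v) x = v := by
  funext ⟨I, c⟩
  simp only [jet, poly_eq]
  have := iterPD_sum isOpen_univ Finset.univ (fun J : MultiIdx k => v (J, c))
    (f := fun J => mono x (fun μ => (J.1 μ : ℤ))) (fun J => (mono_contDiff _ _).contDiffOn) I.1
    (mem_univ x)
  rw [this]
  show ∑ J : MultiIdx k, v (J, c) * iterPD I.1 (mono x fun μ => (J.1 μ : ℤ)) x = v (I, c)
  rw [Finset.sum_eq_single I]
  · simp [iterPD_mono, mono, dpow_zero]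
  · intro J _ hJ
    have : ∃ μ, J.1 μ ≠ I.1 μ := by
      by_contra h
      push Not at h
      exact hJ (Subtype.ext (funext h))
    obtain ⟨μ, hμ⟩ := this
    rw [iterPD_mono, mono, Finset.prod_eq_zero (Finset.mem_univ μ), mul_zero]
    rw [sub_self, dpow_zero, if_neg]
    omega
  · simp

/-! ### Change of coordinates of sections and jets -/

theorem pull_contDiffOn {U W : Set Coord} (hU : IsOpen U) {σ : Coord → Coord}
    (hσ : ContDiffOn ℝ ∞ σ U) (hm : MapsTo σ U W) {s : Coord → Comp → ℝ}
    (hs : ∀ c, ContDiffOn ℝ ∞ (fun w => s w c) W) (c : Comp) :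
    ContDiffOn ℝ ∞ (fun w => pull σ s w c) U := by
  rcases c with q | u
  · exact ContDiffOn.sum fun κ _ => ContDiffOn.sum fun l _ =>
      ((fderiv_contDiffOn hU hσ _ _).mul (fderiv_contDiffOn hU hσ _ _)).mul ((hs _).comp hσ hm)
  · exact (hs _).comp hσ hm

theorem pull_flat {U W : Set Coord} (hU : IsOpen U) (hW : IsOpen W) {σ : Coord → Coord}
    (hσ : ContDiffOn ℝ ∞ σ U) (hm : MapsTo σ U W) {s : Coord → Comp → ℝ}
    (hs : ∀ c, ContDiffOn ℝ ∞ (fun w => s w c) W) {k : ℕ} {z : Coord} (hz : z ∈ U)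
    (h : ∀ c, Flat k (fun w => s w c) (σ z)) (c : Comp) : Flat k (fun w => pull σ s w c) z := by
  rcases c with q | u
  · have hd := fun (q : SymIdx) κ l => (fderiv_contDiffOn hU hσ q.1.1 κ).mul
      (fderiv_contDiffOn hU hσ q.1.2 l)
    have hc := fun c => (hs c).comp hσ hm
    refine Flat.sum hU _ hz (fun κ => ContDiffOn.sum fun l _ => (hd q κ l).mul (hc _)) fun κ => ?_
    refine Flat.sum hU _ hz (fun l => (hd q κ l).mul (hc _)) fun l => ?_
    exact Flat.mul hU hz (hd q κ l) (hc _) (Flat.comp hU hW hσ hm hz (hs _) (h _))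
  · exact Flat.comp hU hW hσ hm hz (hs _) (h _)

theorem jet_pull_congr {U W : Set Coord} (hU : IsOpen U) (hW : IsOpen W) {σ : Coord → Coord}
    (hσ : ContDiffOn ℝ ∞ σ U) (hm : MapsTo σ U W) {s s' : Coord → Comp → ℝ}
    (hs : ∀ c, ContDiffOn ℝ ∞ (fun w => s w c) W) (hs' : ∀ c, ContDiffOn ℝ ∞ (fun w => s' w c) W)
    {k : ℕ} {z : Coord} (hz : z ∈ U) (h : jet k s (σ z) = jet k s' (σ z)) :
    jet k (pull σ s) z = jet k (pull σ s') z := by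
  have hd : ∀ c, ContDiffOn ℝ ∞ (fun w => (fun w c => s w c - s' w c) w c) W :=
    fun c => (hs c).sub (hs' c)
  have hf : ∀ c, Flat k (fun w => (fun w c => s w c - s' w c) w c) (σ z) := fun c =>
    flat_of_iterPD hW (hm hz) (hd c) fun I hI => by
      have e := iterPD_sub hW (hs c) (hs' c) I (hm hz)
      refine e.trans (sub_eq_zero.2 ?_)
      exact congrFun h (⟨I, hI⟩, c)
  funext ⟨I, c⟩
  have h0 := (pull_flat hU hW hσ hm hd hz hf c).iterPD I.2
  have e : (fun w => pull σ (fun w c => s w c - s' w c) w c) =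
      fun w => pull σ s w c - pull σ s' w c := by
    funext w
    rcases c with q | u
    · simp only [pull, mul_sub, Finset.sum_sub_distrib]
    · rfl
  rw [e, iterPD_sub hU (pull_contDiffOn hU hσ hm hs c) (pull_contDiffOn hU hσ hm hs' c) I.1 hz]
    at h0
  exact sub_eq_zero.1 h0

theorem jet_congr {U : Set Coord} (hU : IsOpen U) {s s' : Coord → Comp → ℝ} (h : EqOn s s' U)
    (k : ℕ) {z : Coord} (hz : z ∈ U) : jet k s z = jet k s' z := by
  funext ⟨I, c⟩
  exact iterPD_congr hU I.1 (fun w hw => congrFun (h hw) c) hz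

theorem sym_comm (μ ν : Fin 4) : sym μ ν = sym ν μ := by
  simp only [sym, min_comm, max_comm]

theorem sym_self (q : SymIdx) : sym q.1.1 q.1.2 = q := by
  apply Subtype.ext
  simp [sym, min_eq_left q.2, max_eq_right q.2]

theorem pull_sym (σ : Coord → Coord) (s : Coord → Comp → ℝ) (w : Coord) (μ ν : Fin 4) :
    pull σ s w (Sum.inl (sym μ ν)) = ∑ κ, ∑ l, fderiv ℝ σ w (dir μ) κ * fderiv ℝ σ w (dir ν) l *
      s (σ w) (Sum.inl (sym κ l)) := by
  rcases le_total μ ν with h | h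
  · simp only [pull, sym, min_eq_left h, max_eq_right h]
  · simp only [pull, sym, min_eq_right h, max_eq_left h]
    rw [Finset.sum_comm]
    refine Finset.sum_congr rfl fun κ _ => Finset.sum_congr rfl fun l _ => ?_
    simp only [min_comm l κ, max_comm l κ]
    ring

theorem pull_congr {U : Set Coord} (hU : IsOpen U) {σ σ' : Coord → Coord} (h : EqOn σ σ' U)
    (s : Coord → Comp → ℝ) : EqOn (pull σ s) (pull σ' s) U := fun z hz => by
  funext c
  have e : fderiv ℝ σ z = fderiv ℝ σ' z :=
    Filter.EventuallyEq.fderiv_eq (h.eventuallyEq_of_mem (hU.mem_nhds hz))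
  unfold pull
  rw [e, h hz]

theorem pull_id (s : Coord → Comp → ℝ) : pull id s = s := by
  funext w c
  rcases c with q | u
  · simp [pull, dir, sym_self]
  · rfl

theorem fderiv_comp_apply {U W : Set Coord} (hU : IsOpen U) (hW : IsOpen W) {σ ρ : Coord → Coord}
    (hσ : ContDiffOn ℝ ∞ σ W) (hρ : ContDiffOn ℝ ∞ ρ U) (hm : MapsTo ρ U W) {z : Coord}
    (hz : z ∈ U) (v : Coord) (κ : Fin 4) :
    fderiv ℝ (fun w => σ (ρ w)) z v κ =
      ∑ ν, fderiv ℝ ρ z v ν * fderiv ℝ σ (ρ z) (dir ν) κ := by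
  have h1 := (hρ.contDiffAt (hU.mem_nhds hz)).differentiableAt (by simp)
  have h2 := (hσ.contDiffAt (hW.mem_nhds (hm hz))).differentiableAt (by simp)
  have := fderiv_comp z h2 h1
  change (fderiv ℝ (σ ∘ ρ) z) v κ = _
  rw [this, ContinuousLinearMap.comp_apply, eq_sum_dir (fderiv ℝ ρ z v)]
  simp only [map_sum, map_smul]
  simp [← eq_sum_dir]

theorem sum_aux (A B : Fin 4 → ℝ) (C S : Fin 4 → Fin 4 → ℝ) :
    ∑ κ, ∑ l, A κ * B l * ∑ a, ∑ b, C κ a * C l b * S a b =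
      ∑ a, ∑ b, (∑ κ, A κ * C κ a) * (∑ l, B l * C l b) * S a b := by
  have h1 : ∀ κ l, A κ * B l * ∑ a, ∑ b, C κ a * C l b * S a b =
      ∑ a, ∑ b, A κ * C κ a * (B l * C l b) * S a b := fun κ l => by
    simp only [Finset.mul_sum]
    exact Finset.sum_congr rfl fun a _ => Finset.sum_congr rfl fun b _ => by ring
  have h2 : ∀ a b, (∑ κ, A κ * C κ a) * (∑ l, B l * C l b) * S a b =
      ∑ κ, ∑ l, A κ * C κ a * (B l * C l b) * S a b := fun a b => by
    rw [Finset.sum_mul_sum, Finset.sum_mul]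
    exact Finset.sum_congr rfl fun _ _ => Finset.sum_mul _ _ _
  simp only [h1, h2]
  calc _ = ∑ κ, ∑ a, ∑ l, ∑ b, A κ * C κ a * (B l * C l b) * S a b :=
        Finset.sum_congr rfl fun _ _ => Finset.sum_comm
    _ = ∑ a, ∑ κ, ∑ l, ∑ b, A κ * C κ a * (B l * C l b) * S a b := Finset.sum_comm
    _ = ∑ a, ∑ κ, ∑ b, ∑ l, A κ * C κ a * (B l * C l b) * S a b :=
        Finset.sum_congr rfl fun _ _ => Finset.sum_congr rfl fun _ _ => Finset.sum_comm
    _ = _ := Finset.sum_congr rfl fun _ _ => Finset.sum_comm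

theorem pull_pull {U W : Set Coord} (hU : IsOpen U) (hW : IsOpen W) {σ ρ : Coord → Coord}
    (hσ : ContDiffOn ℝ ∞ σ W) (hρ : ContDiffOn ℝ ∞ ρ U) (hm : MapsTo ρ U W)
    (s : Coord → Comp → ℝ) :
    EqOn (pull ρ (pull σ s)) (pull (fun w => σ (ρ w)) s) U := fun z hz => by
  funext c
  rcases c with q | u
  · rw [← sym_self q]
    simp only [pull_sym, fderiv_comp_apply hU hW hσ hρ hm hz]
    exact sum_aux _ _ (fun κ a => fderiv ℝ σ (ρ z) (dir κ) a) fun a b => s (σ (ρ z)) (Sum.inl (sym a b))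
  · rfl

theorem ofColumns_apply {ι ι' : Type} [Fintype ι] [Fintype ι'] (c : ι → ι' → ℝ) (v : ι → ℝ)
    (r : ι') : ofColumns c v r = ∑ q, v q * c q r := by
  simp [ofColumns, Fintype.linearCombination_apply]

theorem contDiffOn_ofColumns {ι ι' : Type} [Fintype ι] [Fintype ι'] {c : Coord → ι → ι' → ℝ}
    {U : Set Coord} (h : ∀ q r, ContDiffOn ℝ ∞ (fun z => c z q r) U) :
    ContDiffOn ℝ ∞ (fun z => ofColumns (c z)) U := by
  classical
  have e : ∀ z, ofColumns (c z) = ∑ q, ∑ r, c z q r •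
      (ofColumns (Pi.single q (Pi.single r 1)) : (ι → ℝ) →L[ℝ] (ι' → ℝ)) := by
    intro z
    refine ContinuousLinearMap.ext fun v => funext fun r => ?_
    simp only [_root_.sum_apply, Finset.sum_apply, _root_.smul_apply,
      Pi.smul_apply, ofColumns_apply, smul_eq_mul]
    refine Finset.sum_congr rfl fun q _ => ?_
    rw [Finset.sum_eq_single r, Finset.sum_eq_single q]
    · simp [mul_comm]
    · intro b _ hb
      simp [hb]
    · simp
    · intro b _ hb
      simp only [Finset.mul_sum]
      refine Finset.sum_eq_zero fun a _ => ?_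
      by_cases ha : a = q
      · subst ha
        simp [hb.symm]
      · simp [ha]
    · simp
  simp only [e]
  exact ContDiffOn.sum fun q _ => ContDiffOn.sum fun r _ => (h q r).smul contDiffOn_const

theorem poly_linear {k : ℕ} (x : Coord) (v : JetFib k) (w : Coord) (c : Comp) :
    poly x v w c = ∑ q, v q * poly x (Pi.single q 1) w c := by
  simp only [poly, Finset.mul_sum]
  rw [Finset.sum_comm]
  refine Finset.sum_congr rfl fun J _ => ?_
  rw [Finset.sum_eq_single (J, c)]
  · simp
  · intro b _ hb
    simp [hb.symm]
  · simp

theorem pull_poly_linear {k : ℕ} (σ : Coord → Coord) (x : Coord) (v : JetFib k) (w : Coord)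
    (c : Comp) :
    pull σ (poly x v) w c = ∑ q, v q * pull σ (poly x (Pi.single q 1)) w c := by
  rcases c with m | u
  · simp only [pull, poly_linear x v, Finset.mul_sum]
    symm
    rw [Finset.sum_comm]
    refine Finset.sum_congr rfl fun κ _ => ?_
    rw [Finset.sum_comm]
    refine Finset.sum_congr rfl fun l _ => Finset.sum_congr rfl fun q _ => by ring
  · exact poly_linear x v _ _

theorem jetChange_apply {U : Set Coord} (hU : IsOpen U) {σ : Coord → Coord}
    (hσ : ContDiffOn ℝ ∞ σ U) (k : ℕ) {z : Coord} (hz : z ∈ U) (v : JetFib k) :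
    jetChange k σ z v = jet k (pull σ (poly (σ z) v)) z := by
  funext ⟨I, c⟩
  simp only [jetChange, ofColumns_apply, jet, pull_poly_linear σ (σ z) v]
  exact (iterPD_sum hU Finset.univ v (f := fun q w => pull σ (poly (σ z) (Pi.single q 1)) w c)
    (fun q => pull_contDiffOn hU hσ (mapsTo_univ _ _)
      (fun c => (poly_contDiff _ _ c).contDiffOn) c) I.1 hz).symm

theorem jetChange_congr {U : Set Coord} (hU : IsOpen U) {σ σ' : Coord → Coord} (h : EqOn σ σ' U)
    (k : ℕ) {z : Coord} (hz : z ∈ U) : jetChange k σ z = jetChange k σ' z := by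
  unfold jetChange
  congr 1
  funext q
  rw [h hz]
  exact jet_congr hU (pull_congr hU h _) k hz

theorem jetChange_id (k : ℕ) (z : Coord) (v : JetFib k) : jetChange k id z v = v := by
  rw [jetChange_apply isOpen_univ contDiffOn_id k (mem_univ z), pull_id]
  exact jet_poly z v

theorem jetChange_comp {U W : Set Coord} (hU : IsOpen U) (hW : IsOpen W) {σ ρ : Coord → Coord}
    (hσ : ContDiffOn ℝ ∞ σ W) (hρ : ContDiffOn ℝ ∞ ρ U) (hm : MapsTo ρ U W) (k : ℕ) {z : Coord}
    (hz : z ∈ U) (v : JetFib k) :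
    jetChange k ρ z (jetChange k σ (ρ z) v) = jetChange k (fun w => σ (ρ w)) z v := by
  have hs : ∀ c, ContDiffOn ℝ ∞ (fun w => pull σ (poly (σ (ρ z)) v) w c) W :=
    pull_contDiffOn hW hσ (mapsTo_univ _ _) fun c => (poly_contDiff _ _ c).contDiffOn
  rw [jetChange_apply hU hρ k hz, jetChange_apply hU (σ := fun w => σ (ρ w)) (hσ.comp hρ hm) k hz,
    jetChange_apply hW hσ k (hm hz),
    ← jet_congr hU (pull_pull hU hW hσ hρ hm (poly (σ (ρ z)) v)) k hz]
  exact jet_pull_congr hU hW hρ hm (fun c => (poly_contDiff _ _ c).contDiffOn) hs hz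
    (jet_poly _ _)

/-- The partial derivative in the first variable of a function of two points. -/
def pdJ (μ : Fin 4) (G : Coord × Coord → ℝ) : Coord × Coord → ℝ :=
  fun p => pd μ (fun w => G (w, p.2)) p.1

theorem pdJ_contDiffOn {O : Set (Coord × Coord)} (hO : IsOpen O) {G : Coord × Coord → ℝ}
    (hG : ContDiffOn ℝ ∞ G O) (μ : Fin 4) : ContDiffOn ℝ ∞ (pdJ μ G) O := by
  have h1 : ContDiffOn ℝ ∞ (fun p => fderiv ℝ G p (dir μ, 0)) O :=
    (hG.fderiv_of_isOpen hO (m := ∞) (by simp)).clm_apply contDiffOn_const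
  refine h1.congr fun p hp => ?_
  have h2 : HasFDerivAt G (fderiv ℝ G (p.1, p.2)) (p.1, p.2) :=
    ((hG.contDiffAt (hO.mem_nhds hp)).differentiableAt (by simp)).hasFDerivAt
  have h3 : HasFDerivAt (fun w => G (w, p.2)) _ p.1 :=
    h2.comp (f := fun w : Coord => (w, p.2)) p.1 (hasFDerivAt_prodMk_left p.1 p.2)
  simp only [pdJ, pd]
  rw [h3.fderiv]
  simp

theorem pdnJ_contDiffOn {O : Set (Coord × Coord)} (hO : IsOpen O) (μ : Fin 4) (n : ℕ) :
    ∀ {G : Coord × Coord → ℝ}, ContDiffOn ℝ ∞ G O → ContDiffOn ℝ ∞ ((pdJ μ)^[n] G) O := by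
  induction n with
  | zero => exact fun h => h
  | succ n ih => exact fun h => ih (pdJ_contDiffOn hO h μ)

theorem pdn_eq_pdnJ (μ : Fin 4) (n : ℕ) : ∀ (G : Coord × Coord → ℝ) (a : Coord),
    (pd μ)^[n] (fun w => G (w, a)) = fun w => (pdJ μ)^[n] G (w, a) := by
  induction n with
  | zero => exact fun _ _ => rfl
  | succ n ih => exact fun G a => ih (pdJ μ G) a

theorem iterPD_joint {O : Set (Coord × Coord)} (hO : IsOpen O) {G : Coord × Coord → ℝ}
    (hG : ContDiffOn ℝ ∞ G O) (I : Fin 4 → ℕ) :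
    ContDiffOn ℝ ∞ (fun p : Coord × Coord => iterPD I (fun w => G (w, p.2)) p.1) O := by
  simp only [iterPD, pdn_eq_pdnJ]
  exact pdnJ_contDiffOn hO _ _ (pdnJ_contDiffOn hO _ _ (pdnJ_contDiffOn hO _ _
    (pdnJ_contDiffOn hO _ _ hG)))

theorem poly_joint {k : ℕ} (v : JetFib k) (c : Comp) {O : Set (Coord × Coord)}
    {f g : Coord × Coord → Coord} (hf : ContDiffOn ℝ ∞ f O) (hg : ContDiffOn ℝ ∞ g O) :
    ContDiffOn ℝ ∞ (fun p => poly (g p) v (f p) c) O := by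
  unfold poly
  refine ContDiffOn.sum fun J _ => contDiffOn_const.mul (contDiffOn_prod fun μ _ => ?_)
  have h1 := contDiffOn_euclidean.1 hf μ
  have h2 := contDiffOn_euclidean.1 hg μ
  exact ((h1.sub h2).pow _).div_const _

theorem pull_joint {U : Set Coord} (hU : IsOpen U) {σ : Coord → Coord}
    (hσ : ContDiffOn ℝ ∞ σ U) {k : ℕ} (v : JetFib k) (c : Comp) :
    ContDiffOn ℝ ∞ (fun p : Coord × Coord => pull σ (poly p.2 v) p.1 c)
      (U ×ˢ (univ : Set Coord)) := by
  have h1 : ContDiffOn ℝ ∞ (fun p : Coord × Coord => p.1) (U ×ˢ (univ : Set Coord)) :=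
    contDiff_fst.contDiffOn
  have h2 : ContDiffOn ℝ ∞ (fun p : Coord × Coord => p.2) (U ×ˢ (univ : Set Coord)) :=
    contDiff_snd.contDiffOn
  have hm : MapsTo (fun p : Coord × Coord => p.1) (U ×ˢ (univ : Set Coord)) U := fun p hp => hp.1
  have h3 : ContDiffOn ℝ ∞ (fun p : Coord × Coord => σ p.1) (U ×ˢ (univ : Set Coord)) :=
    hσ.comp h1 hm
  have hs := fun c => poly_joint v c h3 h2
  have hd : ∀ μ κ, ContDiffOn ℝ ∞ (fun p : Coord × Coord => fderiv ℝ σ p.1 (dir μ) κ)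
      (U ×ˢ (univ : Set Coord)) := fun μ κ => (fderiv_contDiffOn hU hσ μ κ).comp h1 hm
  rcases c with m | u
  · simp only [pull]
    exact ContDiffOn.sum fun κ _ => ContDiffOn.sum fun l _ => ((hd _ _).mul (hd _ _)).mul (hs _)
  · simp only [pull]
    exact hs _

theorem jet_joint {U : Set Coord} (hU : IsOpen U) {σ : Coord → Coord}
    (hσ : ContDiffOn ℝ ∞ σ U) {k : ℕ} (v : JetFib k) (I : Fin 4 → ℕ) (c : Comp) :
    ContDiffOn ℝ ∞ (fun z => iterPD I (fun w => pull σ (poly (σ z) v) w c) z) U := by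
  have h3 : ContDiffOn ℝ ∞ (fun z : Coord => (z, σ z)) U := contDiffOn_id.prodMk hσ
  have h4 : MapsTo (fun z : Coord => (z, σ z)) U (U ×ˢ (univ : Set Coord)) :=
    fun z hz => ⟨hz, mem_univ _⟩
  have key : ∀ G : Coord × Coord → ℝ, ContDiffOn ℝ ∞ G (U ×ˢ (univ : Set Coord)) →
      ContDiffOn ℝ ∞ (fun z => iterPD I (fun w => G (w, σ z)) z) U := fun G hG =>
    ContDiffOn.comp (iterPD_joint (hU.prod isOpen_univ) hG I) h3 h4
  exact key (fun p => pull σ (poly p.2 v) p.1 c) (pull_joint hU hσ v c)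

theorem jetChange_contDiffOn {U : Set Coord} (hU : IsOpen U) {σ : Coord → Coord}
    (hσ : ContDiffOn ℝ ∞ σ U) (k : ℕ) : ContDiffOn ℝ ∞ (fun z => jetChange k σ z) U := by
  simp only [jetChange]
  exact contDiffOn_ofColumns fun q r => jet_joint hU hσ (Pi.single q 1) r.1.1 r.2

/-! ### Change of coordinates of multimomenta -/

theorem nfac_comm (μ ν : Fin 4) : nfac μ ν = nfac ν μ := by
  simp only [nfac, eq_comm]

theorem nfac_ne (μ ν : Fin 4) : nfac μ ν ≠ 0 := by
  unfold nfac
  split_ifs <;> norm_num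

theorem at_sum {k : ℕ} {ι : Type} (s : Finset ι) (a : ι → ℝ) (v : ι → JetFib k) (I : Fin 4 → ℕ)
    (c : Comp) : (∑ i ∈ s, a i • v i).at I c = ∑ i ∈ s, a i * (v i).at I c := by
  by_cases h : ∑ μ, I μ ≤ k
  · simp [JetFib.at, h]
  · simp [JetFib.at, h]

theorem pairing_sum_right (P : MomFib) {ι : Type} (s : Finset ι) (a : ι → ℝ) (v : ι → JetFib 1)
    (μ : Fin 4) : pairing P (∑ i ∈ s, a i • v i) μ = ∑ i ∈ s, a i * pairing P (v i) μ := by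
  simp only [pairing, at_sum, Finset.mul_sum]
  rw [Finset.sum_comm' (t' := Finset.univ) (s' := fun _ => s) (by simp)]
  refine Finset.sum_congr rfl fun c _ => ?_
  simp only [mul_add, Finset.sum_add_distrib, Finset.mul_sum]
  congr 1
  · exact Finset.sum_congr rfl fun i _ => by ring
  · rw [Finset.sum_comm]
    exact Finset.sum_congr rfl fun i _ => Finset.sum_congr rfl fun ν _ => by ring

theorem pairing_sum_left (P : MomFib) (v : JetFib 1) (μ : Fin 4) :
    pairing P v μ = ∑ q, P q * pairing (Pi.single q 1) v μ := by
  have h1 : ∀ c, P (Sum.inl μ, c) = ∑ q, P q * (Pi.single q 1 : MomFib) (Sum.inl μ, c) := by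
    intro c
    rw [Finset.sum_eq_single (Sum.inl μ, c)]
    · simp
    · intro b _ hb
      simp [hb.symm]
    · simp
  have h2 : ∀ m c, P (Sum.inr m, c) = ∑ q, P q * (Pi.single q 1 : MomFib) (Sum.inr m, c) := by
    intro m c
    rw [Finset.sum_eq_single (Sum.inr m, c)]
    · simp
    · intro b _ hb
      simp [hb.symm]
    · simp
  simp only [pairing, Finset.mul_sum]
  symm
  rw [Finset.sum_comm]
  refine Finset.sum_congr rfl fun c _ => ?_
  simp only [mul_add, Finset.sum_add_distrib, Finset.mul_sum]
  congr 1
  · rw [h1 c, Finset.sum_mul]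
    exact Finset.sum_congr rfl fun i _ => by ring
  · rw [Finset.sum_comm]
    refine Finset.sum_congr rfl fun ν _ => ?_
    rw [h2 _ c, Finset.mul_sum, Finset.sum_mul]
    exact Finset.sum_congr rfl fun i _ => by ring

theorem pairingChange_sum_left (σ τ : Coord → Coord) (z : Coord) (P : MomFib) (v : JetFib 1)
    (μ : Fin 4) : pairingChange σ τ z P v μ =
      ∑ q, P q * pairingChange σ τ z (Pi.single q 1) v μ := by
  simp only [pairingChange]
  simp only [pairing_sum_left P, Finset.mul_sum]
  symm
  rw [Finset.sum_comm]
  exact Finset.sum_congr rfl fun _ _ => Finset.sum_congr rfl fun _ _ => by ring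

theorem pairingChange_sum_right (σ τ : Coord → Coord) (z : Coord) (P : MomFib) {ι : Type}
    (s : Finset ι) (a : ι → ℝ) (v : ι → JetFib 1) (μ : Fin 4) :
    pairingChange σ τ z P (∑ i ∈ s, a i • v i) μ = ∑ i ∈ s, a i * pairingChange σ τ z P (v i) μ := by
  simp only [pairingChange, map_sum, map_smul, pairing_sum_right, Finset.mul_sum]
  rw [Finset.sum_comm]
  exact Finset.sum_congr rfl fun _ _ => Finset.sum_congr rfl fun _ _ => by ring

theorem momChange_inl (σ τ : Coord → Coord) (z : Coord) (P : MomFib) (μ : Fin 4) (c : Comp) :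
    momChange σ τ z P (Sum.inl μ, c) = pairingChange σ τ z P (unit 1 0 c) μ := by
  rw [momChange, ofColumns_apply, pairingChange_sum_left]

theorem momChange_inr (σ τ : Coord → Coord) (z : Coord) (P : MomFib) (m : SymIdx) (c : Comp) :
    momChange σ τ z P (Sum.inr m, c) =
      nfac m.1.1 m.1.2 * pairingChange σ τ z P (unit 1 (one m.1.1) c) m.1.2 := by
  rw [momChange, ofColumns_apply, pairingChange_sum_left, Finset.mul_sum]
  exact Finset.sum_congr rfl fun _ _ => by ring

theorem iterPD_one (μ : Fin 4) (f : Coord → ℝ) : iterPD (one μ) f = pd μ f := by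
  fin_cases μ <;> simp [iterPD, one]

theorem sum_one (μ : Fin 4) : ∑ ν, one μ ν = 1 := by simp [one]

theorem one_inj {μ ν : Fin 4} (h : one μ = one ν) : μ = ν := by
  by_contra hne
  have := congrFun h μ
  simp [one, hne] at this

theorem one_ne_zero' (μ : Fin 4) : one μ ≠ 0 := fun h => by
  have := congrFun h μ
  simp [one] at this

theorem multiIdx_one (I : MultiIdx 1) : I.1 = 0 ∨ ∃ ν, I.1 = one ν := by
  obtain ⟨I, hI⟩ := I
  rw [Fin.sum_univ_four] at hI
  by_cases h : I = 0
  · exact Or.inl h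
  · right
    obtain ⟨ν, hν⟩ := Function.ne_iff.1 h
    refine ⟨ν, funext fun κ => ?_⟩
    simp only [Pi.zero_apply] at hν
    fin_cases ν <;> fin_cases κ <;> simp [one] at * <;> omega

theorem jetFib_one_decomp (v : JetFib 1) :
    v = ∑ q : Option (Fin 4) × Comp,
      v.at (q.1.elim 0 one) q.2 • unit 1 (q.1.elim 0 one) q.2 := by
  funext ⟨I, c⟩
  have hv : v.at I.1 c = v (I, c) := by simp [JetFib.at, I.2]
  rw [Finset.sum_apply]
  obtain ⟨o, ho⟩ : ∃ o : Option (Fin 4), I.1 = o.elim 0 one := by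
    rcases multiIdx_one I with h | ⟨ν, h⟩
    · exact ⟨none, h⟩
    · exact ⟨some ν, h⟩
  rw [Finset.sum_eq_single (o, c)]
  · simp [unit, ← ho, hv]
  · rintro ⟨o', c'⟩ _ hne
    have : ¬(I.1 = o'.elim 0 one ∧ c = c') := by
      rintro ⟨h1, rfl⟩
      apply hne
      rw [ho] at h1
      rcases o with _ | ν <;> rcases o' with _ | ν'
      · rfl
      · exact absurd h1.symm (one_ne_zero' _)
      · exact absurd h1 (one_ne_zero' _)
      · rw [one_inj h1]
    simp [unit, this]
  · simp

theorem jetChange_unit_one {W : Set Coord} (hW : IsOpen W) {τ : Coord → Coord}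
    (hτ : ContDiffOn ℝ ∞ τ W) {x : Coord} (hx : x ∈ W) (ν : Fin 4) (a : Comp) :
    (∀ b, (jetChange 1 τ x (unit 1 (one ν) a)).at 0 b = 0) ∧
    ∀ l b, (jetChange 1 τ x (unit 1 (one ν) a)).at (one l) b =
      fderiv ℝ τ x (dir l) ν * pull τ (fun _ c => if c = a then 1 else 0) x b := by
  have hp : ∀ w c, poly (τ x) (unit 1 (one ν) a) w c =
      (w ν - τ x ν) * if c = a then 1 else 0 := by
    intro w c
    rw [poly, Finset.sum_eq_single (⟨one ν, (sum_one ν).le⟩ : MultiIdx 1)]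
    · rw [Finset.prod_eq_single ν]
      · simp [unit, one, mul_comm]
      · intro κ _ hκ
        simp [one, hκ]
      · simp
    · intro J _ hJ
      have : J.1 ≠ one ν := fun h => hJ (Subtype.ext h)
      simp [unit, this]
    · simp
  have hq : ∀ y b, pull τ (poly (τ x) (unit 1 (one ν) a)) y b =
      (τ y ν - τ x ν) * pull τ (fun _ c => if c = a then 1 else 0) y b := by
    intro y b
    rcases b with m | u
    · simp only [pull, hp, Finset.mul_sum]
      exact Finset.sum_congr rfl fun _ _ => Finset.sum_congr rfl fun _ _ => by ring
    · simp only [pull, hp]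
  have h1 : ContDiffOn ℝ ∞ (fun y => τ y ν - τ x ν) W :=
    (coord_contDiffOn hτ ν).sub contDiffOn_const
  have h2 : ∀ b, ContDiffOn ℝ ∞
      (fun y => pull τ (fun _ c => if c = a then 1 else 0) y b) W :=
    pull_contDiffOn hW hτ (mapsTo_univ _ _) fun c => contDiffOn_const
  rw [jetChange_apply hW hτ 1 hx]
  constructor
  · intro b
    simp [JetFib.at, jet, hq, iterPD]
  · intro l b
    have e := pd_mul hW h1 (h2 b) l hx
    have e' : pd l (fun y => τ y ν - τ x ν) x = fderiv ℝ τ x (dir l) ν := by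
      have hd := (hτ.contDiffAt (hW.mem_nhds hx)).differentiableAt (by simp)
      have := (EuclideanSpace.proj ν : Coord →L[ℝ] ℝ).hasFDerivAt.comp x hd.hasFDerivAt
      have := this.sub_const (τ x ν)
      unfold pd
      have e2 : fderiv ℝ (fun y => τ y ν - τ x ν) x = _ := HasFDerivAt.fderiv this
      rw [e2]
      simp
    simp only [JetFib.at, sum_one, le_refl, dif_pos, jet, hq, iterPD_one]
    rw [e]
    simp only [e', sub_self, zero_mul, zero_add]

theorem pairingChange_symm {W : Set Coord} (hW : IsOpen W) (σ : Coord → Coord) {τ : Coord → Coord}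
    (hτ : ContDiffOn ℝ ∞ τ W) {z : Coord} (hz : σ z ∈ W) (P : MomFib) (μ ν : Fin 4) (a : Comp) :
    pairingChange σ τ z P (unit 1 (one ν) a) μ = pairingChange σ τ z P (unit 1 (one μ) a) ν := by
  simp only [pairingChange, pairing, (jetChange_unit_one hW hτ hz _ a).1,
    (jetChange_unit_one hW hτ hz _ a).2]
  congr 1
  simp only [mul_zero, zero_add, Finset.mul_sum]
  have : ∀ (α β : Fin 4), (∑ κ, ∑ c, ∑ l, fderiv ℝ τ (σ z) (dir κ) α * ((nfac l κ)⁻¹ *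
      P (Sum.inr (sym l κ), c) * (fderiv ℝ τ (σ z) (dir l) β *
        pull τ (fun _ c => if c = a then 1 else 0) (σ z) c))) =
      ∑ c, ∑ κ, ∑ l, fderiv ℝ τ (σ z) (dir κ) α * ((nfac l κ)⁻¹ *
      P (Sum.inr (sym l κ), c) * (fderiv ℝ τ (σ z) (dir l) β *
        pull τ (fun _ c => if c = a then 1 else 0) (σ z) c)) := fun α β => Finset.sum_comm
  rw [this, this]
  refine Finset.sum_congr rfl fun c _ => ?_
  rw [Finset.sum_comm]
  refine Finset.sum_congr rfl fun κ _ => Finset.sum_congr rfl fun l _ => ?_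
  rw [sym_comm κ l, nfac_comm κ l]
  ring

theorem pairing_momChange {W : Set Coord} (hW : IsOpen W) (σ : Coord → Coord) {τ : Coord → Coord}
    (hτ : ContDiffOn ℝ ∞ τ W) {z : Coord} (hz : σ z ∈ W) (P : MomFib) (v : JetFib 1) (μ : Fin 4) :
    pairing (momChange σ τ z P) v μ = pairingChange σ τ z P v μ := by
  conv_rhs => rw [jetFib_one_decomp v, pairingChange_sum_right]
  have h : ∀ ν c, (nfac ν μ)⁻¹ * momChange σ τ z P (Sum.inr (sym ν μ), c) =
      pairingChange σ τ z P (unit 1 (one ν) c) μ := by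
    intro ν c
    rw [momChange_inr]
    rcases le_total ν μ with h | h
    · simp only [sym, min_eq_left h, max_eq_right h]
      rw [inv_mul_cancel_left₀ (nfac_ne _ _)]
    · simp only [sym, min_eq_right h, max_eq_left h]
      rw [nfac_comm, inv_mul_cancel_left₀ (nfac_ne _ _), pairingChange_symm hW σ hτ hz]
  simp only [pairing, h, momChange_inl]
  rw [Fintype.sum_prod_type_right]
  refine Finset.sum_congr rfl fun c _ => ?_
  rw [Fintype.sum_option]
  simp only [Option.elim]
  congr 1
  · ring
  · exact Finset.sum_congr rfl fun _ _ => by ring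

theorem momChange_ext {P P' : MomFib} (h : ∀ v μ, pairing P v μ = pairing P' v μ) : P = P' := by
  have h1 : ∀ (P : MomFib) c μ, P (Sum.inl μ, c) = pairing P (unit 1 0 c) μ := by
    intro P c μ
    rw [pairing, Finset.sum_eq_single c]
    · simp [JetFib.at, unit, one_ne_zero', sum_one]
    · intro b _ hb
      simp [JetFib.at, unit, hb]
    · simp
  have h2 : ∀ (P : MomFib) c (m : SymIdx), P (Sum.inr m, c) =
      nfac m.1.1 m.1.2 * pairing P (unit 1 (one m.1.1) c) m.1.2 := by
    intro P c m
    rw [pairing, Finset.sum_eq_single c]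
    · rw [Finset.sum_eq_single m.1.1]
      · simp [JetFib.at, unit, (one_ne_zero' _).symm, sum_one, sym_self, nfac_ne]
      · intro b _ hb
        have : one b ≠ one m.1.1 := fun h => hb (one_inj h)
        simp [JetFib.at, unit, this]
      · simp
    · intro b _ hb
      simp [JetFib.at, unit, hb]
    · simp
  funext ⟨q, c⟩
  rcases q with μ | m
  · rw [h1 P, h1 P', h]
  · rw [h2 P, h2 P', h]

theorem momChange_congr {U W : Set Coord} (hU : IsOpen U) (hW : IsOpen W)
    {σ σ' τ τ' : Coord → Coord} (h : EqOn σ σ' U) (h' : EqOn τ τ' W) {z : Coord} (hz : z ∈ U)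
    (hz' : σ z ∈ W) : momChange σ τ z = momChange σ' τ' z := by
  have e1 : fderiv ℝ σ z = fderiv ℝ σ' z :=
    Filter.EventuallyEq.fderiv_eq (h.eventuallyEq_of_mem (hU.mem_nhds hz))
  have e2 : fderiv ℝ τ (σ z) = fderiv ℝ τ' (σ z) :=
    Filter.EventuallyEq.fderiv_eq (h'.eventuallyEq_of_mem (hW.mem_nhds hz'))
  have e3 : pairingChange σ τ z = pairingChange σ' τ' z := by
    funext P v μ
    simp only [pairingChange, ← h hz, e1, e2, jetChange_congr hW h' 1 hz']
  unfold momChange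
  rw [e3]

theorem momChange_id (z : Coord) (P : MomFib) : momChange id id z P = P := by
  refine momChange_ext fun v μ => ?_
  rw [pairing_momChange isOpen_univ id contDiffOn_id (mem_univ _), pairingChange]
  have hd : (ContinuousLinearMap.id ℝ Coord).det = 1 := LinearMap.det_id
  simp [jetChange_id, dir, hd]

theorem momChange_comp {U V W : Set Coord} (hU : IsOpen U) (hV : IsOpen V) (hW : IsOpen W)
    {σ τ ρ ρ' : Coord → Coord} (hσ : ContDiffOn ℝ ∞ σ V) (hτ : ContDiffOn ℝ ∞ τ W)
    (hρ : ContDiffOn ℝ ∞ ρ U) (hρ' : ContDiffOn ℝ ∞ ρ' V) (hm : MapsTo ρ U V)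
    (hm' : MapsTo τ W V) {z : Coord} (hz : z ∈ U) (hz' : σ (ρ z) ∈ W)
    (hinv : τ (σ (ρ z)) = ρ z) (P : MomFib) :
    momChange ρ ρ' z (momChange σ τ (ρ z) P) =
      momChange (fun w => σ (ρ w)) (fun w => ρ' (τ w)) z P := by
  refine momChange_ext fun v μ => ?_
  have hdet : (fderiv ℝ (fun w => σ (ρ w)) z).det =
      (fderiv ℝ ρ z).det * (fderiv ℝ σ (ρ z)).det := by
    have h1 := (hρ.contDiffAt (hU.mem_nhds hz)).differentiableAt (by simp)
    have h2 := (hσ.contDiffAt (hV.mem_nhds (hm hz))).differentiableAt (by simp)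
    have := fderiv_comp z h2 h1
    change (fderiv ℝ (σ ∘ ρ) z).det = _
    rw [this, mul_comm]
    exact LinearMap.det_comp _ _
  rw [pairing_momChange hV ρ hρ' (hm hz),
    pairing_momChange hW (fun w => σ (ρ w)) (τ := fun w => ρ' (τ w)) (hρ'.comp hτ hm') hz']
  simp only [pairingChange, hdet, pairing_momChange hW σ hτ hz',
    fderiv_comp_apply hW hV hρ' hτ hm' hz', ← jetChange_comp hW hV hρ' hτ hm' 1 hz', hinv]
  rw [mul_assoc]
  congr 1
  simp only [Finset.mul_sum, Finset.sum_mul]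
  rw [Finset.sum_comm]
  exact Finset.sum_congr rfl fun _ _ => Finset.sum_congr rfl fun _ _ => by ring

theorem at_contDiffOn {U : Set Coord} {k : ℕ} {A : Coord → JetFib k →L[ℝ] JetFib k}
    (hA : ContDiffOn ℝ ∞ A U) (v : JetFib k) (I : Fin 4 → ℕ) (c : Comp) :
    ContDiffOn ℝ ∞ (fun z => (A z v).at I c) U := by
  by_cases h : ∑ μ, I μ ≤ k
  · simp only [JetFib.at, h, dif_pos]
    exact contDiffOn_pi.1 (hA.clm_apply contDiffOn_const) _
  · simp only [JetFib.at, h, dif_neg, not_false_iff]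
    exact contDiffOn_const

theorem det_contDiffOn {U : Set Coord} (hU : IsOpen U) {σ : Coord → Coord}
    (hσ : ContDiffOn ℝ ∞ σ U) : ContDiffOn ℝ ∞ (fun z => (fderiv ℝ σ z).det) U := by
  have e : ∀ A : Coord →L[ℝ] Coord, A.det = ∑ p : Equiv.Perm (Fin 4),
      ((Equiv.Perm.sign p : ℤ) : ℝ) * ∏ i, A (dir i) (p i) := by
    intro A
    have := LinearMap.det_toMatrix (EuclideanSpace.basisFun (Fin 4) ℝ).toBasis (A : Coord →ₗ[ℝ] Coord)
    rw [ContinuousLinearMap.det, ← this, Matrix.det_apply']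
    simp [LinearMap.toMatrix_apply, dir]
  simp only [e]
  exact ContDiffOn.sum fun p _ => contDiffOn_const.mul
    (contDiffOn_prod fun i _ => fderiv_contDiffOn hU hσ _ _)

theorem momChange_contDiffOn {U W : Set Coord} (hU : IsOpen U) (hW : IsOpen W)
    {σ τ : Coord → Coord} (hσ : ContDiffOn ℝ ∞ σ U) (hτ : ContDiffOn ℝ ∞ τ W)
    (hm : MapsTo σ U W) : ContDiffOn ℝ ∞ (momChange σ τ) U := by
  have hp : ∀ P v μ, ContDiffOn ℝ ∞ (fun z => pairingChange σ τ z P v μ) U := by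
    intro P v μ
    refine (det_contDiffOn hU hσ).mul (ContDiffOn.sum fun κ _ =>
      ((fderiv_contDiffOn hW hτ _ _).comp hσ hm).mul ?_)
    have ha := fun I c => at_contDiffOn ((jetChange_contDiffOn hW hτ 1).comp hσ hm) v I c
    exact ContDiffOn.sum fun c _ => (contDiffOn_const.mul (ha _ _)).add
      (ContDiffOn.sum fun ν _ => contDiffOn_const.mul (ha _ _))
  refine contDiffOn_ofColumns fun q r => ?_
  obtain ⟨m, c⟩ := r
  rcases m with μ | m
  · exact hp _ _ _
  · exact contDiffOn_const.mul (hp _ _ _)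

/-! ### The bundles over the base manifold -/

section Bundles

variable (M : Type*) [TopologicalSpace M] [ChartedSpace Coord M]

/-- The change of coordinates from the chart `e` to the chart `e'`. -/
def trans (e e' : atlas Coord M) : Coord → Coord := fun w => e'.1 (e.1.symm w)

/-- The coordinates in the chart `e` of the points in the domains of `e`, `e'` and `e''`. -/
def overlap (e e' e'' : atlas Coord M) : Set Coord :=
  e.1.target ∩ e.1.symm ⁻¹' (e'.1.source ∩ e''.1.source)

variable {M}

theorem isOpen_overlap (e e' e'' : atlas Coord M) : IsOpen (overlap M e e' e'') :=
  e.1.isOpen_inter_preimage_symm (e'.1.open_source.inter e''.1.open_source)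

theorem mem_overlap {e e' e'' : atlas Coord M} {x : M} (h : x ∈ e.1.source)
    (h' : x ∈ e'.1.source) (h'' : x ∈ e''.1.source) : e.1 x ∈ overlap M e e' e'' := by
  simp [overlap, h, h', h'']

theorem trans_apply {e : atlas Coord M} (e' : atlas Coord M) {x : M} (h : x ∈ e.1.source) :
    trans M e e' (e.1 x) = e'.1 x := by
  simp [trans, h]

theorem trans_mapsTo (e e' e'' : atlas Coord M) :
    MapsTo (trans M e e') (overlap M e e' e'') (overlap M e' e e'') := fun _ hw =>
  mem_overlap hw.2.1 (e.1.map_target hw.1) hw.2.2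

theorem overlap_subset (e e' e'' : atlas Coord M) : overlap M e e' e'' ⊆ overlap M e e' e' :=
  fun _ hw => ⟨hw.1, hw.2.1, hw.2.1⟩

theorem overlap_comm (e e' e'' : atlas Coord M) : overlap M e e' e'' = overlap M e e'' e' := by
  simp only [overlap, inter_comm e'.1.source]

theorem trans_trans (e e' e'' : atlas Coord M) :
    EqOn (fun w => trans M e' e'' (trans M e e' w)) (trans M e e'') (overlap M e e' e'') :=
  fun w hw => by simp [trans, e'.1.left_inv hw.2.1]

theorem trans_self (e : atlas Coord M) : EqOn (trans M e e) id e.1.target :=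
  fun _ hw => e.1.right_inv hw

theorem trans_contDiffOn [IsManifold (𝓡 4) ∞ M] (e e' e'' : atlas Coord M) :
    ContDiffOn ℝ ∞ (trans M e e') (overlap M e e' e'') := by
  have h := HasGroupoid.compatible (G := contDiffGroupoid ∞ (𝓡 4)) e.2 e'.2
  rw [contDiffGroupoid, mem_groupoid_of_pregroupoid] at h
  have h1 := h.1
  simp only [contDiffPregroupoid, modelWithCornersSelf_coe, modelWithCornersSelf_coe_symm,
    preimage_id, range_id, inter_univ, Function.comp_def, id] at h1
  exact h1.mono fun w hw => by simp [hw.1, hw.2.1]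

theorem chart_contMDiffOn [IsManifold (𝓡 4) ∞ M] (e : atlas Coord M) :
    ContMDiffOn (𝓡 4) (𝓡 4) ∞ e.1 e.1.source :=
  contMDiffOn_of_mem_maximalAtlas (IsManifold.subset_maximalAtlas e.2)

variable (M)

/-- The vector bundle of `k`-jets of sections `(g, φ)` of `S²T*M × ℝ`. In the chart `e`, its fibre
coordinates at `x` are the partial derivatives at `e x` of the components of a section. -/
def jetCore [IsManifold (𝓡 4) ∞ M] (k : ℕ) :
    VectorBundleCore ℝ M (JetFib k) (atlas Coord M) where
  baseSet e := e.1.source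
  isOpen_baseSet e := e.1.open_source
  indexAt x := ⟨chartAt Coord x, chart_mem_atlas Coord x⟩
  mem_baseSet_at x := mem_chart_source Coord x
  coordChange e e' x := jetChange k (trans M e' e) (e'.1 x)
  coordChange_self e x hx v := by
    rw [jetChange_congr e.1.open_target (trans_self e) k (e.1.map_source hx), jetChange_id]
  continuousOn_coordChange e e' :=
    (jetChange_contDiffOn (isOpen_overlap e' e e) (trans_contDiffOn e' e e) k).continuousOn.comp
      (e'.1.continuousOn.mono inter_subset_right) fun _ hx => mem_overlap hx.2 hx.1 hx.1
  coordChange_comp e e' e'' x hx v := by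
    have hz := mem_overlap hx.2 hx.1.2 hx.1.1
    have h := jetChange_comp (isOpen_overlap e'' e' e) (isOpen_overlap e' e'' e)
      ((trans_contDiffOn e' e e).mono (overlap_comm e' e e'' ▸ overlap_subset e' e e''))
      (trans_contDiffOn e'' e' e) (trans_mapsTo e'' e' e) k hz v
    rw [trans_apply e' hx.2] at h
    rw [h, jetChange_congr (isOpen_overlap e'' e' e) (trans_trans e'' e' e) k hz]

instance [IsManifold (𝓡 4) ∞ M] (k : ℕ) : (jetCore M k).IsContMDiff (𝓡 4) ∞ where
  contMDiffOn_coordChange e e' :=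
    (jetChange_contDiffOn (isOpen_overlap e' e e) (trans_contDiffOn e' e e) k).contMDiffOn.comp
      ((chart_contMDiffOn e').mono inter_subset_right) fun _ hx => mem_overlap hx.2 hx.1 hx.1

/-- The vector bundle of restricted symmetric multimomenta, that is, of the symmetric elements of
`Hom (J¹(S²T*M × ℝ), Λ³T*M)`. In a chart, its fibre coordinates are
`p_g^{αβ,μ}, p_φ^μ, p_g^{αβ,μν}, p_φ^{μν}`. -/
def momCore [IsManifold (𝓡 4) ∞ M] : VectorBundleCore ℝ M MomFib (atlas Coord M) where
  baseSet e := e.1.source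
  isOpen_baseSet e := e.1.open_source
  indexAt x := ⟨chartAt Coord x, chart_mem_atlas Coord x⟩
  mem_baseSet_at x := mem_chart_source Coord x
  coordChange e e' x := momChange (trans M e' e) (trans M e e') (e'.1 x)
  coordChange_self e x hx v := by
    rw [momChange_congr e.1.open_target e.1.open_target (trans_self e) (trans_self e)
      (e.1.map_source hx) (by rw [trans_apply e hx]; exact e.1.map_source hx), momChange_id]
  continuousOn_coordChange e e' :=
    (momChange_contDiffOn (isOpen_overlap e' e e) (isOpen_overlap e e' e)
      (trans_contDiffOn e' e e) (trans_contDiffOn e e' e)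
      (trans_mapsTo e' e e)).continuousOn.comp
      (e'.1.continuousOn.mono inter_subset_right) fun _ hx => mem_overlap hx.2 hx.1 hx.1
  coordChange_comp e e' e'' x hx v := by
    have hz := mem_overlap hx.2 hx.1.2 hx.1.1
    have hz' : trans M e' e (trans M e'' e' (e''.1 x)) ∈ overlap M e e' e'' := by
      rw [trans_apply e' hx.2, trans_apply e hx.1.2]
      exact mem_overlap hx.1.1 hx.1.2 hx.2
    have h := momChange_comp (isOpen_overlap e'' e' e) (isOpen_overlap e' e'' e)
      (isOpen_overlap e e' e'')
      ((trans_contDiffOn e' e e).mono (overlap_comm e' e e'' ▸ overlap_subset e' e e''))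
      (trans_contDiffOn e e' e'') (trans_contDiffOn e'' e' e) (trans_contDiffOn e' e'' e)
      (trans_mapsTo e'' e' e) (overlap_comm e' e e'' ▸ trans_mapsTo e e' e'') hz hz'
      (by rw [trans_apply e' hx.2, trans_apply e hx.1.2, trans_apply e' hx.1.1]) v
    rw [trans_apply e' hx.2] at h
    rw [h, momChange_congr (isOpen_overlap e'' e' e) (isOpen_overlap e e' e'')
      (trans_trans e'' e' e) (trans_trans e e' e'') hz hz']

instance [IsManifold (𝓡 4) ∞ M] : (momCore M).IsContMDiff (𝓡 4) ∞ where
  contMDiffOn_coordChange e e' :=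
    (momChange_contDiffOn (isOpen_overlap e' e e) (isOpen_overlap e e' e)
      (trans_contDiffOn e' e e) (trans_contDiffOn e e' e) (trans_mapsTo e' e e)).contMDiffOn.comp
      ((chart_contMDiffOn e').mono inter_subset_right) fun _ hx => mem_overlap hx.2 hx.1 hx.1

end Bundles

/-! ### Lorentzian metrics -/

/-- A symmetric matrix has Lorentzian signature `(-, +, +, +)`. -/
def IsLorentzian (A : Matrix (Fin 4) (Fin 4) ℝ) : Prop :=
  sigPos A.toQuadraticForm' = 3 ∧ sigNeg A.toQuadraticForm' = 1

theorem toQuadraticForm'_eq (A : Matrix (Fin 4) (Fin 4) ℝ) (x : Fin 4 → ℝ) :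
    A.toQuadraticForm' x = x ⬝ᵥ A.mulVec x := by
  simp [Matrix.toQuadraticForm', Matrix.toLinearMap₂'_apply']

theorem isLorentzian_iff (A : Matrix (Fin 4) (Fin 4) ℝ) :
    IsLorentzian A ↔ 3 ≤ sigPos A.toQuadraticForm' ∧ 1 ≤ sigNeg A.toQuadraticForm' := by
  have h := QuadraticForm.sigPos_add_sigNeg_add_radical (Q := A.toQuadraticForm')
  rw [Module.finrank_fin_fun] at h
  unfold IsLorentzian
  omega

theorem isOpen_sigPos (n : ℕ) (s : ℝ) :
    IsOpen {A : Matrix (Fin 4) (Fin 4) ℝ | n ≤ sigPos (s • A.toQuadraticForm')} := by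
  rw [isOpen_iff_mem_nhds]
  intro A hA
  obtain ⟨V, hV, hp⟩ := exists_finrank_eq_sigPos_and_posDef (s • A.toQuadraticForm')
  have hK : IsCompact ((V : Set (Fin 4 → ℝ)) ∩ Metric.sphere 0 1) :=
    (isCompact_sphere _ _).inter_left V.closed_of_finiteDimensional
  have hc : Continuous fun p : Matrix (Fin 4) (Fin 4) ℝ × (Fin 4 → ℝ) =>
      s * (p.2 ⬝ᵥ p.1.mulVec p.2) := by fun_prop
  have hev : ∀ᶠ B in 𝓝 A, ∀ x ∈ (V : Set (Fin 4 → ℝ)) ∩ Metric.sphere 0 1,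
      0 < s * (x ⬝ᵥ B.mulVec x) := by
    refine hK.eventually_forall_of_forall_eventually fun x hx => ?_
    refine hc.continuousAt.eventually (isOpen_Ioi.mem_nhds ?_)
    have := hp ⟨x, hx.1⟩ (by
      rintro h
      have h0 : x = 0 := congrArg Subtype.val h
      simp [h0] at hx)
    simpa [toQuadraticForm'_eq] using this
  filter_upwards [hev] with B hB
  refine hA.trans (hV ▸ le_sigPos_of_posDef _ ?_)
  intro x hx
  have hx0 : ‖(x : Fin 4 → ℝ)‖ ≠ 0 := by simpa using hx
  have h1 := hB (‖(x : Fin 4 → ℝ)‖⁻¹ • (x : Fin 4 → ℝ))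
    ⟨V.smul_mem _ x.2, by simp [norm_smul, hx0]⟩
  simp only [Matrix.mulVec_smul, smul_dotProduct, dotProduct_smul, smul_eq_mul] at h1
  have h2 : 0 < ‖(x : Fin 4 → ℝ)‖⁻¹ * ‖(x : Fin 4 → ℝ)‖⁻¹ := by positivity
  have h3 : 0 < (‖(x : Fin 4 → ℝ)‖⁻¹ * ‖(x : Fin 4 → ℝ)‖⁻¹) *
      (s * ((x : Fin 4 → ℝ) ⬝ᵥ B.mulVec (x : Fin 4 → ℝ))) := by
    convert! h1 using 1
    ring
  have := (mul_pos_iff_of_pos_left h2).1 h3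
  simpa [toQuadraticForm'_eq] using this

theorem isOpen_isLorentzian : IsOpen {A : Matrix (Fin 4) (Fin 4) ℝ | IsLorentzian A} := by
  have h := (isOpen_sigPos 3 1).inter (isOpen_sigPos 1 (-1))
  have e : ∀ A : Matrix (Fin 4) (Fin 4) ℝ,
      (-1 : ℝ) • A.toQuadraticForm' = -A.toQuadraticForm' := fun A => by
    ext x
    simp
  simp only [one_smul, e, sigPos_neg] at h
  convert! h using 1
  ext A
  exact isLorentzian_iff A

theorem isLorentzian_congr {A B T : Matrix (Fin 4) (Fin 4) ℝ} (hT : IsUnit T)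
    (h : B = T * A * T.transpose) (hA : IsLorentzian A) : IsLorentzian B := by
  have e : A.toQuadraticForm'.Equivalent B.toQuadraticForm' := by
    have hT' : IsUnit T.transpose := by simpa using hT
    refine QuadraticMap.Equivalent.symm ⟨⟨LinearEquiv.ofInjectiveEndo (Matrix.toLin' T.transpose)
      (fun a b h => Matrix.mulVec_injective_of_isUnit hT' (by simpa using h)), fun x => ?_⟩⟩
    subst h
    have hx : LinearEquiv.ofInjectiveEndo (Matrix.toLin' T.transpose)
        (fun a b h => Matrix.mulVec_injective_of_isUnit hT' (by simpa using h)) x =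
        T.transpose.mulVec x := Matrix.toLin'_apply _ _
    change A.toQuadraticForm' (LinearEquiv.ofInjectiveEndo _ _ x) = _
    rw [hx, toQuadraticForm'_eq, toQuadraticForm'_eq, ← Matrix.mulVec_mulVec,
      ← Matrix.mulVec_mulVec]
    rw [Matrix.dotProduct_mulVec x T, ← Matrix.mulVec_transpose]
  unfold IsLorentzian at *
  rw [← e.sigPos_eq, ← e.sigNeg_eq]
  exact hA

/-- The matrix `g_{αβ}` of the metric component of a jet. -/
def metric {k : ℕ} (v : JetFib k) : Matrix (Fin 4) (Fin 4) ℝ :=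
  Matrix.of fun α β => v.at 0 (Sum.inl (sym α β))

theorem metric_continuous (k : ℕ) : Continuous (metric : JetFib k → _) := by
  refine continuous_matrix fun α β => ?_
  simp only [metric, JetFib.at, Matrix.of_apply]
  simpa using continuous_apply _

/-- The Jacobian matrix `∂σ^κ/∂w^μ`. -/
def jacobian (σ : Coord → Coord) (z : Coord) : Matrix (Fin 4) (Fin 4) ℝ :=
  Matrix.of fun μ κ => fderiv ℝ σ z (dir μ) κ

theorem metric_jetChange {U : Set Coord} (hU : IsOpen U) {σ : Coord → Coord}
    (hσ : ContDiffOn ℝ ∞ σ U) (k : ℕ) {z : Coord} (hz : z ∈ U) (v : JetFib k) :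
    metric (jetChange k σ z v) = jacobian σ z * metric v * (jacobian σ z).transpose := by
  have h0 : ∑ μ, (0 : Fin 4 → ℕ) μ ≤ k := by simp
  have hj : ∀ c, poly (σ z) v (σ z) c = v (⟨0, h0⟩, c) := fun c =>
    congrFun (jet_poly (σ z) v) (⟨0, h0⟩, c)
  ext α β
  simp only [metric, JetFib.at, Matrix.of_apply, dif_pos h0, jetChange_apply hU hσ k hz, jet]
  show pull σ (poly (σ z) v) z (Sum.inl (sym α β)) = _
  rw [pull_sym]
  simp only [hj, jacobian, Matrix.mul_apply, Matrix.of_apply, Matrix.transpose_apply,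
    Finset.sum_mul]
  rw [Finset.sum_comm]
  exact Finset.sum_congr rfl fun _ _ => Finset.sum_congr rfl fun _ _ => by ring

theorem isLorentzian_jetChange {U W : Set Coord} (hU : IsOpen U) (hW : IsOpen W)
    {σ τ : Coord → Coord} (hσ : ContDiffOn ℝ ∞ σ U) (hτ : ContDiffOn ℝ ∞ τ W)
    (hm : MapsTo σ U W) (hi : EqOn (fun w => τ (σ w)) id U) (k : ℕ) {z : Coord} (hz : z ∈ U)
    {v : JetFib k} (hv : IsLorentzian (metric v)) :
    IsLorentzian (metric (jetChange k σ z v)) := by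
  refine isLorentzian_congr (T := jacobian σ z) ?_ (metric_jetChange hU hσ k hz v) hv
  have e : jacobian σ z * jacobian τ (σ z) = 1 := by
    ext μ κ
    have h := fderiv_comp_apply hU hW hτ hσ hm hz (dir μ) κ
    rw [Filter.EventuallyEq.fderiv_eq (hi.eventuallyEq_of_mem (hU.mem_nhds hz)), fderiv_id] at h
    simp only [Matrix.mul_apply, jacobian, Matrix.of_apply, ← h]
    simp [dir, Matrix.one_apply, eq_comm]
  exact IsUnit.of_mul_eq_one _ e

/-! ### Jet spaces, momenta and the Legendre map -/

section Spaces

variable (M : Type*) [TopologicalSpace M] [ChartedSpace Coord M] [IsManifold (𝓡 4) ∞ M]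

variable {M} in
theorem isLorentzian_coordChange (k : ℕ) (e e' : atlas Coord M) {x : M} (h : x ∈ e.1.source)
    (h' : x ∈ e'.1.source) {v : JetFib k} (hv : IsLorentzian (metric v)) :
    IsLorentzian (metric ((jetCore M k).coordChange e e' x v)) := by
  refine isLorentzian_jetChange (isOpen_overlap e' e e') (isOpen_overlap e e' e')
    (trans_contDiffOn e' e e') (trans_contDiffOn e e' e') (trans_mapsTo e' e e') ?_ k
    (mem_overlap h' h h') hv
  intro w hw
  simp [trans, e.1.left_inv hw.2.1, e'.1.right_inv hw.1]

/-- The `k`-jets at which the metric is Lorentzian. -/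
def lorentzSet (k : ℕ) : Set (TotalSpace (JetFib k) (jetCore M k).Fiber) :=
  {p | IsLorentzian (metric (show JetFib k from p.2))}

theorem isOpen_lorentzSet (k : ℕ) : IsOpen (lorentzSet M k) := by
  rw [isOpen_iff_mem_nhds]
  intro p hp
  let i := (jetCore M k).indexAt p.1
  let t := (jetCore M k).localTriv i
  have ho : IsOpen (t.source ∩ t ⁻¹' {q : M × JetFib k | IsLorentzian (metric q.2)}) :=
    t.continuousOn.isOpen_inter_preimage t.open_source
      (isOpen_isLorentzian.preimage ((metric_continuous k).comp continuous_snd))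
  have hps : p ∈ t.source := ((jetCore M k).mem_localTriv_source i p).2
    ((jetCore M k).mem_baseSet_at p.1)
  refine Filter.mem_of_superset (ho.mem_nhds ⟨hps, ?_⟩) ?_
  · change IsLorentzian (metric (t p).2)
    rw [VectorBundleCore.localTriv_apply]
    exact isLorentzian_coordChange k _ _ ((jetCore M k).mem_baseSet_at p.1)
      ((jetCore M k).mem_baseSet_at p.1) hp
  · rintro q ⟨hqs, hq⟩
    have hqi := ((jetCore M k).mem_localTriv_source i q).1 hqs
    have hqj := (jetCore M k).mem_baseSet_at q.1
    change IsLorentzian (metric (t q).2) at hq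
    rw [VectorBundleCore.localTriv_apply] at hq
    dsimp only at hq
    have h := isLorentzian_coordChange k i _ hqi hqj hq
    have hc := (jetCore M k).coordChange_comp _ i _ q.1 ⟨⟨hqj, hqi⟩, hqj⟩ q.2
    have hs := (jetCore M k).coordChange_self _ _ hqj q.2
    exact (congrArg (fun v : JetFib k => IsLorentzian (metric v)) (hc.trans hs)).mp h

/-- The jet space `J^kπ` of the bundle `π : E → M` whose sections are the pairs `(g, φ)` of a
Lorentzian metric and a function. -/
def jetSpace (k : ℕ) : TopologicalSpace.Opens (TotalSpace (JetFib k) (jetCore M k).Fiber) :=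
  ⟨lorentzSet M k, isOpen_lorentzSet M k⟩

/-- The fibre product over `M` of the bundle of first jets with the bundle of multimomenta. -/
abbrev MomTotal : Type _ :=
  TotalSpace (JetFib 1 × MomFib) ((jetCore M 1).Fiber ×ᵇ (momCore M).Fiber)

/-- The projection onto the first jets. -/
def momProj (p : MomTotal M) : TotalSpace (JetFib 1) (jetCore M 1).Fiber := ⟨p.1, p.2.1⟩

theorem momProj_continuous : Continuous (momProj M) :=
  continuous_fst.comp
    (FiberBundle.Prod.isInducing_diag (JetFib 1) (jetCore M 1).Fiber MomFib
      (momCore M).Fiber).continuous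

/-- The restricted `2`-symmetric multimomentum bundle `J²π‡`. -/
def momSpace : TopologicalSpace.Opens (MomTotal M) :=
  ⟨momProj M ⁻¹' lorentzSet M 1, (isOpen_lorentzSet M 1).preimage (momProj_continuous M)⟩

end Spaces

/-! ### The Lagrangian in coordinates -/

/-- The total derivative `D_τ f` of a function `f` on the `k`-th jet space, in coordinates. -/
def totalDeriv {k : ℕ} (τ : Fin 4) (f : Coord × JetFib k → ℝ) : Coord × JetFib (k + 1) → ℝ :=
  fun q => fderiv ℝ f (q.1, trunc k q.2) (dir τ, fun r => q.2.at (r.1.1 + one τ) r.2)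

/-- The derivative `g_{αβ,μ}` of the metric. -/
def dmetric {k : ℕ} (v : JetFib k) (α β μ : Fin 4) : ℝ := v.at (one μ) (Sum.inl (sym α β))

/-- The Christoffel symbols `Γ^γ_{μν}`. -/
def christoffel (γ μ ν : Fin 4) (q : Coord × JetFib 1) : ℝ :=
  1 / 2 * ∑ ρ, (metric q.2)⁻¹ γ ρ *
    (dmetric q.2 ν ρ μ + dmetric q.2 ρ μ ν - dmetric q.2 μ ν ρ)

/-- The Ricci tensor
`R_{αβ} = D_γ Γ^γ_{αβ} - D_α Γ^γ_{γβ} + Γ^γ_{αβ} Γ^δ_{δγ} - Γ^γ_{δβ} Γ^δ_{αγ}`. -/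
def ricci (α β : Fin 4) (q : Coord × JetFib 2) : ℝ :=
  let Γ (γ μ ν : Fin 4) : ℝ := christoffel γ μ ν (q.1, trunc 1 q.2)
  ∑ γ, (totalDeriv γ (christoffel γ α β) q - totalDeriv α (christoffel γ γ β) q +
    ∑ δ, (Γ γ α β * Γ δ δ γ - Γ γ δ β * Γ δ α γ))

/-- The scalar curvature `R = g^{αβ} R_{αβ}`. -/
def scalarCurvature (q : Coord × JetFib 2) : ℝ :=
  ∑ α, ∑ β, (metric q.2)⁻¹ α β * ricci α β q

/-- The scalar field `φ`. -/
def scalarField {k : ℕ} (v : JetFib k) : ℝ := v.at 0 (Sum.inr ())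

/-- The kinetic term `X = -(1/2) g^{μν} φ_{,μ} φ_{,ν}`. -/
def kinetic {k : ℕ} (v : JetFib k) : ℝ :=
  -(1 / 2) * ∑ μ, ∑ ν, (metric v)⁻¹ μ ν * v.at (one μ) (Sum.inr ()) * v.at (one ν) (Sum.inr ())

/-- The d'Alembertian `□φ = g^{μν} ∇_μ ∇_ν φ = g^{μν} (φ_{,μν} - Γ^γ_{μν} φ_{,γ})`. -/
def dAlembertian (q : Coord × JetFib 2) : ℝ :=
  ∑ μ, ∑ ν, (metric q.2)⁻¹ μ ν * (q.2.at (one μ + one ν) (Sum.inr ()) -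
    ∑ γ, christoffel γ μ ν (q.1, trunc 1 q.2) * q.2.at (one γ) (Sum.inr ()))

/-- The cubic Horndeski Lagrangian
`L = (1 / 16πG) √|det g| (R + X + G₂(φ, X) + G₃(φ, X) □φ)`. -/
def lagrangian (G : ℝ) (G₂ G₃ : ℝ × ℝ → ℝ) (q : Coord × JetFib 2) : ℝ :=
  1 / (16 * Real.pi * G) * √|(metric q.2).det| *
    (scalarCurvature q + kinetic q.2 + G₂ (scalarField q.2, kinetic q.2) +
      G₃ (scalarField q.2, kinetic q.2) * dAlembertian q)

/-- The derivative `∂L/∂y^c_I`. -/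
def dL (L : Coord × JetFib 2 → ℝ) (I : Fin 4 → ℕ) (c : Comp) (q : Coord × JetFib 2) : ℝ :=
  fderiv ℝ L q (0, unit 2 I c)

/-- The momenta of the Legendre map of a second order Lagrangian:
`p_c^μ = ∂L/∂y^c_μ - ∑_ν (1/n(μν)) D_ν (∂L/∂y^c_{μν})` and `p_c^{μν} = ∂L/∂y^c_{μν}`. -/
def legendre (L : Coord × JetFib 2 → ℝ) (q : Coord × JetFib 3) : MomFib := fun r =>
  match r with
  | (Sum.inl μ, c) => dL L (one μ) c (q.1, trunc 2 q.2) -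
      ∑ ν, (nfac μ ν)⁻¹ * totalDeriv ν (dL L (one μ + one ν) c) q
  | (Sum.inr m, c) => dL L (one m.1.1 + one m.1.2) c (q.1, trunc 2 q.2)

section Legendre

variable (M : Type*) [TopologicalSpace M] [ChartedSpace Coord M] [IsManifold (𝓡 4) ∞ M]

/-- The restricted Legendre map `J³π → J²π‡` of the Lagrangian density `L d⁴x`: the fibre
coordinates of the bundles at `x` are those of the chart `chartAt Coord x`. -/
def legendreMap (L : Coord × JetFib 2 → ℝ) (j : jetSpace M 3) : momSpace M :=
  let v : JetFib 3 := j.1.2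
  ⟨⟨j.1.1, (trunc 1 v, legendre L (chartAt Coord j.1.1 j.1.1, v))⟩, by
    have h : IsLorentzian (metric v) := j.2
    have e : metric (trunc 1 v) = metric v := by
      ext α β
      simp [metric, trunc, JetFib.at]
    change IsLorentzian (metric (trunc 1 v))
    rwa [e]⟩

/-- The changes of coordinates between the charts of `M` preserve the orientation of `ℝ⁴`. -/
def IsOrientedAtlas (M : Type*) [TopologicalSpace M] [ChartedSpace Coord M] : Prop :=
  ∀ e ∈ atlas Coord M, ∀ e' ∈ atlas Coord M, ∀ w ∈ (e.symm.trans e').source,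
    0 < (fderiv ℝ (e.symm.trans e') w).det

end Legendre

/-! ### Almost-regular Lagrangians -/

section Submanifolds

variable {E H : Type*} [NormedAddCommGroup E] [NormedSpace ℝ E] [TopologicalSpace H]
  (I : ModelWithCorners ℝ E H) {N : Type*} [TopologicalSpace N] [ChartedSpace H N]
  {E' H' : Type*} [NormedAddCommGroup E'] [NormedSpace ℝ E'] [TopologicalSpace H']
  (I' : ModelWithCorners ℝ E' H') {N' : Type*} [TopologicalSpace N'] [ChartedSpace H' N']

/-- The subset `S` with the given charts is an embedded smooth submanifold of dimension `d`: these
charts make it a smooth manifold, and the inclusion is a smooth embedding. -/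
def IsSubmanifoldWith (S : Set N) (d : ℕ) (cs : ChartedSpace (EuclideanSpace ℝ (Fin d)) S) :
    Prop :=
  letI := cs
  IsManifold (𝓡 d) ∞ S ∧ Manifold.IsSmoothEmbedding (𝓡 d) I ∞ (Subtype.val : S → N)

/-- The subset `S` is an embedded smooth submanifold. -/
def IsSubmanifold (S : Set N) : Prop :=
  ∃ (d : ℕ) (cs : ChartedSpace (EuclideanSpace ℝ (Fin d)) S), IsSubmanifoldWith I S d cs

/-- The map `F`, whose image carries the given charts, is almost regular: its image is a closed
submanifold, `F` is a submersion onto its image, and the fibre of `F` through any point is a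
connected submanifold. -/
def IsAlmostRegularWith (F : N → N') (d : ℕ)
    (cs : ChartedSpace (EuclideanSpace ℝ (Fin d)) (range F)) : Prop :=
  letI := cs
  IsClosed (range F) ∧ IsSubmanifoldWith I' (range F) d cs ∧
    Manifold.IsSubmersion I (𝓡 d) ∞ (rangeFactorization F) ∧
    ∀ j : N, IsConnected (F ⁻¹' {F j}) ∧ IsSubmanifold I (F ⁻¹' {F j})

end Submanifolds

end

end Horndeski

namespace Horndeski

noncomputable section

/-! ### Jets along sections -/

/-! The scalar curvature is affine in the second derivatives of the metric, with coefficients built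
from the metric alone. Since `G₃` does not depend on `X`, the second derivatives of `φ` in `G₃ □φ`
also have coefficients built from the fields alone. So `L` is affine in the second derivatives, with
a linear part that depends only on the fields (`isAffineInSecond_lagrangian`). Hence `p_c^{μν}` is a
function of the fields, its total derivatives are functions of the first jet, and `∂L/∂y^c_μ` is
blind to second derivatives because the linear part does not contain `y^c_μ`. The Legendre map
therefore depends on the first jet only (`IsAffineInSecond.legendre_eq`): it is the projection
`π^3_1` followed by a section of the multimomentum bundle over `J¹π` (`legendreMap_eq`).

Almost-regularity follows from this factorization (`isAlmostRegularWith_of_factor`). The image of a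
continuous section of a Hausdorff bundle is closed; a smooth section is an embedding and identifies
`J¹π` with its image; and the projection of jets is a surjective submersion. A section is injective,
so the fibres of the Legendre map are those of the projection, which are affine spaces.

What remains is that the section is smooth over all of `M`. The Legendre map is written at each
point in a preferred chart, which may jump from point to point, so the formula for the momenta has
to be the same in every chart of the atlas (`legendre_covariant`). Instead of transforming that
formula directly, the proof characterizes the momenta variationally. If a variation `η` vanishes at
a point, the divergence there of the pairing of the momenta with `j¹η` is the derivative of `L`
along `j²η` (`first_variation`), and a field of symmetric multimomenta is determined by such
divergences (`eq_zero_of_div_pairing`). The divergence of a vector density is a scalar density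
(`piola`), so for an invariant `L d⁴x` the transformed momenta satisfy the same characterization.

Invariance of `L d⁴x` (`isInvariantUnder_lagrangian`) rests on the transformation laws of the
connection, the curvature and the Hessian (`christoffel_law`, `curvature_law`, `hessian_law`). The
orientation enters in the volume factor, which must be multiplied by the Jacobian determinant and
not by its absolute value (`volume_pull`). -/

theorem pd_iterPD {U : Set Coord} (hU : IsOpen U) (I : Fin 4 → ℕ) (μ : Fin 4) {f : Coord → ℝ}
    (hf : ContDiffOn ℝ ∞ f U) : EqOn (pd μ (iterPD I f)) (iterPD (I + one μ) f) U := by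
  have h3 := pdn_contDiffOn hU 3 (I 3) hf
  have h2 := pdn_contDiffOn hU 2 (I 2) h3
  have h1 := pdn_contDiffOn hU 1 (I 1) h2
  refine EqOn.trans ?_ (iterPD_pd hU I μ hf)
  exact ((pdn_congr hU _ _ ((pdn_congr hU _ _ ((pdn_congr hU _ _ (pdn_comm hU 3 μ _ hf)).trans
      (pdn_comm hU 2 μ _ h3))).trans (pdn_comm hU 1 μ _ h2))).trans (pdn_comm hU 0 μ _ h1)).symm

theorem at_of_le {k : ℕ} (v : JetFib k) {I : Fin 4 → ℕ} (h : ∑ μ, I μ ≤ k) (c : Comp) :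
    v.at I c = v (⟨I, h⟩, c) := dif_pos h

theorem jet_at {k : ℕ} (s : Coord → Comp → ℝ) (z : Coord) {I : Fin 4 → ℕ} (h : ∑ μ, I μ ≤ k)
    (c : Comp) : (jet k s z).at I c = iterPD I (fun w => s w c) z := at_of_le _ h c

theorem sum_zero_le (k : ℕ) : ∑ μ : Fin 4, (0 : Fin 4 → ℕ) μ ≤ k := by simp

theorem sum_one_le (k : ℕ) (μ : Fin 4) : ∑ ν, one μ ν ≤ k + 1 := by simp [sum_one]

theorem sum_one_add_le (k : ℕ) (μ ν : Fin 4) : ∑ κ, (one μ + one ν) κ ≤ k + 2 := by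
  simp [Finset.sum_add_distrib, sum_one]

theorem jet_at_zero (k : ℕ) (s : Coord → Comp → ℝ) (z : Coord) (c : Comp) :
    (jet k s z).at 0 c = s z c := jet_at s z (sum_zero_le k) c

theorem jet_at_one (k : ℕ) (s : Coord → Comp → ℝ) (z : Coord) (μ : Fin 4) (c : Comp) :
    (jet (k + 1) s z).at (one μ) c = pd μ (fun w => s w c) z := by
  rw [jet_at s z (sum_one_le k μ), iterPD_one]

theorem jet_at_two (k : ℕ) {U : Set Coord} (hU : IsOpen U) {s : Coord → Comp → ℝ}
    (hs : ∀ c, ContDiffOn ℝ ∞ (fun w => s w c) U) {z : Coord} (hz : z ∈ U) (μ ν : Fin 4)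
    (c : Comp) :
    (jet (k + 2) s z).at (one μ + one ν) c = pd ν (pd μ (fun w => s w c)) z := by
  rw [jet_at s z (sum_one_add_le k μ ν), ← pd_iterPD hU (one μ) ν (hs c) hz, iterPD_one]

theorem trunc_at {k l : ℕ} (v : JetFib k) {I : Fin 4 → ℕ} (h : ∑ μ, I μ ≤ l) (c : Comp) :
    (trunc l v).at I c = v.at I c := at_of_le _ h c

theorem trunc_jet {k l : ℕ} (h : l ≤ k) (s : Coord → Comp → ℝ) (z : Coord) :
    trunc l (jet k s z) = jet l s z := by
  funext q
  exact jet_at s z (q.1.2.trans h) q.2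

theorem trunc_trunc {k l m : ℕ} (h : m ≤ l) (v : JetFib k) : trunc m (trunc l v) = trunc m v := by
  funext q
  exact trunc_at v (q.1.2.trans h) q.2

theorem trunc_self {k : ℕ} (v : JetFib k) : trunc k v = v := by
  funext q
  exact at_of_le v q.1.2 q.2

theorem metric_trunc {k l : ℕ} (v : JetFib k) : metric (trunc l v) = metric v := by
  ext α β
  exact trunc_at v (sum_zero_le l) _

theorem jet_contDiffOn {U : Set Coord} (hU : IsOpen U) {s : Coord → Comp → ℝ}
    (hs : ∀ c, ContDiffOn ℝ ∞ (fun w => s w c) U) (k : ℕ) : ContDiffOn ℝ ∞ (jet k s) U :=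
  contDiffOn_pi.2 fun q => iterPD_contDiffOn hU q.1.1 (hs q.2)

theorem hasFDerivAt_jet {U : Set Coord} (hU : IsOpen U) {s : Coord → Comp → ℝ}
    (hs : ∀ c, ContDiffOn ℝ ∞ (fun w => s w c) U) (k : ℕ) {z : Coord} (hz : z ∈ U) :
    HasFDerivAt (jet k s) (fderiv ℝ (jet k s) z) z :=
  (((jet_contDiffOn hU hs k).contDiffAt (hU.mem_nhds hz)).differentiableAt (by simp)).hasFDerivAt

theorem fderiv_jet {U : Set Coord} (hU : IsOpen U) {s : Coord → Comp → ℝ}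
    (hs : ∀ c, ContDiffOn ℝ ∞ (fun w => s w c) U) (k : ℕ) {z : Coord} (hz : z ∈ U) (τ : Fin 4) :
    fderiv ℝ (jet k s) z (dir τ) = fun r => (jet (k + 1) s z).at (r.1.1 + one τ) r.2 := by
  funext r
  have h1 := hasFDerivAt_pi'.1 (hasFDerivAt_jet hU hs k hz) r
  have h2 : ∑ μ, (r.1.1 + one τ) μ ≤ k + 1 := by
    simpa [Finset.sum_add_distrib, sum_one] using r.1.2
  rw [jet_at s z h2, ← pd_iterPD hU r.1.1 τ (hs r.2) hz]
  exact (congrArg (fun A : Coord →L[ℝ] ℝ => A (dir τ)) h1.fderiv).symm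

theorem hasFDerivAt_comp_jet {U : Set Coord} (hU : IsOpen U) {s : Coord → Comp → ℝ}
    (hs : ∀ c, ContDiffOn ℝ ∞ (fun w => s w c) U) {k : ℕ} {z : Coord} (hz : z ∈ U)
    {f : Coord × JetFib k → ℝ} (hf : DifferentiableAt ℝ f (z, jet k s z)) :
    HasFDerivAt (fun w => f (w, jet k s w)) ((fderiv ℝ f (z, jet k s z)).comp
      ((ContinuousLinearMap.id ℝ Coord).prod (fderiv ℝ (jet k s) z))) z :=
  HasFDerivAt.comp (f := fun w => (w, jet k s w)) z hf.hasFDerivAt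
    ((hasFDerivAt_id z).prodMk (hasFDerivAt_jet hU hs k hz))

/-- The total derivative is the derivative along prolonged sections. -/
theorem totalDeriv_jet {U : Set Coord} (hU : IsOpen U) {s : Coord → Comp → ℝ}
    (hs : ∀ c, ContDiffOn ℝ ∞ (fun w => s w c) U) {k : ℕ} {z : Coord} (hz : z ∈ U)
    {f : Coord × JetFib k → ℝ} (hf : DifferentiableAt ℝ f (z, jet k s z)) (τ : Fin 4) :
    totalDeriv τ f (z, jet (k + 1) s z) = pd τ (fun w => f (w, jet k s w)) z := by
  rw [pd, (hasFDerivAt_comp_jet hU hs hz hf).fderiv, totalDeriv, trunc_jet (Nat.le_succ k)]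
  simp [fderiv_jet hU hs k hz τ]

theorem poly_contDiffOn {k : ℕ} (x : Coord) (v : JetFib k) (U : Set Coord) (c : Comp) :
    ContDiffOn ℝ ∞ (fun w => poly x v w c) U := (poly_contDiff x v c).contDiffOn

/-- The polynomial representative in the definition of `jetChange` may be replaced by any section
with the same jet, since the jet of a pullback depends only on the jet of the section. -/
theorem jetChange_jet {U W : Set Coord} (hU : IsOpen U) (hW : IsOpen W) {σ : Coord → Coord}
    (hσ : ContDiffOn ℝ ∞ σ U) (hm : MapsTo σ U W) {s : Coord → Comp → ℝ}
    (hs : ∀ c, ContDiffOn ℝ ∞ (fun w => s w c) W) (k : ℕ) {z : Coord} (hz : z ∈ U) :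
    jetChange k σ z (jet k s (σ z)) = jet k (pull σ s) z := by
  rw [jetChange_apply hU hσ k hz]
  exact jet_pull_congr hU hW hσ hm (poly_contDiffOn _ _ W) hs hz (jet_poly _ _)

/-! ### The first variation and the uniqueness of momenta -/

theorem degree_one (μ : Fin 4) : ∑ κ, one μ κ = 1 := sum_one μ

theorem degree_two (μ ν : Fin 4) : ∑ κ, (one μ + one ν) κ = 2 := by
  simp [Finset.sum_add_distrib, sum_one]

theorem one_ne_one_add (α μ ν : Fin 4) : one α ≠ one μ + one ν := fun h => by
  have := congrArg (fun I : Fin 4 → ℕ => ∑ κ, I κ) h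
  simp only [degree_one, degree_two] at this
  omega

theorem one_add_ne_zero (μ ν : Fin 4) : one μ + one ν ≠ 0 := fun h => by
  have := congrArg (fun I : Fin 4 → ℕ => ∑ κ, I κ) h
  simp only [degree_two] at this
  simp at this

theorem one_add_inj {α β μ ν : Fin 4} :
    one μ + one ν = one α + one β ↔ (μ = α ∧ ν = β) ∨ (μ = β ∧ ν = α) := by
  simp only [funext_iff, one, Pi.add_apply]
  decide +revert

theorem multiIdx_two (I : MultiIdx 2) :
    I.1 = 0 ∨ (∃ μ, I.1 = one μ) ∨ ∃ μ ν, I.1 = one μ + one ν := by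
  obtain ⟨I, hI⟩ := I
  by_cases h : I = 0
  · exact Or.inl h
  right
  obtain ⟨ν, hν⟩ := Function.ne_iff.1 h
  simp only [Pi.zero_apply] at hν
  -- The truncated subtraction is exact because `I ν ≠ 0`. Taking off one derivative reduces the
  -- claim to order one.
  have e : I = (I - one ν) + one ν := by
    funext κ
    by_cases hk : κ = ν
    · subst hk
      simp [one]
      omega
    · simp [one, hk]
  have h1 : ∑ κ, (I - one ν) κ ≤ 1 := by
    rw [e] at hI
    simp only [Pi.add_apply, Finset.sum_add_distrib, sum_one] at hI
    simpa using hI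
  rcases multiIdx_one ⟨I - one ν, h1⟩ with h2 | ⟨μ, h2⟩
  · refine Or.inl ⟨ν, ?_⟩
    exact e.trans (by rw [show I - one ν = 0 from h2, zero_add])
  · refine Or.inr ⟨μ, ν, ?_⟩
    exact e.trans (by rw [show I - one ν = one μ from h2])

/-- A second-order multi-index comes from two ordered pairs off the diagonal and from one on it. The
weight `1/n` compensates exactly, so weighted sums over ordered pairs are sums over multi-indices.
-/
theorem sum_nfac_inv (α β : Fin 4) (a : ℝ) :
    ∑ μ, ∑ ν, (nfac μ ν)⁻¹ * (if one α + one β = one μ + one ν then a else 0) = a := by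
  by_cases h : α = β
  · subst h
    have e : ∀ μ ν, (nfac μ ν)⁻¹ * (if one α + one α = one μ + one ν then a else 0) =
        if μ = α then if ν = α then a else 0 else 0 := by
      intro μ ν
      simp only [one_add_inj, nfac]
      grind
    simp [e]
  · have e : ∀ μ ν, (nfac μ ν)⁻¹ * (if one α + one β = one μ + one ν then a else 0) =
        (if μ = α then if ν = β then a / 2 else 0 else 0) +
          (if μ = β then if ν = α then a / 2 else 0 else 0) := by
      intro μ ν
      simp only [one_add_inj, nfac]
      grind
    simp [e, Finset.sum_add_distrib]

/-- A vertical vector of the second jet bundle without components of order zero, in terms of the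
coordinate vectors. -/
theorem jetFib_two_decomp (v : JetFib 2) (h0 : ∀ c, v.at 0 c = 0) :
    v = ∑ c, (∑ μ, v.at (one μ) c • unit 2 (one μ) c +
      ∑ μ, ∑ ν, ((nfac μ ν)⁻¹ * v.at (one μ + one ν) c) • unit 2 (one μ + one ν) c) := by
  funext ⟨I, c⟩
  have hv : v (I, c) = v.at I.1 c := (at_of_le v I.2 c).symm
  rw [hv, Finset.sum_apply, Finset.sum_eq_single c]
  · simp only [Pi.add_apply, Finset.sum_apply, Pi.smul_apply, smul_eq_mul, unit, and_true]
    rcases multiIdx_two I with h | ⟨α, h⟩ | ⟨α, β, h⟩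
    · simp [h, h0, (one_ne_zero' _).symm, (one_add_ne_zero _ _).symm]
    · rw [h, Finset.sum_eq_single α]
      · simp [one_ne_one_add]
      · intro b _ hb
        have : one α ≠ one b := fun h => hb (one_inj h).symm
        simp [this]
      · simp
    · have e : ∀ μ ν, (nfac μ ν)⁻¹ * v.at (one μ + one ν) c *
          (if one α + one β = one μ + one ν then 1 else 0) =
          (nfac μ ν)⁻¹ * (if one α + one β = one μ + one ν then v.at (one α + one β) c else 0) := by
        intro μ ν
        by_cases hh : one α + one β = one μ + one ν
        · simp [hh]
        · simp [hh]
      simp only [h, (one_ne_one_add _ _ _).symm, if_false, mul_zero, Finset.sum_const_zero,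
        zero_add, e, sum_nfac_inv]
  · intro b _ hb
    simp [unit, hb.symm]
  · simp

theorem linear_two_decomp (A : JetFib 2 →L[ℝ] ℝ) (v : JetFib 2) (h0 : ∀ c, v.at 0 c = 0) :
    A v = ∑ c, (∑ μ, A (unit 2 (one μ) c) * v.at (one μ) c +
      ∑ μ, ∑ ν, (nfac μ ν)⁻¹ * A (unit 2 (one μ + one ν) c) * v.at (one μ + one ν) c) := by
  conv_lhs => rw [jetFib_two_decomp v h0]
  simp only [map_sum, map_add, map_smul, smul_eq_mul]
  refine Finset.sum_congr rfl fun c _ => congrArg₂ _ (Finset.sum_congr rfl fun μ _ => mul_comm _ _)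
    (Finset.sum_congr rfl fun μ _ => Finset.sum_congr rfl fun ν _ => by ring)

theorem pd_fun_sum {ι : Type} (t : Finset ι) {f : ι → Coord → ℝ} {z : Coord}
    (hf : ∀ i ∈ t, DifferentiableAt ℝ (f i) z) (μ : Fin 4) :
    pd μ (fun w => ∑ i ∈ t, f i w) z = ∑ i ∈ t, pd μ (f i) z := by
  simp only [pd]
  rw [fderiv_fun_sum hf, _root_.sum_apply]

theorem pd_fun_add {f g : Coord → ℝ} {z : Coord} (hf : DifferentiableAt ℝ f z)
    (hg : DifferentiableAt ℝ g z) (μ : Fin 4) :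
    pd μ (fun w => f w + g w) z = pd μ f z + pd μ g z := by
  simp only [pd]
  rw [fderiv_fun_add hf hg]
  rfl

theorem pd_fun_mul {f g : Coord → ℝ} {z : Coord} (hf : DifferentiableAt ℝ f z)
    (hg : DifferentiableAt ℝ g z) (μ : Fin 4) :
    pd μ (fun w => f w * g w) z = f z * pd μ g z + pd μ f z * g z := by
  simp only [pd]
  rw [fderiv_fun_mul hf hg]
  simp [mul_comm]

theorem pd_const_mul {f : Coord → ℝ} {z : Coord} (a : ℝ) (hf : DifferentiableAt ℝ f z)
    (μ : Fin 4) : pd μ (fun w => a * f w) z = a * pd μ f z := by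
  simp only [pd]
  rw [fderiv_const_mul hf]
  rfl

theorem contDiffOn_diffAt {E F : Type*} [NormedAddCommGroup E] [NormedSpace ℝ E]
    [NormedAddCommGroup F] [NormedSpace ℝ F] {f : E → F} {U : Set E} (hf : ContDiffOn ℝ ∞ f U)
    (hU : IsOpen U) {z : E} (hz : z ∈ U) : DifferentiableAt ℝ f z :=
  (hf.contDiffAt (hU.mem_nhds hz)).differentiableAt (by simp)

/-- The divergence of the pairing of a field of multimomenta with a variation which vanishes at
the point. -/
theorem div_pairing {U : Set Coord} (hU : IsOpen U) {P : Coord → MomFib}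
    (hP : ∀ q, ContDiffOn ℝ ∞ (fun z => P z q) U) {η : Coord → Comp → ℝ}
    (hη : ∀ c, ContDiffOn ℝ ∞ (fun w => η w c) U) {z : Coord} (hz : z ∈ U)
    (h0 : ∀ c, η z c = 0) :
    ∑ μ, pd μ (fun w => pairing (P w) (jet 1 η w) μ) z =
      ∑ c, (∑ μ, (P z (Sum.inl μ, c) +
          ∑ ν, (nfac μ ν)⁻¹ * pd ν (fun w => P w (Sum.inr (sym μ ν), c)) z) *
          (jet 2 η z).at (one μ) c +
        ∑ μ, ∑ ν, (nfac μ ν)⁻¹ * P z (Sum.inr (sym μ ν), c) *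
          (jet 2 η z).at (one μ + one ν) c) := by
  have dP := fun q => contDiffOn_diffAt (hP q) hU hz
  have d0 := fun c => contDiffOn_diffAt (hη c) hU hz
  have d1 := fun ν c => contDiffOn_diffAt (pd_contDiffOn hU (hη c) ν) hU hz
  have key : ∀ μ, pd μ (fun w => pairing (P w) (jet 1 η w) μ) z =
      ∑ c, (P z (Sum.inl μ, c) * pd μ (fun w => η w c) z +
        ∑ ν, (nfac ν μ)⁻¹ * (P z (Sum.inr (sym ν μ), c) * pd μ (pd ν (fun w => η w c)) z +
          pd μ (fun w => P w (Sum.inr (sym ν μ), c)) z * pd ν (fun w => η w c) z)) := by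
    intro μ
    simp only [pairing, jet_at_zero, jet_at_one]
    have dm : ∀ c ν, DifferentiableAt ℝ
        (fun w => P w (Sum.inr (sym ν μ), c) * pd ν (fun w => η w c) w) z :=
      fun c ν => (dP _).mul (d1 ν c)
    have ds : ∀ c, DifferentiableAt ℝ (fun w => ∑ ν, (nfac ν μ)⁻¹ *
        (P w (Sum.inr (sym ν μ), c) * pd ν (fun w => η w c) w)) z :=
      fun c => DifferentiableAt.fun_sum fun ν _ => (dm c ν).const_mul _
    have dm0 : ∀ c, DifferentiableAt ℝ (fun w => P w (Sum.inl μ, c) * η w c) z :=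
      fun c => (dP _).mul (d0 c)
    have da : ∀ c ∈ Finset.univ, DifferentiableAt ℝ (fun w => P w (Sum.inl μ, c) * η w c +
        ∑ ν, (nfac ν μ)⁻¹ * (P w (Sum.inr (sym ν μ), c) * pd ν (fun w => η w c) w)) z :=
      fun c _ => (dm0 c).add (ds c)
    simp only [mul_assoc]
    rw [pd_fun_sum _ da]
    refine Finset.sum_congr rfl fun c _ => ?_
    -- The only term with `η` undifferentiated is `(∂_μ p^μ) η`, and it vanishes at `z`. Without
    -- this, an Euler–Lagrange term would appear.
    rw [pd_fun_add (dm0 c) (ds c), pd_fun_mul (dP _) (d0 c), h0, mul_zero, add_zero,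
      pd_fun_sum _ fun ν _ => (dm c ν).const_mul _]
    congr 1
    refine Finset.sum_congr rfl fun ν _ => ?_
    rw [pd_const_mul _ (dm c ν), pd_fun_mul (dP _) (d1 ν c)]
  simp only [key, jet_at_one 1, jet_at_two 0 hU hη hz]
  rw [Finset.sum_comm]
  refine Finset.sum_congr rfl fun c _ => ?_
  simp only [mul_add, Finset.sum_add_distrib, add_mul, Finset.sum_mul]
  rw [add_assoc]
  congr 1
  rw [add_comm]
  congr 1
  · rw [Finset.sum_comm]
    refine Finset.sum_congr rfl fun μ _ => Finset.sum_congr rfl fun ν _ => by ring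
  · rw [Finset.sum_comm]
    refine Finset.sum_congr rfl fun μ _ => Finset.sum_congr rfl fun ν _ => by ring

theorem unit_at {k : ℕ} (I J : Fin 4 → ℕ) (hJ : ∑ μ, J μ ≤ k) (c c' : Comp) :
    (unit k I c).at J c' = if J = I ∧ c' = c then 1 else 0 := at_of_le _ hJ c'

/-- A field of multimomenta is determined by the divergences of its pairings with the variations
which vanish at a point. -/
theorem eq_zero_of_div_pairing {U : Set Coord} (hU : IsOpen U) {P : Coord → MomFib}
    (hP : ∀ q, ContDiffOn ℝ ∞ (fun z => P z q) U)
    (h : ∀ z ∈ U, ∀ v : JetFib 2, (∀ c, v.at 0 c = 0) →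
      ∑ μ, pd μ (fun w => pairing (P w) (jet 1 (poly z v) w) μ) z = 0) :
    ∀ z ∈ U, P z = 0 := by
  have h' : ∀ z ∈ U, ∀ v : JetFib 2, (∀ c, v.at 0 c = 0) →
      ∑ c, (∑ μ, (P z (Sum.inl μ, c) +
          ∑ ν, (nfac μ ν)⁻¹ * pd ν (fun w => P w (Sum.inr (sym μ ν), c)) z) * v.at (one μ) c +
        ∑ μ, ∑ ν, (nfac μ ν)⁻¹ * P z (Sum.inr (sym μ ν), c) * v.at (one μ + one ν) c) = 0 := by
    intro z hz v hv
    have e := div_pairing hU hP (poly_contDiffOn z v U) hz (fun c => by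
      rw [← jet_at_zero 2 (poly z v) z c, jet_poly, hv])
    rw [jet_poly] at e
    rw [← e, h z hz v hv]
  -- Testing with a single second derivative isolates one `p_c^{αβ}`. The two ordered pairs give the
  -- same component because the momenta are symmetric.
  have h2 : ∀ z ∈ U, ∀ α β c, P z (Sum.inr (sym α β), c) = 0 := by
    intro z hz α β c
    have e := h' z hz (unit 2 (one α + one β) c) (fun c' => by
      rw [unit_at _ _ (sum_zero_le 2), if_neg fun hh => one_add_ne_zero _ _ hh.1.symm])
    rw [Finset.sum_eq_single c] at e
    · have e1 : ∀ μ, (unit 2 (one α + one β) c).at (one μ) c = 0 := fun μ => by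
        rw [unit_at _ _ (sum_one_le 1 μ), if_neg fun hh => one_ne_one_add _ _ _ hh.1]
      have e2 : ∀ μ ν, (nfac μ ν)⁻¹ * P z (Sum.inr (sym μ ν), c) *
          (unit 2 (one α + one β) c).at (one μ + one ν) c =
          (nfac μ ν)⁻¹ * (if one α + one β = one μ + one ν then
            P z (Sum.inr (sym α β), c) else 0) := by
        intro μ ν
        rw [unit_at _ _ (sum_one_add_le 0 μ ν)]
        by_cases hh : one μ + one ν = one α + one β
        · rcases one_add_inj.1 hh with ⟨rfl, rfl⟩ | ⟨rfl, rfl⟩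
          · simp
          · simp [add_comm, sym_comm]
        · simp [hh, Ne.symm hh]
      simpa only [e1, e2, mul_zero, Finset.sum_const_zero, zero_add, sum_nfac_inv] using e
    · intro b _ hb
      have e1 : ∀ μ, (unit 2 (one α + one β) c).at (one μ) b = 0 := fun μ => by
        rw [unit_at _ _ (sum_one_le 1 μ), if_neg fun hh => hb hh.2]
      have e2 : ∀ μ ν, (unit 2 (one α + one β) c).at (one μ + one ν) b = 0 := fun μ ν => by
        rw [unit_at _ _ (sum_one_add_le 0 μ ν), if_neg fun hh => hb hh.2]
      simp [e1, e2]
    · simp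
  -- The vanishing just found holds on the whole open set and can be differentiated. This is why the
  -- hypothesis concerns every point of `U`. Tests with first derivatives then see `p_c^μ` alone.
  have h3 : ∀ z ∈ U, ∀ α β c κ, pd κ (fun w => P w (Sum.inr (sym α β), c)) z = 0 := by
    intro z hz α β c κ
    rw [pd_congr hU (g := fun _ => 0) (fun w hw => h2 w hw α β c) κ hz]
    simp [pd]
  intro z hz
  funext ⟨q, c⟩
  rcases q with α | m
  · have e := h' z hz (unit 2 (one α) c) (fun c' => by
      rw [unit_at _ _ (sum_zero_le 2), if_neg fun hh => one_ne_zero' _ hh.1.symm])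
    simp only [h2 z hz, h3 z hz, mul_zero, zero_mul, Finset.sum_const_zero, add_zero] at e
    rw [Finset.sum_eq_single c, Finset.sum_eq_single α] at e
    · simpa [unit_at _ _ (sum_one_le 1 α)] using e
    · intro μ _ hμ
      rw [unit_at _ _ (sum_one_le 1 μ), if_neg fun hh => hμ (one_inj hh.1), mul_zero]
    · simp
    · intro b _ hb
      refine Finset.sum_eq_zero fun μ _ => ?_
      rw [unit_at _ _ (sum_one_le 1 μ), if_neg fun hh => hb hh.2, mul_zero]
    · simp
  · rw [← sym_self m]
    exact h2 z hz _ _ c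

/-! ### The Piola identity -/

theorem pd_sum_mul {ι : Type} (t : Finset ι) {f g : ι → Coord → ℝ} {z : Coord}
    (hf : ∀ i, DifferentiableAt ℝ (f i) z) (hg : ∀ i, DifferentiableAt ℝ (g i) z) (μ : Fin 4) :
    pd μ (fun w => ∑ i ∈ t, f i w * g i w) z =
      ∑ i ∈ t, (f i z * pd μ (g i) z + pd μ (f i) z * g i z) := by
  have h : ∀ i ∈ t, DifferentiableAt ℝ (fun w => f i w * g i w) z := fun i _ => (hf i).mul (hg i)
  rw [pd_fun_sum t h]
  exact Finset.sum_congr rfl fun i _ => pd_fun_mul (hf i) (hg i) μ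

/-- A nontrivial permutation moves at least two indices, so after one factor is differentiated an
off-diagonal entry of the identity matrix remains. Only the identity permutation contributes, and it
gives the trace. -/
theorem pd_det_of_eq_one {A : Coord → Matrix (Fin 4) (Fin 4) ℝ} {z : Coord}
    (hA : ∀ i j, DifferentiableAt ℝ (fun w => A w i j) z) (h1 : A z = 1) (μ : Fin 4) :
    pd μ (fun w => (A w).det) z = ∑ i, pd μ (fun w => A w i i) z := by
  have hd : ∀ p : Equiv.Perm (Fin 4), HasFDerivAt (fun w => ∏ i, A w (p i) i)
      (∑ i, (∏ j ∈ Finset.univ.erase i, A z (p j) j) • fderiv ℝ (fun w => A w (p i) i) z) z :=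
    fun p => HasFDerivAt.finsetProd fun i _ => (hA (p i) i).hasFDerivAt
  have hp : ∀ p : Equiv.Perm (Fin 4), p ≠ 1 → ∀ i,
      ∏ j ∈ Finset.univ.erase i, A z (p j) j = 0 := by
    intro p hp i
    obtain ⟨j, hj, hne⟩ : ∃ j, j ≠ i ∧ p j ≠ j := by
      by_contra hc
      push Not at hc
      refine hp (Equiv.ext fun j => ?_)
      by_cases hji : j = i
      · subst hji
        by_contra hpj
        exact hpj (p.injective (hc _ hpj))
      · exact hc j hji
    refine Finset.prod_eq_zero (Finset.mem_erase.2 ⟨hj, Finset.mem_univ j⟩) ?_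
    rw [h1, Matrix.one_apply_ne hne]
  have hs : HasFDerivAt (fun w => (A w).det) (∑ p : Equiv.Perm (Fin 4),
      ((Equiv.Perm.sign p : ℤ) : ℝ) • ∑ i, (∏ j ∈ Finset.univ.erase i, A z (p j) j) •
        fderiv ℝ (fun w => A w (p i) i) z) z := by
    simp only [Matrix.det_apply']
    exact HasFDerivAt.fun_sum fun p _ => (hd p).const_mul _
  rw [pd, hs.fderiv, _root_.sum_apply, Finset.sum_eq_single 1]
  · simp only [Equiv.Perm.sign_one, Units.val_one, Int.cast_one, one_smul, Equiv.Perm.one_apply,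
      _root_.sum_apply]
    refine Finset.sum_congr rfl fun i _ => ?_
    simp [h1, pd]
  · intro p _ hne
    simp [hp p hne]
  · simp

/-- The Jacobian matrix with entries `∂σ^κ/∂w^μ` in row `κ` and column `μ`. -/
def jac (σ : Coord → Coord) (z : Coord) : Matrix (Fin 4) (Fin 4) ℝ :=
  Matrix.of fun κ μ => fderiv ℝ σ z (dir μ) κ

theorem jac_det (σ : Coord → Coord) (z : Coord) : (jac σ z).det = (fderiv ℝ σ z).det := by
  have h := LinearMap.det_toMatrix (EuclideanSpace.basisFun (Fin 4) ℝ).toBasis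
    (fderiv ℝ σ z : Coord →ₗ[ℝ] Coord)
  rw [ContinuousLinearMap.det, ← h]
  congr 1

theorem jac_mul_jac {U W : Set Coord} (hU : IsOpen U) (hW : IsOpen W) {σ τ : Coord → Coord}
    (hσ : ContDiffOn ℝ ∞ σ U) (hτ : ContDiffOn ℝ ∞ τ W) (hm : MapsTo σ U W)
    (hi : EqOn (fun w => τ (σ w)) id U) {z : Coord} (hz : z ∈ U) :
    jac τ (σ z) * jac σ z = 1 := by
  ext ν μ
  have h := fderiv_comp_apply hU hW hτ hσ hm hz (dir μ) ν
  rw [Filter.EventuallyEq.fderiv_eq (hi.eventuallyEq_of_mem (hU.mem_nhds hz)), fderiv_id] at h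
  simp only [Matrix.mul_apply, jac, Matrix.of_apply]
  rw [Matrix.one_apply]
  simp only [mul_comm] at h ⊢
  rw [← h]
  simp [dir]

theorem jac_contDiffOn {U : Set Coord} (hU : IsOpen U) {σ : Coord → Coord}
    (hσ : ContDiffOn ℝ ∞ σ U) (κ μ : Fin 4) : ContDiffOn ℝ ∞ (fun w => jac σ w κ μ) U :=
  fderiv_contDiffOn hU hσ μ κ

theorem jac_eq_pd {U : Set Coord} (hU : IsOpen U) {σ : Coord → Coord}
    (hσ : ContDiffOn ℝ ∞ σ U) (κ μ : Fin 4) :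
    EqOn (fun w => jac σ w κ μ) (pd μ (fun w => σ w κ)) U := fun z hz => by
  have h := (EuclideanSpace.proj κ : Coord →L[ℝ] ℝ).hasFDerivAt.comp z
    (contDiffOn_diffAt hσ hU hz).hasFDerivAt
  have e : fderiv ℝ (fun w => σ w κ) z = _ := HasFDerivAt.fderiv h
  simp [pd, e, jac]

theorem pd_jac_comm {U : Set Coord} (hU : IsOpen U) {σ : Coord → Coord}
    (hσ : ContDiffOn ℝ ∞ σ U) (κ μ ν : Fin 4) {z : Coord} (hz : z ∈ U) :
    pd ν (fun w => jac σ w κ μ) z = pd μ (fun w => jac σ w κ ν) z := by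
  rw [pd_congr hU (jac_eq_pd hU hσ κ μ) ν hz, pd_congr hU (jac_eq_pd hU hσ κ ν) μ hz]
  exact pd_comm hU (coord_contDiffOn hσ κ) ν μ hz

section Piola

variable {U W : Set Coord} {σ τ : Coord → Coord}

/-- Jacobi's formula for the derivative of a determinant, with the inverse of the Jacobian matrix
frozen at `z`. -/
theorem pd_det_jac (hU : IsOpen U) (hσ : ContDiffOn ℝ ∞ σ U) {K : Matrix (Fin 4) (Fin 4) ℝ}
    {z : Coord} (hz : z ∈ U) (hK : K * jac σ z = 1) (μ : Fin 4) :
    pd μ (fun w => (jac σ w).det) z =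
      (jac σ z).det * ∑ i, ∑ a, K i a * pd μ (fun w => jac σ w a i) z := by
  have hd : (jac σ z).det * K.det = 1 := by
    rw [mul_comm, ← Matrix.det_mul, hK, Matrix.det_one]
  -- Multiplication by the constant matrix `K` moves the value at `z` to the identity, where the
  -- derivative of the determinant is a trace.
  have e : (fun w => (jac σ w).det) = fun w => (jac σ z).det * (K * jac σ w).det := by
    funext w
    rw [Matrix.det_mul, ← mul_assoc, hd, one_mul]
  have hJ : ∀ κ ν, DifferentiableAt ℝ (fun w => jac σ w κ ν) z := fun κ ν =>
    contDiffOn_diffAt (jac_contDiffOn hU hσ κ ν) hU hz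
  have hA : ∀ i j, DifferentiableAt ℝ (fun w => (K * jac σ w) i j) z := fun i j => by
    simp only [Matrix.mul_apply]
    exact DifferentiableAt.fun_sum fun a _ => (hJ a j).const_mul _
  have hdet : DifferentiableAt ℝ (fun w => (K * jac σ w).det) z := by
    simp only [Matrix.det_apply']
    exact DifferentiableAt.fun_sum fun p _ =>
      (HasFDerivAt.finsetProd fun i _ => (hA (p i) i).hasFDerivAt).differentiableAt.const_mul _
  conv_lhs => rw [e]
  rw [pd_const_mul _ hdet, pd_det_of_eq_one hA hK]
  congr 1
  refine Finset.sum_congr rfl fun i _ => ?_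
  simp only [Matrix.mul_apply]
  rw [pd_fun_sum _ fun a _ => (hJ a i).const_mul _]
  exact Finset.sum_congr rfl fun a _ => pd_const_mul _ (hJ a i) μ

/-- The rule `d(J⁻¹) = -J⁻¹ (dJ) J⁻¹`: differentiate `J⁻¹ J = 1` along the coordinate change and
multiply by `J⁻¹` on the right. -/
theorem pd_jac_inv (hU : IsOpen U) (hW : IsOpen W)
    (hσ : ContDiffOn ℝ ∞ σ U) (hτ : ContDiffOn ℝ ∞ τ W) (hm : MapsTo σ U W)
    (hi : EqOn (fun w => τ (σ w)) id U) {z : Coord} (hz : z ∈ U) (μ ν κ : Fin 4) :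
    pd μ (fun w => jac τ (σ w) ν κ) z =
      -∑ b, ∑ a, jac τ (σ z) ν a * pd μ (fun w => jac σ w a b) z * jac τ (σ z) b κ := by
  have hJ : ∀ κ ν, DifferentiableAt ℝ (fun w => jac σ w κ ν) z := fun κ ν =>
    contDiffOn_diffAt (jac_contDiffOn hU hσ κ ν) hU hz
  have hK : ∀ κ ν, DifferentiableAt ℝ (fun w => jac τ (σ w) κ ν) z := fun κ ν =>
    contDiffOn_diffAt ((jac_contDiffOn hW hτ κ ν).comp hσ hm) hU hz
  have h1 : ∀ b, ∑ a, (jac τ (σ z) ν a * pd μ (fun w => jac σ w a b) z +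
      pd μ (fun w => jac τ (σ w) ν a) z * jac σ z a b) = 0 := by
    intro b
    have e : EqOn (fun w => ∑ a, jac τ (σ w) ν a * jac σ w a b)
        (fun _ => (1 : Matrix (Fin 4) (Fin 4) ℝ) ν b) U := fun w hw => by
      rw [← jac_mul_jac hU hW hσ hτ hm hi hw, Matrix.mul_apply]
    have h := pd_congr hU e μ hz
    rw [pd_sum_mul _ (fun a => hK ν a) (fun a => hJ a b)] at h
    rw [h]
    simp [pd]
  have h2 : ∀ a, ∑ b, jac σ z a b * jac τ (σ z) b κ = if a = κ then 1 else 0 := by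
    intro a
    rw [← Matrix.mul_apply, mul_eq_one_comm.1 (jac_mul_jac hU hW hσ hτ hm hi hz),
      Matrix.one_apply]
  have h3 : ∑ b, (∑ a, (jac τ (σ z) ν a * pd μ (fun w => jac σ w a b) z +
      pd μ (fun w => jac τ (σ w) ν a) z * jac σ z a b)) * jac τ (σ z) b κ = 0 := by
    simp only [h1, zero_mul, Finset.sum_const_zero]
  simp only [Finset.sum_add_distrib, add_mul, Finset.sum_mul] at h3
  have h4 : ∑ b, ∑ a, pd μ (fun w => jac τ (σ w) ν a) z * jac σ z a b * jac τ (σ z) b κ =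
      pd μ (fun w => jac τ (σ w) ν κ) z := by
    rw [Finset.sum_comm]
    simp only [mul_assoc, ← Finset.mul_sum, h2]
    simp
  rw [h4] at h3
  linarith

/-- The divergence of a vector density is a scalar density. -/
theorem piola (hU : IsOpen U) (hW : IsOpen W)
    (hσ : ContDiffOn ℝ ∞ σ U) (hτ : ContDiffOn ℝ ∞ τ W) (hm : MapsTo σ U W)
    (hi : EqOn (fun w => τ (σ w)) id U) {F : Coord → Fin 4 → ℝ}
    (hF : ∀ κ, ContDiffOn ℝ ∞ (fun x => F x κ) W) {z : Coord} (hz : z ∈ U) :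
    ∑ μ, pd μ (fun w => (jac σ w).det * ∑ κ, jac τ (σ w) μ κ * F (σ w) κ) z =
      (jac σ z).det * ∑ κ, pd κ (fun x => F x κ) (σ z) := by
  have hK : ∀ κ ν, DifferentiableAt ℝ (fun w => jac τ (σ w) κ ν) z := fun κ ν =>
    contDiffOn_diffAt ((jac_contDiffOn hW hτ κ ν).comp hσ hm) hU hz
  have hG : ∀ κ, DifferentiableAt ℝ (fun w => F (σ w) κ) z := fun κ =>
    contDiffOn_diffAt ((hF κ).comp hσ hm) hU hz
  have hd : DifferentiableAt ℝ (fun w => (jac σ w).det) z := by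
    simp only [jac_det]
    exact contDiffOn_diffAt (det_contDiffOn hU hσ) hU hz
  have e1 := jac_mul_jac hU hW hσ hτ hm hi hz
  have hs : ∀ μ, DifferentiableAt ℝ (fun w => ∑ κ, jac τ (σ w) μ κ * F (σ w) κ) z := fun μ =>
    DifferentiableAt.fun_sum fun κ _ => (hK μ κ).mul (hG κ)
  have e2 : ∀ κ l, ∑ μ, jac τ (σ z) μ κ * jac σ z l μ = if l = κ then 1 else 0 := by
    intro κ l
    rw [← Matrix.one_apply, ← mul_eq_one_comm.1 e1, Matrix.mul_apply]
    exact Finset.sum_congr rfl fun _ _ => mul_comm _ _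
  -- The first group contains the derivatives of `F` by the chain rule. The second collects the
  -- derivatives of the determinant and of the inverse Jacobian matrix, and has to vanish after
  -- summation over `μ`.
  have key : ∀ μ, pd μ (fun w => (jac σ w).det * ∑ κ, jac τ (σ w) μ κ * F (σ w) κ) z =
      (jac σ z).det * (∑ κ, ∑ l, jac τ (σ z) μ κ * jac σ z l μ * pd l (fun x => F x κ) (σ z)) +
      (jac σ z).det * ∑ κ, F (σ z) κ * (∑ i, ∑ a, jac τ (σ z) i a *
        pd μ (fun w => jac σ w a i) z * jac τ (σ z) μ κ -
        ∑ b, ∑ a, jac τ (σ z) μ a * pd μ (fun w => jac σ w a b) z * jac τ (σ z) b κ) := by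
    intro μ
    rw [pd_fun_mul hd (hs μ), pd_sum_mul _ (hK μ) hG,
      pd_det_jac hU hσ hz e1]
    have h5 : ∀ κ, pd μ (fun w => F (σ w) κ) z =
        ∑ l, jac σ z l μ * pd l (fun x => F x κ) (σ z) := fun κ =>
      pd_comp hU hW hσ hm (hF κ) μ hz
    simp only [pd_jac_inv hU hW hσ hτ hm hi hz, h5]
    rw [mul_assoc, ← mul_add, ← mul_add]
    congr 1
    rw [Finset.mul_sum, ← Finset.sum_add_distrib, ← Finset.sum_add_distrib]
    refine Finset.sum_congr rfl fun κ _ => ?_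
    simp only [mul_assoc, ← Finset.mul_sum]
    have h6 : (∑ i, ∑ a, jac τ (σ z) i a * pd μ (fun w => jac σ w a i) z) *
        jac τ (σ z) μ κ = ∑ i, ∑ a, jac τ (σ z) i a *
          (pd μ (fun w => jac σ w a i) z * jac τ (σ z) μ κ) := by
      simp only [Finset.sum_mul, mul_assoc]
    rw [← h6]
    ring
  simp only [key]
  rw [Finset.sum_add_distrib, ← Finset.mul_sum, ← Finset.mul_sum]
  -- The two triple sums become equal after renaming the summation indices, because second partial
  -- derivatives of `σ` commute.
  have z1 : ∑ μ, ∑ κ, F (σ z) κ * (∑ i, ∑ a, jac τ (σ z) i a *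
        pd μ (fun w => jac σ w a i) z * jac τ (σ z) μ κ -
        ∑ b, ∑ a, jac τ (σ z) μ a * pd μ (fun w => jac σ w a b) z * jac τ (σ z) b κ) = 0 := by
    rw [Finset.sum_comm]
    refine Finset.sum_eq_zero fun κ _ => ?_
    rw [← Finset.mul_sum, Finset.sum_sub_distrib]
    rw [Finset.sum_comm (f := fun μ b => ∑ a, jac τ (σ z) μ a *
      pd μ (fun w => jac σ w a b) z * jac τ (σ z) b κ)]
    rw [sub_eq_zero.2, mul_zero]
    refine Finset.sum_congr rfl fun μ _ => Finset.sum_congr rfl fun i _ =>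
      Finset.sum_congr rfl fun a _ => ?_
    rw [pd_jac_comm hU hσ a i μ hz]
  rw [z1, mul_zero, add_zero]
  congr 1
  rw [Finset.sum_comm]
  refine Finset.sum_congr rfl fun κ _ => ?_
  rw [Finset.sum_comm]
  simp only [← Finset.sum_mul, e2]
  simp

end Piola

/-! ### Covariance of the Legendre map of an invariant Lagrangian -/

theorem contDiffOn_dL {O : Set (Coord × JetFib 2)} (hO : IsOpen O) {L : Coord × JetFib 2 → ℝ}
    (hL : ContDiffOn ℝ ∞ L O) (I : Fin 4 → ℕ) (c : Comp) : ContDiffOn ℝ ∞ (dL L I c) O :=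
  (hL.fderiv_of_isOpen hO (m := ∞) (by simp)).clm_apply contDiffOn_const

theorem dL_sym (L : Coord × JetFib 2 → ℝ) (μ ν : Fin 4) (c : Comp) :
    dL L (one (sym μ ν).1.1 + one (sym μ ν).1.2) c = dL L (one μ + one ν) c := by
  rcases le_total μ ν with h | h
  · simp only [sym, min_eq_left h, max_eq_right h]
  · simp only [sym, min_eq_right h, max_eq_left h, add_comm]

/-! ### The momenta along a section and the first variation formula. -/

section Variation

variable {O : Set (Coord × JetFib 2)} {L : Coord × JetFib 2 → ℝ} {U : Set Coord}
  {s : Coord → Comp → ℝ}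

theorem contDiffOn_comp_jet (hU : IsOpen U)
    (hs : ∀ c, ContDiffOn ℝ ∞ (fun w => s w c) U) {k : ℕ} {O : Set (Coord × JetFib k)}
    (hsO : ∀ w ∈ U, (w, jet k s w) ∈ O) {f : Coord × JetFib k → ℝ} (hf : ContDiffOn ℝ ∞ f O) :
    ContDiffOn ℝ ∞ (fun w => f (w, jet k s w)) U :=
  hf.comp (contDiffOn_id.prodMk (jet_contDiffOn hU hs k)) hsO

theorem legendre_jet_inr (s : Coord → Comp → ℝ) (w : Coord) (μ ν : Fin 4) (c : Comp) :
    legendre L (w, jet 3 s w) (Sum.inr (sym μ ν), c) = dL L (one μ + one ν) c (w, jet 2 s w) := by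
  simp only [legendre, dL_sym, trunc_jet (show 2 ≤ 3 by norm_num)]

/-- Along a section the total derivatives become ordinary derivatives. The correction in `p_c^μ` is
then precisely the weighted divergence of `p_c^{μν}` which occurs in `div_pairing`. -/
theorem legendre_jet_inl (hO : IsOpen O) (hL : ContDiffOn ℝ ∞ L O) (hU : IsOpen U)
    (hs : ∀ c, ContDiffOn ℝ ∞ (fun w => s w c) U) (hsO : ∀ w ∈ U, (w, jet 2 s w) ∈ O)
    {w : Coord} (hw : w ∈ U) (μ : Fin 4) (c : Comp) :
    legendre L (w, jet 3 s w) (Sum.inl μ, c) = dL L (one μ) c (w, jet 2 s w) -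
      ∑ ν, (nfac μ ν)⁻¹ *
        pd ν (fun x => legendre L (x, jet 3 s x) (Sum.inr (sym μ ν), c)) w := by
  simp only [legendre_jet_inr]
  simp only [legendre, trunc_jet (show 2 ≤ 3 by norm_num)]
  congr 1
  refine Finset.sum_congr rfl fun ν _ => ?_
  rw [totalDeriv_jet hU hs hw (contDiffOn_diffAt (contDiffOn_dL hO hL _ _) hO (hsO w hw))]

theorem contDiffOn_legendre_jet (hO : IsOpen O) (hL : ContDiffOn ℝ ∞ L O) (hU : IsOpen U)
    (hs : ∀ c, ContDiffOn ℝ ∞ (fun w => s w c) U) (hsO : ∀ w ∈ U, (w, jet 2 s w) ∈ O)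
    (q : (Fin 4 ⊕ SymIdx) × Comp) :
    ContDiffOn ℝ ∞ (fun w => legendre L (w, jet 3 s w) q) U := by
  have h2 : ∀ μ ν c,
      ContDiffOn ℝ ∞ (fun w => legendre L (w, jet 3 s w) (Sum.inr (sym μ ν), c)) U := by
    intro μ ν c
    simp only [legendre_jet_inr]
    exact contDiffOn_comp_jet hU hs hsO (contDiffOn_dL hO hL _ _)
  obtain ⟨μ | m, c⟩ := q
  · refine ContDiffOn.congr ?_ fun w hw => legendre_jet_inl hO hL hU hs hsO hw μ c
    exact (contDiffOn_comp_jet hU hs hsO (contDiffOn_dL hO hL _ _)).sub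
      (ContDiffOn.sum fun ν _ => contDiffOn_const.mul (pd_contDiffOn hU (h2 μ ν c) ν))
  · rw [← sym_self m]
    exact h2 _ _ c

/-- The first variation formula at a point where the variation vanishes. -/
theorem first_variation (hO : IsOpen O) (hL : ContDiffOn ℝ ∞ L O) (hU : IsOpen U)
    (hs : ∀ c, ContDiffOn ℝ ∞ (fun w => s w c) U) (hsO : ∀ w ∈ U, (w, jet 2 s w) ∈ O)
    {η : Coord → Comp → ℝ} (hη : ∀ c, ContDiffOn ℝ ∞ (fun w => η w c) U) {z : Coord}
    (hz : z ∈ U) (h0 : ∀ c, η z c = 0) :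
    ∑ μ, pd μ (fun w => pairing (legendre L (w, jet 3 s w)) (jet 1 η w) μ) z =
      fderiv ℝ L (z, jet 2 s z) (0, jet 2 η z) := by
  rw [div_pairing hU (contDiffOn_legendre_jet hO hL hU hs hsO) hη hz h0]
  have h := linear_two_decomp ((fderiv ℝ L (z, jet 2 s z)).comp
    (ContinuousLinearMap.inr ℝ Coord (JetFib 2))) (jet 2 η z)
    (fun c => (jet_at_zero 2 η z c).trans (h0 c))
  simp only [ContinuousLinearMap.comp_apply, ContinuousLinearMap.inr_apply] at h
  rw [h]
  -- The divergence of `p_c^{μν}` subtracted in `p_c^μ` cancels the one produced by the product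
  -- rule, which leaves the expansion of the differential of `L` in coordinates.
  simp only [legendre_jet_inl hO hL hU hs hsO hz, sub_add_cancel]
  simp only [legendre_jet_inr]
  rfl

end Variation

theorem pairing_sub (P P' : MomFib) (v : JetFib 1) (μ : Fin 4) :
    pairing (P - P') v μ = pairing P v μ - pairing P' v μ := by
  simp only [pairing, Pi.sub_apply, sub_mul, mul_sub, Finset.sum_sub_distrib,
    Finset.sum_add_distrib]
  ring

theorem contDiffOn_pairing {U : Set Coord} (hU : IsOpen U) {P : Coord → MomFib}
    (hP : ∀ q, ContDiffOn ℝ ∞ (fun z => P z q) U) {η : Coord → Comp → ℝ}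
    (hη : ∀ c, ContDiffOn ℝ ∞ (fun w => η w c) U) (μ : Fin 4) :
    ContDiffOn ℝ ∞ (fun w => pairing (P w) (jet 1 η w) μ) U := by
  simp only [pairing, jet_at_zero, jet_at_one]
  exact ContDiffOn.sum fun c _ => ((hP _).mul (hη c)).add (ContDiffOn.sum fun ν _ =>
    (contDiffOn_const.mul (hP _)).mul (pd_contDiffOn hU (hη c) ν))

/-- The jets with a Lorentzian metric, in coordinates. -/
def lorentzDomain (k : ℕ) : Set (Coord × JetFib k) := {q | IsLorentzian (metric q.2)}

theorem isOpen_lorentzDomain (k : ℕ) : IsOpen (lorentzDomain k) :=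
  isOpen_isLorentzian.preimage ((metric_continuous k).comp continuous_snd)

theorem metric_jet (k l : ℕ) (s : Coord → Comp → ℝ) (z : Coord) :
    metric (jet k s z) = metric (jet l s z) := by
  ext α β
  simp only [metric, Matrix.of_apply, jet_at_zero]

/-- A Lagrangian density is invariant under the coordinate change `σ`. -/
def IsInvariantUnder (L : Coord × JetFib 2 → ℝ) (σ : Coord → Coord) (U : Set Coord) : Prop :=
  ∀ z ∈ U, ∀ v : JetFib 2, IsLorentzian (metric v) →
    L (z, jetChange 2 σ z v) = (fderiv ℝ σ z).det * L (σ z, v)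

/-! ### An invariant Lagrangian density has a covariant Legendre map. -/

section Covariance

variable {L : Coord × JetFib 2 → ℝ} {U W : Set Coord} {σ τ : Coord → Coord}

/-- The invariance holds for all jets near `v`, since being Lorentzian is an open condition, and can
be differentiated in the fibre. The change of jets is linear, so it is its own derivative. -/
theorem IsInvariantUnder.fderiv_apply (hL : ContDiffOn ℝ ∞ L (lorentzDomain 2))
    (h : IsInvariantUnder L σ U) {z : Coord} (hz : z ∈ U) {v : JetFib 2}
    (hv : IsLorentzian (metric v)) (hv' : IsLorentzian (metric (jetChange 2 σ z v)))
    (y : JetFib 2) :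
    fderiv ℝ L (z, jetChange 2 σ z v) (0, jetChange 2 σ z y) =
      (fderiv ℝ σ z).det * fderiv ℝ L (σ z, v) (0, y) := by
  have hO := isOpen_lorentzDomain 2
  have d1 := (contDiffOn_diffAt hL hO (z := (z, jetChange 2 σ z v)) hv').hasFDerivAt
  have d2 := (contDiffOn_diffAt hL hO (z := (σ z, v)) hv).hasFDerivAt
  have c1 : HasFDerivAt (fun u => L (z, jetChange 2 σ z u)) _ v :=
    HasFDerivAt.comp (f := fun u : JetFib 2 => (z, jetChange 2 σ z u)) v d1
      ((hasFDerivAt_const z v).prodMk (jetChange 2 σ z).hasFDerivAt)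
  have c2 : HasFDerivAt (fun u => (fderiv ℝ σ z).det * L (σ z, u)) _ v :=
    (HasFDerivAt.comp (f := fun u : JetFib 2 => (σ z, u)) v d2
      ((hasFDerivAt_const (σ z) v).prodMk (hasFDerivAt_id v))).const_mul _
  have e : (fun u => L (z, jetChange 2 σ z u)) =ᶠ[𝓝 v]
      fun u => (fderiv ℝ σ z).det * L (σ z, u) := by
    filter_upwards [(isOpen_isLorentzian.preimage (metric_continuous 2)).mem_nhds hv] with u hu
    exact h z hz u hu
  have := (c1.congr_of_eventuallyEq e.symm).unique c2
  simpa using congrArg (fun A : JetFib 2 →L[ℝ] ℝ => A y) this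

/-- Both sides extend to fields of multimomenta along a section, and `eq_zero_of_div_pairing`
reduces their equality to that of the divergences of their pairings with variations vanishing at a
point. The first variation formula gives these divergences in both coordinate systems; the Piola
identity and the invariance of `L` match them. -/
theorem legendre_covariant (hL : ContDiffOn ℝ ∞ L (lorentzDomain 2)) (hU : IsOpen U)
    (hW : IsOpen W) (hσ : ContDiffOn ℝ ∞ σ U) (hτ : ContDiffOn ℝ ∞ τ W) (hm : MapsTo σ U W)
    (hm' : MapsTo τ W U) (hi : EqOn (fun w => τ (σ w)) id U) (hi' : EqOn (fun x => σ (τ x)) id W)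
    (hinv : IsInvariantUnder L σ U) {z : Coord} (hz : z ∈ U) {v : JetFib 3}
    (hv : IsLorentzian (metric v)) :
    legendre L (z, jetChange 3 σ z v) = momChange σ τ z (legendre L (σ z, v)) := by
  have hO := isOpen_lorentzDomain 2
  -- A section realizing the jet at `σ z`; its higher derivatives play no role.
  set s := poly (σ z) v with hs_def
  have hjs : jet 3 s (σ z) = v := jet_poly _ _
  have hLor : IsOpen {x | IsLorentzian (metric (jet 3 s x))} :=
    isOpen_isLorentzian.preimage ((metric_continuous 3).comp (continuousOn_univ.1
      (jet_contDiffOn isOpen_univ (poly_contDiffOn _ _ univ) 3).continuousOn))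
  -- The polynomial section is a Lorentzian metric only near `σ z`, so both coordinate domains are
  -- shrunk to where it is one.
  set W' := W ∩ {x | IsLorentzian (metric (jet 3 s x))} with hW'_def
  have hW' : IsOpen W' := hW.inter hLor
  set U' := U ∩ σ ⁻¹' W' with hU'_def
  have hU' : IsOpen U' := hσ.continuousOn.isOpen_inter_preimage hU hW'
  have hσ' : ContDiffOn ℝ ∞ σ U' := hσ.mono inter_subset_left
  have hτ' : ContDiffOn ℝ ∞ τ W' := hτ.mono inter_subset_left
  have hmU : MapsTo σ U' W' := fun w hw => hw.2
  have hmW : MapsTo τ W' U' := fun x hx => ⟨hm' hx.1, by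
    rw [mem_preimage, show σ (τ x) = x from hi' hx.1]
    exact hx⟩
  have hiU : EqOn (fun w => τ (σ w)) id U' := fun w hw => hi hw.1
  have hiW : EqOn (fun x => σ (τ x)) id W' := fun x hx => hi' hx.1
  have hzU : z ∈ U' := ⟨hz, hm hz, by rw [mem_ofPred_eq, hjs]; exact hv⟩
  have hsW : ∀ c, ContDiffOn ℝ ∞ (fun w => s w c) W' := poly_contDiffOn _ _ W'
  have hsU : ∀ c, ContDiffOn ℝ ∞ (fun w => pull σ s w c) U' := pull_contDiffOn hU' hσ' hmU hsW
  have hsWO : ∀ x ∈ W', (x, jet 2 s x) ∈ lorentzDomain 2 := fun x hx => by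
    change IsLorentzian (metric (jet 2 s x))
    rw [metric_jet 2 3]
    exact hx.2
  have hjU : ∀ k, ∀ w ∈ U', jet k (pull σ s) w = jetChange k σ w (jet k s (σ w)) :=
    fun k w hw => (jetChange_jet hU' hW' hσ' hmU hsW k hw).symm
  have hsUO : ∀ w ∈ U', (w, jet 2 (pull σ s) w) ∈ lorentzDomain 2 := fun w hw => by
    change IsLorentzian (metric (jet 2 (pull σ s) w))
    rw [hjU 2 w hw]
    exact isLorentzian_jetChange hU' hW' hσ' hτ' hmU hiU 2 hw (hsWO _ (hmU hw))
  have hP1 := contDiffOn_legendre_jet hO hL hU' hsU hsUO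
  have hP2 := contDiffOn_legendre_jet hO hL hW' hsW hsWO
  have hP3 : ∀ q, ContDiffOn ℝ ∞
      (fun w => momChange σ τ w (legendre L (σ w, jet 3 s (σ w))) q) U' :=
    contDiffOn_pi.1 ((momChange_contDiffOn hU' hW' hσ' hτ' hmU).clm_apply
      (contDiffOn_pi.2 fun q => (hP2 q).comp hσ' hmU))
  -- The difference of the two sides is taken at all points of `U'`, since a single point would not
  -- suffice for uniqueness; the value at `z` is read off at the end.
  have key := eq_zero_of_div_pairing hU' (P := fun w => legendre L (w, jet 3 (pull σ s) w) -
      momChange σ τ w (legendre L (σ w, jet 3 s (σ w)))) (fun q => (hP1 q).sub (hP3 q)) ?_ z hzU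
  · have e := sub_eq_zero.1 key
    rw [hjU 3 z hzU, hjs] at e
    exact e
  intro z₁ hz₁ y hy
  set η' := poly z₁ y with hη'_def
  have hη'U : ∀ c, ContDiffOn ℝ ∞ (fun w => η' w c) U' := poly_contDiffOn _ _ U'
  have hηW : ∀ c, ContDiffOn ℝ ∞ (fun w => pull τ η' w c) W' := pull_contDiffOn hW' hτ' hmW hη'U
  have hη0 : ∀ c, η' z₁ c = 0 := fun c => by
    rw [← jet_at_zero 2 η' z₁ c, hη'_def, jet_poly, hy]
  have hη0' : ∀ c, pull τ η' (σ z₁) c = 0 := by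
    have e : τ (σ z₁) = z₁ := hiU hz₁
    rintro (c | c) <;> simp [pull, e, hη0]
  -- The variation is given in the new coordinates. Its expression in the old ones is its pullback
  -- under `τ`, and pulling back under `σ` recovers it.
  have hback : EqOn (pull σ (pull τ η')) η' U' := by
    refine (pull_pull hU' hW' hτ' hσ' hmU η').trans ?_
    refine (pull_congr hU' hiU η').trans ?_
    exact fun w _ => congrFun (pull_id η') w
  have hjη : ∀ k, ∀ w ∈ U', jet k η' w = jetChange k σ w (jet k (pull τ η') (σ w)) := by
    intro k w hw
    rw [jetChange_jet hU' hW' hσ' hmU hηW k hw, jet_congr hU' hback k hw]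
  have v1 := first_variation hO hL hU' hsU hsUO hη'U hz₁ hη0
  have v2 := first_variation hO hL hW' hsW hsWO hηW (hmU hz₁) hη0'
  have hF : ∀ κ, ContDiffOn ℝ ∞
      (fun x => pairing (legendre L (x, jet 3 s x)) (jet 1 (pull τ η') x) κ) W' :=
    contDiffOn_pairing hW' hP2 hηW
  have v3 := piola hU' hW' hσ' hτ' hmU hiU hF hz₁
  -- By the definition of the change of multimomenta, the pairing transforms as a vector density,
  -- which is the form required by `piola`.
  have v4 : ∀ μ, EqOn (fun w => pairing (momChange σ τ w (legendre L (σ w, jet 3 s (σ w))))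
      (jet 1 η' w) μ) (fun w => (jac σ w).det * ∑ κ, jac τ (σ w) μ κ *
        pairing (legendre L (σ w, jet 3 s (σ w))) (jet 1 (pull τ η') (σ w)) κ) U' := by
    intro μ w hw
    have e : τ (σ w) = w := hiU hw
    have e2 : jetChange 1 τ (σ w) (jet 1 η' w) = jet 1 (pull τ η') (σ w) := by
      have := jetChange_jet hW' hU' hτ' hmW hη'U 1 (hmU hw)
      rwa [e] at this
    simp only [pairing_momChange hW' σ hτ' (hmU hw), pairingChange, jac_det, e2]
    rfl
  -- For the transformed momenta: by Piola the divergence is the Jacobian determinant times the one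
  -- in the old coordinates, which is a derivative of `L` there, and invariance carries it to the
  -- new coordinates.
  have v5 : ∑ μ, pd μ (fun w => pairing (momChange σ τ w (legendre L (σ w, jet 3 s (σ w))))
      (jet 1 η' w) μ) z₁ = fderiv ℝ L (z₁, jet 2 (pull σ s) z₁) (0, jet 2 η' z₁) := by
    rw [hjU 2 z₁ hz₁, hjη 2 z₁ hz₁, hinv.fderiv_apply hL hz₁.1 (hsWO _ (hmU hz₁)) (by
      rw [← hjU 2 z₁ hz₁]
      exact hsUO z₁ hz₁), ← v2, ← jac_det, ← v3]
    exact Finset.sum_congr rfl fun μ _ => pd_congr hU' (v4 μ) μ hz₁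
  have d1 := fun μ => contDiffOn_diffAt (contDiffOn_pairing hU' hP1 hη'U μ) hU' hz₁
  have d3 := fun μ => contDiffOn_diffAt (contDiffOn_pairing hU' hP3 hη'U μ) hU' hz₁
  have e : ∀ μ, pd μ (fun w => pairing (legendre L (w, jet 3 (pull σ s) w) -
      momChange σ τ w (legendre L (σ w, jet 3 s (σ w)))) (jet 1 η' w) μ) z₁ =
      pd μ (fun w => pairing (legendre L (w, jet 3 (pull σ s) w)) (jet 1 η' w) μ) z₁ -
      pd μ (fun w => pairing (momChange σ τ w (legendre L (σ w, jet 3 s (σ w))))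
        (jet 1 η' w) μ) z₁ := by
    intro μ
    simp only [pairing_sub]
    simp only [pd]
    rw [fderiv_fun_sub (d1 μ) (d3 μ)]
    rfl
  simp only [e, Finset.sum_sub_distrib]
  rw [v1, v5, sub_self]

end Covariance

/-! ### Smoothness of the Lagrangian -/

/-- The indices of the signature already add up to four, so the radical of the form is zero. For a
symmetric matrix the kernel lies in the radical. -/
theorem IsLorentzian.det_ne_zero {A : Matrix (Fin 4) (Fin 4) ℝ} (hA : IsLorentzian A)
    (hs : A.transpose = A) : A.det ≠ 0 := by
  intro h0
  obtain ⟨x, hx, hAx⟩ := Matrix.exists_mulVec_eq_zero_iff.2 h0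
  have h := QuadraticForm.sigPos_add_sigNeg_add_radical (Q := A.toQuadraticForm')
  rw [Module.finrank_fin_fun, hA.1, hA.2] at h
  have hb : A.toQuadraticForm'.radical = ⊥ := Submodule.finrank_eq_zero.1 (by omega)
  have hxr : x ∈ A.toQuadraticForm'.radical := by
    rw [QuadraticMap.mem_radical_iff']
    refine ⟨by rw [toQuadraticForm'_eq, hAx, dotProduct_zero], fun n => ?_⟩
    have hz : x ⬝ᵥ A.mulVec n = 0 := by
      rw [Matrix.dotProduct_mulVec, ← Matrix.mulVec_transpose, hs, hAx, zero_dotProduct]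
    rw [toQuadraticForm'_eq, toQuadraticForm'_eq, Matrix.mulVec_add, hAx, zero_add,
      add_dotProduct, hz, zero_add]
  rw [hb] at hxr
  exact hx hxr

theorem metric_transpose {k : ℕ} (v : JetFib k) : (metric v).transpose = metric v := by
  ext α β
  simp [metric, sym_comm α β]

theorem metric_det_ne_zero {k : ℕ} {v : JetFib k} (hv : IsLorentzian (metric v)) :
    (metric v).det ≠ 0 := hv.det_ne_zero (metric_transpose v)

section Smooth

variable {E : Type*} [NormedAddCommGroup E] [NormedSpace ℝ E]

theorem contDiffOn_det {S : Set E} {n : Type} [Fintype n] [DecidableEq n] {A : E → Matrix n n ℝ}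
    (hA : ∀ i j, ContDiffOn ℝ ∞ (fun x => A x i j) S) : ContDiffOn ℝ ∞ (fun x => (A x).det) S := by
  simp only [Matrix.det_apply']
  exact ContDiffOn.sum fun p _ => contDiffOn_const.mul (contDiffOn_prod fun i _ => hA _ _)

/-- Cramer's rule: the entries of the inverse are cofactors divided by the nonvanishing determinant.
-/
theorem contDiffOn_inv_apply {S : Set E} {n : Type} [Fintype n] [DecidableEq n]
    {A : E → Matrix n n ℝ} (hA : ∀ i j, ContDiffOn ℝ ∞ (fun x => A x i j) S)
    (h0 : ∀ x ∈ S, (A x).det ≠ 0) (i j : n) : ContDiffOn ℝ ∞ (fun x => (A x)⁻¹ i j) S := by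
  simp only [Matrix.inv_def, Ring.inverse_eq_inv', Matrix.smul_apply, smul_eq_mul,
    Matrix.adjugate_apply]
  refine ((contDiffOn_det hA).inv h0).mul (contDiffOn_det fun a b => ?_)
  simp only [Matrix.updateRow_apply]
  by_cases h : a = j
  · simp only [h, if_true]
    exact contDiffOn_const
  · simp only [h, if_false]
    exact hA a b

end Smooth

theorem contDiff_at {k : ℕ} (I : Fin 4 → ℕ) (c : Comp) :
    ContDiff ℝ ∞ (fun v : JetFib k => v.at I c) := by
  by_cases h : ∑ μ, I μ ≤ k
  · simp only [JetFib.at, h, dif_pos]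
    exact contDiff_apply ℝ ℝ _
  · simp only [JetFib.at, h, dif_neg, not_false_iff]
    exact contDiff_const

theorem contDiffOn_at {k : ℕ} (I : Fin 4 → ℕ) (c : Comp) (S : Set (Coord × JetFib k)) :
    ContDiffOn ℝ ∞ (fun q : Coord × JetFib k => q.2.at I c) S :=
  ((contDiff_at I c).comp contDiff_snd).contDiffOn

theorem at_add {k : ℕ} (v w : JetFib k) (I : Fin 4 → ℕ) (c : Comp) :
    (v + w).at I c = v.at I c + w.at I c := by
  by_cases h : ∑ μ, I μ ≤ k <;> simp [JetFib.at, h]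

theorem at_smul {k : ℕ} (a : ℝ) (v : JetFib k) (I : Fin 4 → ℕ) (c : Comp) :
    (a • v).at I c = a * v.at I c := by
  by_cases h : ∑ μ, I μ ≤ k <;> simp [JetFib.at, h]

/-- The truncation of jets as a continuous linear map. -/
def truncL (k l : ℕ) : JetFib k →L[ℝ] JetFib l :=
  LinearMap.toContinuousLinearMap
    { toFun := trunc l
      map_add' := fun v w => funext fun _ => at_add v w _ _
      map_smul' := fun a v => funext fun _ => at_smul a v _ _ }

theorem truncL_apply {k : ℕ} (l : ℕ) (v : JetFib k) : truncL k l v = trunc l v := rfl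

/-- The map of jets `y^c_I ↦ y^c_{I + μ}` as a continuous linear map. -/
def shiftL (k : ℕ) (μ : Fin 4) : JetFib (k + 1) →L[ℝ] JetFib k :=
  LinearMap.toContinuousLinearMap
    { toFun := fun v r => v.at (r.1.1 + one μ) r.2
      map_add' := fun v w => funext fun _ => at_add v w _ _
      map_smul' := fun a v => funext fun _ => at_smul a v _ _ }

theorem totalDeriv_eq {k : ℕ} (τ : Fin 4) (f : Coord × JetFib k → ℝ) (q : Coord × JetFib (k + 1)) :
    totalDeriv τ f q = fderiv ℝ f (q.1, truncL (k + 1) k q.2) (dir τ, shiftL k τ q.2) := rfl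

theorem mem_lorentzDomain_trunc {k : ℕ} (l : ℕ) {q : Coord × JetFib k} (hq : q ∈ lorentzDomain k) :
    (q.1, trunc l q.2) ∈ lorentzDomain l := by
  change IsLorentzian (metric (trunc l q.2))
  rw [metric_trunc]
  exact hq

theorem contDiffOn_comp_trunc {k l : ℕ} {f : Coord × JetFib l → ℝ}
    (hf : ContDiffOn ℝ ∞ f (lorentzDomain l)) :
    ContDiffOn ℝ ∞ (fun q : Coord × JetFib k => f (q.1, trunc l q.2)) (lorentzDomain k) :=
  hf.comp (contDiff_fst.prodMk ((truncL k l).contDiff.comp contDiff_snd)).contDiffOn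
    fun _ hq => mem_lorentzDomain_trunc l hq

theorem contDiffOn_totalDeriv {k : ℕ} (τ : Fin 4) {f : Coord × JetFib k → ℝ}
    (hf : ContDiffOn ℝ ∞ f (lorentzDomain k)) :
    ContDiffOn ℝ ∞ (totalDeriv τ f) (lorentzDomain (k + 1)) := by
  have h1 : ContDiffOn ℝ ∞ (fun q : Coord × JetFib (k + 1) =>
      fderiv ℝ f (q.1, truncL (k + 1) k q.2)) (lorentzDomain (k + 1)) :=
    (hf.fderiv_of_isOpen (isOpen_lorentzDomain k) (m := ∞) (by simp)).comp
      (contDiff_fst.prodMk ((truncL (k + 1) k).contDiff.comp contDiff_snd)).contDiffOn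
      fun _ hq => mem_lorentzDomain_trunc k hq
  exact h1.clm_apply (contDiff_const.prodMk ((shiftL k τ).contDiff.comp contDiff_snd)).contDiffOn

theorem contDiffOn_metric_apply {k : ℕ} (S : Set (Coord × JetFib k)) (α β : Fin 4) :
    ContDiffOn ℝ ∞ (fun q : Coord × JetFib k => metric q.2 α β) S :=
  contDiffOn_at 0 (Sum.inl (sym α β)) S

theorem contDiffOn_metric_inv {k : ℕ} (α β : Fin 4) :
    ContDiffOn ℝ ∞ (fun q : Coord × JetFib k => (metric q.2)⁻¹ α β) (lorentzDomain k) :=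
  contDiffOn_inv_apply (contDiffOn_metric_apply _) (fun _ hq => metric_det_ne_zero hq) α β

theorem contDiffOn_christoffel (γ μ ν : Fin 4) :
    ContDiffOn ℝ ∞ (christoffel γ μ ν) (lorentzDomain 1) := by
  unfold christoffel dmetric
  exact contDiffOn_const.mul (ContDiffOn.sum fun ρ _ => (contDiffOn_metric_inv γ ρ).mul
    (((contDiffOn_at _ _ _).add (contDiffOn_at _ _ _)).sub (contDiffOn_at _ _ _)))

theorem contDiffOn_ricci (α β : Fin 4) : ContDiffOn ℝ ∞ (ricci α β) (lorentzDomain 2) := by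
  have h : ∀ γ μ ν, ContDiffOn ℝ ∞ (fun q : Coord × JetFib 2 =>
      christoffel γ μ ν (q.1, trunc 1 q.2)) (lorentzDomain 2) :=
    fun γ μ ν => contDiffOn_comp_trunc (contDiffOn_christoffel γ μ ν)
  unfold ricci
  exact ContDiffOn.sum fun γ _ => ((contDiffOn_totalDeriv _ (contDiffOn_christoffel _ _ _)).sub
    (contDiffOn_totalDeriv _ (contDiffOn_christoffel _ _ _))).add
    (ContDiffOn.sum fun δ _ => ((h _ _ _).mul (h _ _ _)).sub ((h _ _ _).mul (h _ _ _)))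

theorem contDiffOn_scalarCurvature : ContDiffOn ℝ ∞ scalarCurvature (lorentzDomain 2) :=
  ContDiffOn.sum fun α _ => ContDiffOn.sum fun β _ =>
    (contDiffOn_metric_inv α β).mul (contDiffOn_ricci α β)

theorem contDiffOn_kinetic (k : ℕ) :
    ContDiffOn ℝ ∞ (fun q : Coord × JetFib k => kinetic q.2) (lorentzDomain k) :=
  contDiffOn_const.mul (ContDiffOn.sum fun μ _ => ContDiffOn.sum fun ν _ =>
    ((contDiffOn_metric_inv μ ν).mul (contDiffOn_at _ _ _)).mul (contDiffOn_at _ _ _))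

theorem contDiffOn_dAlembertian : ContDiffOn ℝ ∞ dAlembertian (lorentzDomain 2) :=
  ContDiffOn.sum fun μ _ => ContDiffOn.sum fun ν _ => (contDiffOn_metric_inv μ ν).mul
    ((contDiffOn_at _ _ _).sub (ContDiffOn.sum fun γ _ =>
      (contDiffOn_comp_trunc (contDiffOn_christoffel γ μ ν)).mul (contDiffOn_at _ _ _)))

theorem contDiffOn_volume (k : ℕ) : ContDiffOn ℝ ∞
    (fun q : Coord × JetFib k => √|(metric q.2).det|) (lorentzDomain k) := by
  refine ContDiffOn.sqrt (fun q hq => ?_) fun q hq => abs_ne_zero.2 (metric_det_ne_zero hq)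
  exact (((contDiffOn_det (contDiffOn_metric_apply _)).contDiffAt
    ((isOpen_lorentzDomain k).mem_nhds hq)).abs (metric_det_ne_zero hq)).contDiffWithinAt

theorem contDiffOn_lagrangian (G : ℝ) {G₂ G₃ : ℝ × ℝ → ℝ} (hG₂ : ContDiff ℝ ∞ G₂)
    (hG₃ : ContDiff ℝ ∞ G₃) : ContDiffOn ℝ ∞ (lagrangian G G₂ G₃) (lorentzDomain 2) := by
  have h : ContDiffOn ℝ ∞ (fun q : Coord × JetFib 2 => (scalarField q.2, kinetic q.2))
      (lorentzDomain 2) := (contDiffOn_at _ _ _).prodMk (contDiffOn_kinetic 2)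
  exact (contDiffOn_const.mul (contDiffOn_volume 2)).mul
    (((contDiffOn_scalarCurvature.add (contDiffOn_kinetic 2)).add (hG₂.comp_contDiffOn h)).add
      ((hG₃.comp_contDiffOn h).mul contDiffOn_dAlembertian))

/-! ### Lagrangians which are affine in the second derivatives -/

/-- Differentiability being known, a directional derivative can be read off on one line. This gives
the derivatives of `L` and of the Christoffel symbols without expanding them. -/
theorem fderiv_apply_of_line {E : Type*} [NormedAddCommGroup E] [NormedSpace ℝ E] {f : E → ℝ}
    {p w : E} {b : ℝ} (hf : DifferentiableAt ℝ f p) (h : ∀ t : ℝ, f (p + t • w) = f p + t * b) :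
    fderiv ℝ f p w = b := by
  have h1 : HasDerivAt (fun t : ℝ => f (p + t • w)) (fderiv ℝ f p w) 0 :=
    hf.hasFDerivAt.hasLineDerivAt w
  have h2 : HasDerivAt (fun t : ℝ => f (p + t • w)) b 0 := by
    simp only [h]
    simpa using ((hasDerivAt_id (0 : ℝ)).mul_const b).const_add (f p)
  exact h1.unique h2

/-- Two restrictions to parallel lines which differ by a constant have the same derivative. -/
theorem fderiv_apply_congr_line {E : Type*} [NormedAddCommGroup E] [NormedSpace ℝ E] {f : E → ℝ}
    {p p' w : E} {b : ℝ} (hf : DifferentiableAt ℝ f p) (hf' : DifferentiableAt ℝ f p')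
    (h : ∀ t : ℝ, f (p + t • w) = f (p' + t • w) + b) : fderiv ℝ f p w = fderiv ℝ f p' w := by
  have h1 : HasDerivAt (fun t : ℝ => f (p + t • w)) (fderiv ℝ f p w) 0 :=
    hf.hasFDerivAt.hasLineDerivAt w
  have h2 : HasDerivAt (fun t : ℝ => f (p' + t • w)) (fderiv ℝ f p' w) 0 :=
    hf'.hasFDerivAt.hasLineDerivAt w
  simp only [h] at h1
  exact h1.unique (h2.add_const b)

theorem metric_add_of_trunc {k : ℕ} (v : JetFib k) {l : ℕ} {y : JetFib k} (hy : trunc l y = 0) :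
    metric (v + y) = metric v := by
  have h : ∀ c, y.at 0 c = 0 := fun c => by
    rw [← trunc_at y (sum_zero_le l), hy]
    exact at_of_le _ (sum_zero_le l) c
  ext α β
  simp [metric, at_add, h]

theorem metric_add_smul_unit {k : ℕ} (v : JetFib k) {I : Fin 4 → ℕ} (hI : I ≠ 0) (c : Comp)
    (t : ℝ) : metric (v + t • unit k I c) = metric v := by
  ext α β
  simp [metric, at_add, at_smul, unit_at _ _ (sum_zero_le k), hI.symm]

theorem trunc_add {k l : ℕ} (v w : JetFib k) : trunc l (v + w) = trunc l v + trunc l w :=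
  (truncL k l).map_add v w

theorem trunc_sub {k l : ℕ} (v w : JetFib k) : trunc l (v - w) = trunc l v - trunc l w :=
  (truncL k l).map_sub v w

theorem trunc_smul {k l : ℕ} (t : ℝ) (v : JetFib k) : trunc l (t • v) = t • trunc l v :=
  (truncL k l).map_smul t v

theorem trunc_unit {k l : ℕ} {I : Fin 4 → ℕ} (hI : l < ∑ μ, I μ) (hlk : l ≤ k) (c : Comp) :
    trunc l (unit k I c) = 0 := by
  funext q
  have : q.1.1 ≠ I := fun h => by
    have := q.1.2
    rw [h] at this
    omega
  exact (unit_at I q.1.1 (q.1.2.trans hlk) c q.2).trans (if_neg fun h => this h.1)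

/-- The Lagrangian does not depend on the point, it is affine in the second derivatives, and the
linear part `B` depends on the fields only. -/
structure IsAffineInSecond (L : Coord × JetFib 2 → ℝ) (B : JetFib 0 → JetFib 2 → ℝ) : Prop where
  add : ∀ x v y, IsLorentzian (metric v) → trunc 1 y = 0 → L (x, v + y) = L (0, v) + B (trunc 0 v) y
  smul : ∀ u (t : ℝ) y, B u (t • y) = t * B u y

namespace IsAffineInSecond

variable {L : Coord × JetFib 2 → ℝ} {B : JetFib 0 → JetFib 2 → ℝ}

theorem eq_zero_point (h : IsAffineInSecond L B) (x : Coord) {v : JetFib 2}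
    (hv : IsLorentzian (metric v)) : L (x, v) = L (0, v) := by
  have h1 := h.add x v 0 hv ((truncL 2 1).map_zero)
  -- Homogeneity with factor zero gives `B u 0 = 0`, so the zero increment compares only the base
  -- points.
  have h2 := h.smul (trunc 0 v) 0 0
  rw [zero_smul, zero_mul] at h2
  rwa [add_zero, h2, add_zero] at h1

theorem dL_second (h : IsAffineInSecond L B) (hL : ContDiffOn ℝ ∞ L (lorentzDomain 2))
    (x : Coord) {v : JetFib 2} (hv : IsLorentzian (metric v)) (μ ν : Fin 4) (c : Comp) :
    dL L (one μ + one ν) c (x, v) = B (trunc 0 v) (unit 2 (one μ + one ν) c) := by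
  refine fderiv_apply_of_line (contDiffOn_diffAt hL (isOpen_lorentzDomain 2) hv) fun t => ?_
  have e : (x, v) + t • ((0 : Coord), unit 2 (one μ + one ν) c) =
      (x, v + t • unit 2 (one μ + one ν) c) := by
    simp
  have h0 : trunc 1 (unit 2 (one μ + one ν) c) = 0 :=
    trunc_unit (by rw [degree_two]; norm_num) (by norm_num) c
  rw [e, h.add x v _ hv (by rw [trunc_smul, h0, smul_zero]), h.smul, h.eq_zero_point x hv]

/-- Truncating down and up again replaces the second derivatives by zero, which changes `L` by a
value of `B` at the underlying fields. Moving in the direction `y^c_μ` does not alter these fields,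
so the change is constant along the line and the derivative is the same. -/
theorem dL_first (h : IsAffineInSecond L B) (hL : ContDiffOn ℝ ∞ L (lorentzDomain 2))
    (x : Coord) {v : JetFib 2} (hv : IsLorentzian (metric v)) (μ : Fin 4) (c : Comp) :
    dL L (one μ) c (x, v) = dL L (one μ) c (0, trunc 2 (trunc 1 v)) := by
  have hv' : IsLorentzian (metric (trunc 2 (trunc 1 v) : JetFib 2)) := by
    rwa [metric_trunc, metric_trunc]
  refine fderiv_apply_congr_line (b := B (trunc 0 v) (v - trunc 2 (trunc 1 v)))
    (contDiffOn_diffAt hL (isOpen_lorentzDomain 2) hv)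
    (contDiffOn_diffAt hL (isOpen_lorentzDomain 2) hv') fun t => ?_
  have e : ∀ (x' : Coord) (v' : JetFib 2), (x', v') + t • ((0 : Coord), unit 2 (one μ) c) =
      (x', v' + t • unit 2 (one μ) c) := by
    intro x' v'
    simp
  have ht : ∀ w : JetFib 2, trunc 1 (trunc 2 (trunc 1 w) : JetFib 2) = trunc 1 w := fun w => by
    rw [trunc_trunc (by norm_num), trunc_self]
  have ht0 : ∀ w : JetFib 2, trunc 0 (trunc 2 (trunc 1 w) : JetFib 2) = trunc 0 w := fun w => by
    rw [trunc_trunc (by norm_num), trunc_trunc (by norm_num)]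
  have h0 : trunc 0 (unit 2 (one μ) c) = 0 :=
    trunc_unit (by rw [degree_one]; norm_num) (by norm_num) c
  rw [e, e]
  have e2 : v + t • unit 2 (one μ) c = (trunc 2 (trunc 1 v) + t • unit 2 (one μ) c) +
      (v - trunc 2 (trunc 1 v)) := by abel
  rw [e2, h.add x _ _ (by rwa [metric_add_smul_unit _ (one_ne_zero' μ)])
    (by rw [trunc_sub, ht, sub_self]), trunc_add, trunc_smul, h0, smul_zero, add_zero, ht0]

/-- The Legendre map of a Lagrangian which is affine in the second derivatives depends on first
jets only. -/
theorem legendre_eq (h : IsAffineInSecond L B) (hL : ContDiffOn ℝ ∞ L (lorentzDomain 2))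
    (x : Coord) {v : JetFib 3} (hv : IsLorentzian (metric v)) :
    legendre L (x, v) = legendre L (0, trunc 3 (trunc 1 v)) := by
  set v' : JetFib 3 := trunc 3 (trunc 1 v) with hv'_def
  have hm : ∀ l, IsLorentzian (metric (trunc l v)) := fun l => by rwa [metric_trunc]
  have hm' : ∀ l, IsLorentzian (metric (trunc l v')) := fun l => by
    rwa [metric_trunc, hv'_def, metric_trunc, metric_trunc]
  have ht : ∀ l, l ≤ 1 → trunc l v' = trunc l v := fun l hl => by
    rw [hv'_def, trunc_trunc (by omega), trunc_trunc hl]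
  have h2 : ∀ μ ν c, dL L (one μ + one ν) c (x, trunc 2 v) =
      dL L (one μ + one ν) c (0, trunc 2 v') := fun μ ν c => by
    rw [h.dL_second hL x (hm 2), h.dL_second hL 0 (hm' 2), trunc_trunc (by norm_num),
      trunc_trunc (by norm_num), ht 0 (by norm_num)]
  have h1 : ∀ μ c, dL L (one μ) c (x, trunc 2 v) = dL L (one μ) c (0, trunc 2 v') := fun μ c => by
    rw [h.dL_first hL x (hm 2), h.dL_first hL 0 (hm' 2), trunc_trunc (l := 2) (by norm_num) v,
      trunc_trunc (l := 2) (by norm_num) v', ht 1 le_rfl]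
  -- The function `∂L/∂y^c_{μκ}` depends on the fields only, so its total derivative contains no
  -- derivatives of order above one.
  have h3 : ∀ ν μ κ c, totalDeriv ν (dL L (one μ + one κ) c) (x, v) =
      totalDeriv ν (dL L (one μ + one κ) c) (0, v') := by
    intro ν μ κ c
    set f := dL L (one μ + one κ) c with hf
    have hO := isOpen_lorentzDomain 2
    have hfd : ContDiffOn ℝ ∞ f (lorentzDomain 2) := contDiffOn_dL hO hL _ _
    -- The linear projection which forgets the point and sets all derivatives to zero. `f` factors
    -- through it, and hence so does the differential of `f`.
    obtain ⟨ρ, hρ⟩ : ∃ ρ : Coord × JetFib 2 →L[ℝ] Coord × JetFib 2,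
        ∀ q : Coord × JetFib 2, ρ q = (0, trunc 2 (trunc 0 q.2)) :=
      ⟨(0 : Coord × JetFib 2 →L[ℝ] Coord).prod
        ((truncL 0 2).comp ((truncL 2 0).comp (ContinuousLinearMap.snd ℝ Coord (JetFib 2)))),
        fun _ => rfl⟩
    have hρO : ∀ q ∈ lorentzDomain 2, ρ q ∈ lorentzDomain 2 := fun q hq => by
      rw [hρ]
      change IsLorentzian (metric (trunc 2 (trunc 0 q.2) : JetFib 2))
      rwa [metric_trunc, metric_trunc]
    have hfρ : ∀ q ∈ lorentzDomain 2, f q = f (ρ q) := fun q hq => by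
      have hq' := hρO q hq
      rw [hρ] at hq' ⊢
      rw [hf, show q = (q.1, q.2) from rfl, h.dL_second hL q.1 hq, h.dL_second hL 0 hq',
        trunc_trunc (by norm_num), trunc_self]
    have hfd' : ∀ q ∈ lorentzDomain 2, ∀ w, fderiv ℝ f q w = fderiv ℝ f (ρ q) (ρ w) := by
      intro q hq w
      have c1 := (contDiffOn_diffAt hfd hO (hρO q hq)).hasFDerivAt.comp q ρ.hasFDerivAt
      have c2 := c1.congr_of_eventuallyEq (Filter.mem_of_superset (hO.mem_nhds hq) hfρ)
      rw [c2.fderiv]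
      rfl
    have m1 : ((x, truncL 3 2 v) : Coord × JetFib 2) ∈ lorentzDomain 2 := hm 2
    have m2 : ((0, truncL 3 2 v') : Coord × JetFib 2) ∈ lorentzDomain 2 := hm' 2
    rw [totalDeriv_eq, totalDeriv_eq]
    refine (hfd' _ m1 _).trans (Eq.trans ?_ (hfd' _ m2 _).symm)
    rw [hρ, hρ, hρ, hρ]
    have e1 : ∀ u : JetFib 3, trunc 0 (truncL 3 2 u) = trunc 0 u := fun u =>
      trunc_trunc (by norm_num) u
    -- The order-zero part of the shifted jet consists of first derivatives, on which `v` and `v'`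
    -- agree.
    have e2 : trunc 0 (shiftL 2 ν v) = trunc 0 (shiftL 2 ν v') := by
      funext q
      have hq : ∑ i, q.1.1 i = 0 := Nat.le_zero.1 q.1.2
      have hq1 : ∑ i, (q.1.1 + one ν) i ≤ 1 := by
        simp [Finset.sum_add_distrib, sum_one, hq]
      have e3 : ∀ u : JetFib 3, trunc 0 (shiftL 2 ν u) q = (trunc 1 u).at (q.1.1 + one ν) q.2 := by
        intro u
        rw [trunc_at u hq1]
        exact at_of_le _ (by omega) _
      rw [e3, e3, ht 1 le_rfl]
    simp only [e1, e2, ht 0 (by norm_num)]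
  funext ⟨q, c⟩
  rcases q with μ | m
  · simp only [legendre, h1, h3]
  · simp only [legendre, h2]

end IsAffineInSecond

/-! ### The cubic Horndeski Lagrangian is affine in the second derivatives -/

/-- The first derivatives in the Christoffel symbols. -/
def christoffelLin (A : Matrix (Fin 4) (Fin 4) ℝ) (γ μ ν : Fin 4) (u : JetFib 1) : ℝ :=
  1 / 2 * ∑ ρ, A⁻¹ γ ρ * (dmetric u ν ρ μ + dmetric u ρ μ ν - dmetric u μ ν ρ)

theorem christoffelLin_add (A : Matrix (Fin 4) (Fin 4) ℝ) (γ μ ν : Fin 4) (u w : JetFib 1) :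
    christoffelLin A γ μ ν (u + w) = christoffelLin A γ μ ν u + christoffelLin A γ μ ν w := by
  simp only [christoffelLin, dmetric, at_add]
  rw [← mul_add, ← Finset.sum_add_distrib]
  exact congrArg _ (Finset.sum_congr rfl fun ρ _ => by ring)

theorem christoffelLin_smul (A : Matrix (Fin 4) (Fin 4) ℝ) (γ μ ν : Fin 4) (t : ℝ) (u : JetFib 1) :
    christoffelLin A γ μ ν (t • u) = t * christoffelLin A γ μ ν u := by
  simp only [christoffelLin, dmetric, at_smul, Finset.mul_sum]
  exact Finset.sum_congr rfl fun ρ _ => by ring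

/-- With the metric held fixed, a Christoffel symbol is linear in the first derivatives. -/
theorem fderiv_christoffel_vertical (γ μ ν : Fin 4) (x : Coord) {u w : JetFib 1}
    (hu : IsLorentzian (metric u)) (hw : trunc 0 w = 0) :
    fderiv ℝ (christoffel γ μ ν) (x, u) (0, w) = christoffelLin (metric u) γ μ ν w := by
  refine fderiv_apply_of_line (contDiffOn_diffAt (contDiffOn_christoffel γ μ ν)
    (isOpen_lorentzDomain 1) hu) fun t => ?_
  have e : (x, u) + t • ((0 : Coord), w) = (x, u + t • w) := by simp
  have hm : metric (u + t • w) = metric u :=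
    metric_add_of_trunc (l := 0) u (by rw [trunc_smul, hw, smul_zero])
  have hc : ∀ u' : JetFib 1, christoffel γ μ ν (x, u') = christoffelLin (metric u') γ μ ν u' :=
    fun _ => rfl
  rw [e, hc, hc, hm, christoffelLin_add, christoffelLin_smul]

/-- A purely second-order increment `y` does not move the first jet at which the symbol is
differentiated. It enters through the direction only, where its shift is a vertical vector without a
component of order zero. -/
theorem totalDeriv_christoffel_add (γ μ ν τ : Fin 4) (x : Coord) {v y : JetFib 2}
    (hv : IsLorentzian (metric v)) (hy : trunc 1 y = 0) :
    totalDeriv τ (christoffel γ μ ν) (x, v + y) = totalDeriv τ (christoffel γ μ ν) (x, v) +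
      christoffelLin (metric v) γ μ ν (shiftL 1 τ y) := by
  have hs : trunc 0 (shiftL 1 τ y) = 0 := by
    funext q
    have hq : ∑ i, (q.1.1 + one τ) i ≤ 1 := by
      have := q.1.2
      simp only [Pi.add_apply, Finset.sum_add_distrib, sum_one]
      omega
    have h1 := trunc_at y hq q.2
    rw [hy] at h1
    refine (at_of_le _ (q.1.2.trans (by norm_num)) _).trans (h1.symm.trans ?_)
    exact at_of_le _ hq _
  have ht : truncL 2 1 (v + y) = truncL 2 1 v := by
    rw [map_add, truncL_apply 1 y, hy, add_zero]
  have hu : IsLorentzian (metric (truncL 2 1 v)) := by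
    rwa [truncL_apply, metric_trunc]
  have e : (dir τ, shiftL 1 τ (v + y)) = (dir τ, shiftL 1 τ v) + ((0 : Coord), shiftL 1 τ y) := by
    simp
  rw [totalDeriv_eq, totalDeriv_eq]
  simp only
  rw [ht, e, map_add, fderiv_christoffel_vertical γ μ ν x hu hs, truncL_apply, metric_trunc]

theorem christoffel_point (γ μ ν : Fin 4) (x x' : Coord) (u : JetFib 1) :
    christoffel γ μ ν (x, u) = christoffel γ μ ν (x', u) := rfl

theorem totalDeriv_christoffel_point (γ μ ν τ : Fin 4) (x : Coord) {v : JetFib 2}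
    (hv : IsLorentzian (metric v)) :
    totalDeriv τ (christoffel γ μ ν) (x, v) = totalDeriv τ (christoffel γ μ ν) (0, v) := by
  let ρ : Coord × JetFib 1 →L[ℝ] Coord × JetFib 1 :=
    (0 : Coord × JetFib 1 →L[ℝ] Coord).prod (ContinuousLinearMap.snd ℝ Coord (JetFib 1))
  have hu : IsLorentzian (metric (truncL 2 1 v)) := by
    rwa [truncL_apply, metric_trunc]
  have hd : DifferentiableAt ℝ (christoffel γ μ ν) (0, truncL 2 1 v) :=
    contDiffOn_diffAt (contDiffOn_christoffel γ μ ν) (isOpen_lorentzDomain 1) hu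
  have e : ∀ x', fderiv ℝ (christoffel γ μ ν) (x', truncL 2 1 v) =
      (fderiv ℝ (christoffel γ μ ν) (0, truncL 2 1 v)).comp ρ := fun x' =>
    HasFDerivAt.fderiv (HasFDerivAt.comp (f := ρ) (x', truncL 2 1 v) (g := christoffel γ μ ν)
      hd.hasFDerivAt ρ.hasFDerivAt)
  rw [totalDeriv_eq, totalDeriv_eq]
  simp only
  rw [e x, ← e 0]

/-- The second derivatives in the scalar curvature. -/
def curvatureLin (A : Matrix (Fin 4) (Fin 4) ℝ) (y : JetFib 2) : ℝ :=
  ∑ α, ∑ β, A⁻¹ α β * ∑ γ, (christoffelLin A γ α β (shiftL 1 γ y) -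
    christoffelLin A γ γ β (shiftL 1 α y))

/-- The second derivatives in the d'Alembertian. -/
def waveLin (A : Matrix (Fin 4) (Fin 4) ℝ) (y : JetFib 2) : ℝ :=
  ∑ μ, ∑ ν, A⁻¹ μ ν * y.at (one μ + one ν) (Sum.inr ())

/-- The second derivatives in the Lagrangian. -/
def lagrangianLin (G : ℝ) (G₃ : ℝ × ℝ → ℝ) (u : JetFib 0) (y : JetFib 2) : ℝ :=
  1 / (16 * Real.pi * G) * √|(metric u).det| *
    (curvatureLin (metric u) y + G₃ (scalarField u, 0) * waveLin (metric u) y)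

theorem ricci_add (α β : Fin 4) (x : Coord) {v y : JetFib 2}
    (hv : IsLorentzian (metric v)) (hy : trunc 1 y = 0) :
    ricci α β (x, v + y) = ricci α β (0, v) + ∑ γ, (christoffelLin (metric v) γ α β (shiftL 1 γ y) -
      christoffelLin (metric v) γ γ β (shiftL 1 α y)) := by
  have ht : trunc 1 (v + y) = trunc 1 v := by rw [trunc_add, hy, add_zero]
  simp only [ricci, totalDeriv_christoffel_add _ _ _ _ x hv hy, ht,
    christoffel_point _ _ _ x 0, totalDeriv_christoffel_point _ _ _ _ x hv]
  rw [← Finset.sum_add_distrib]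
  exact Finset.sum_congr rfl fun γ _ => by ring

theorem at_add_of_trunc {k l : ℕ} (v : JetFib k) {y : JetFib k} (hy : trunc l y = 0)
    {I : Fin 4 → ℕ} (hI : ∑ μ, I μ ≤ l) (c : Comp) : (v + y).at I c = v.at I c := by
  rw [at_add, ← trunc_at y hI, hy, at_of_le _ hI]
  simp

theorem eq_of_fderiv_snd_eq_zero {f : ℝ × ℝ → ℝ} (hf : ContDiff ℝ ∞ f)
    (h : ∀ p, fderiv ℝ f p (0, 1) = 0) (a b : ℝ) : f (a, b) = f (a, 0) := by
  have hd : ∀ t, HasDerivAt (fun t => f (a, t)) 0 t := by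
    intro t
    have h1 := ((hf.differentiable (by simp)) (a, t)).hasFDerivAt.comp_hasDerivAt t
      ((hasDerivAt_const t a).prodMk (hasDerivAt_id t))
    rw [h] at h1
    exact h1
  exact is_const_of_deriv_eq_zero (fun t => (hd t).differentiableAt) (fun t => (hd t).deriv) b 0

/-- Neither `φ`, `X` nor the volume factor contains second derivatives; the curvature and `□φ` are
affine in them with coefficients from the metric. The factor `G₃` in front of `□φ` would bring in
first derivatives through `X`. As it is independent of `X`, it may be evaluated at `X = 0`, which
gives the linear part `lagrangianLin` in terms of the fields alone. -/
theorem isAffineInSecond_lagrangian (G : ℝ) (G₂ : ℝ × ℝ → ℝ) {G₃ : ℝ × ℝ → ℝ}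
    (hG₃ : ContDiff ℝ ∞ G₃) (hX : ∀ p, fderiv ℝ G₃ p (0, 1) = 0) :
    IsAffineInSecond (lagrangian G G₂ G₃) (lagrangianLin G G₃) where
  add x v y hv hy := by
    have hm : metric (v + y) = metric v := metric_add_of_trunc v hy
    have ht : trunc 1 (v + y) = trunc 1 v := by rw [trunc_add, hy, add_zero]
    have h1 : ∀ μ c, (v + y).at (one μ) c = v.at (one μ) c := fun μ c =>
      at_add_of_trunc v hy (sum_one_le 0 μ) c
    have hk : kinetic (v + y) = kinetic v := by simp only [kinetic, hm, h1]
    have hf : scalarField (v + y) = scalarField v := at_add_of_trunc v hy (sum_zero_le 1) _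
    have hf0 : scalarField (trunc 0 v) = scalarField v := trunc_at v (sum_zero_le 0) _
    have hR : scalarCurvature (x, v + y) = scalarCurvature (0, v) + curvatureLin (metric v) y := by
      simp only [scalarCurvature, curvatureLin, hm, ricci_add _ _ x hv hy, mul_add,
        Finset.sum_add_distrib]
    have hB : dAlembertian (x, v + y) = dAlembertian (0, v) + waveLin (metric v) y := by
      simp only [dAlembertian, waveLin, hm, ht, h1, christoffel_point _ _ _ x 0]
      simp only [← Finset.sum_add_distrib, at_add]
      exact Finset.sum_congr rfl fun μ _ => Finset.sum_congr rfl fun ν _ => by ring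
    simp only [lagrangian, lagrangianLin, hm, hk, hf, hR, hB, hf0, metric_trunc,
      eq_of_fderiv_snd_eq_zero hG₃ hX _ (kinetic v)]
    ring
  smul u t y := by
    have hc : curvatureLin (metric u) (t • y) = t * curvatureLin (metric u) y := by
      simp only [curvatureLin, map_smul, christoffelLin_smul, Finset.mul_sum]
      exact Finset.sum_congr rfl fun _ _ => Finset.sum_congr rfl fun _ _ =>
        Finset.sum_congr rfl fun _ _ => by ring
    have hw : waveLin (metric u) (t • y) = t * waveLin (metric u) y := by
      simp only [waveLin, at_smul, Finset.mul_sum]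
      exact Finset.sum_congr rfl fun _ _ => Finset.sum_congr rfl fun _ _ => by ring
    simp only [lagrangianLin, hc, hw]
    ring

/-! ### Transformation laws of connections and curvature -/

section Laws

set_option synthInstance.maxHeartbeats 400000
set_option maxHeartbeats 1000000

variable {V F : Type*} [NormedAddCommGroup V] [NormedSpace ℝ V] [NormedAddCommGroup F]
  [NormedSpace ℝ F]

theorem hasFDerivAt_apply_apply {f : V → V →L[ℝ] V →L[ℝ] F}
    {f' : V →L[ℝ] V →L[ℝ] V →L[ℝ] F} {x : V} (hf : HasFDerivAt f f' x)
    (a b : V) : HasFDerivAt (fun x => f x a b)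
      (((ContinuousLinearMap.apply ℝ F b).comp (ContinuousLinearMap.apply ℝ (V →L[ℝ] F) a)).comp
        f') x := by
  have h := (hf.clm_apply (hasFDerivAt_const a x)).clm_apply (hasFDerivAt_const b x)
  refine h.congr_fderiv ?_
  ext w
  simp

theorem fderiv_apply_apply {f : V → V →L[ℝ] V →L[ℝ] F} {x : V}
    (hf : DifferentiableAt ℝ f x) (a b w : V) :
    fderiv ℝ (fun x => f x a b) x w = fderiv ℝ f x w a b := by
  rw [(hasFDerivAt_apply_apply hf.hasFDerivAt a b).fderiv]
  rfl

/-- The derivative of the pullback of a field of bilinear maps. -/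
theorem fderiv_pullback {f : V → V →L[ℝ] V →L[ℝ] F}
    {σ : V → V} {z : V} (hf : DifferentiableAt ℝ f (σ z))
    (hσ : DifferentiableAt ℝ σ z) (hσ' : DifferentiableAt ℝ (fderiv ℝ σ) z) (u v w : V) :
    fderiv ℝ (fun x => f (σ x) (fderiv ℝ σ x u) (fderiv ℝ σ x v)) z w =
      fderiv ℝ f (σ z) (fderiv ℝ σ z w) (fderiv ℝ σ z u) (fderiv ℝ σ z v) +
      f (σ z) (fderiv ℝ (fderiv ℝ σ) z w u) (fderiv ℝ σ z v) +
      f (σ z) (fderiv ℝ σ z u) (fderiv ℝ (fderiv ℝ σ) z w v) := by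
  have h1 := HasFDerivAt.comp z (f := σ) (g := f) hf.hasFDerivAt hσ.hasFDerivAt
  have h2 := fun a : V => hσ'.hasFDerivAt.clm_apply (hasFDerivAt_const a z)
  have h3 := (h1.clm_apply (h2 u)).clm_apply (h2 v)
  refine (congrArg (fun A : V →L[ℝ] F => A w) h3.fderiv).trans ?_
  simp
  abel

theorem differentiableAt_pullback {f : V → V →L[ℝ] V →L[ℝ] F}
    {σ : V → V} {z : V} (hf : DifferentiableAt ℝ f (σ z))
    (hσ : DifferentiableAt ℝ σ z) (hσ' : DifferentiableAt ℝ (fderiv ℝ σ) z) (u v : V) :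
    DifferentiableAt ℝ (fun x => f (σ x) (fderiv ℝ σ x u) (fderiv ℝ σ x v)) z :=
  ((hf.comp z hσ).clm_apply (hσ'.clm_apply (differentiableAt_const u))).clm_apply
    (hσ'.clm_apply (differentiableAt_const v))

/-- The bilinear form `g` and the connection `Γ` satisfy the formula which defines the Christoffel
symbols at a point where the derivative of the form is `D`. -/
def IsChristoffel (g : V →L[ℝ] V →L[ℝ] ℝ) (D : V →L[ℝ] V →L[ℝ] V →L[ℝ] ℝ)
    (Γ : V →L[ℝ] V →L[ℝ] V) : Prop :=
  ∀ u v w, g (Γ u v) w = 1 / 2 * (D u v w + D v w u - D w u v)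

/-- By nondegeneracy it suffices to test the difference of the two sides against vectors `dσ w`. In
the combination of derivatives of the pulled back metric, the second derivatives of `σ` cancel by
symmetry except for twice `g (D²σ(u, v), dσ w)`; the factor `1/2` turns this into the inhomogeneous
term. -/
theorem christoffel_law {g g' : V → V →L[ℝ] V →L[ℝ] ℝ}
    {Γ Γ' : V →L[ℝ] V →L[ℝ] V} {σ : V → V} {z : V}
    (hg : DifferentiableAt ℝ g (σ z)) (hg' : DifferentiableAt ℝ g' z)
    (hσ : DifferentiableAt ℝ σ z) (hσ' : DifferentiableAt ℝ (fderiv ℝ σ) z)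
    (hsymm : ∀ u v, fderiv ℝ (fderiv ℝ σ) z u v = fderiv ℝ (fderiv ℝ σ) z v u)
    (hgs : ∀ u v, g (σ z) u v = g (σ z) v u)
    (hnd : ∀ u, (∀ w, g (σ z) u (fderiv ℝ σ z w) = 0) → u = 0)
    (hpull : ∀ᶠ x in 𝓝 z, ∀ u v, g' x u v = g (σ x) (fderiv ℝ σ x u) (fderiv ℝ σ x v))
    (hΓ : IsChristoffel (g (σ z)) (fderiv ℝ g (σ z)) Γ)
    (hΓ' : IsChristoffel (g' z) (fderiv ℝ g' z) Γ') (u v : V) :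
    fderiv ℝ σ z (Γ' u v) =
      Γ (fderiv ℝ σ z u) (fderiv ℝ σ z v) + fderiv ℝ (fderiv ℝ σ) z u v := by
  have hD : ∀ u v w, fderiv ℝ g' z w u v =
      fderiv ℝ g (σ z) (fderiv ℝ σ z w) (fderiv ℝ σ z u) (fderiv ℝ σ z v) +
      g (σ z) (fderiv ℝ (fderiv ℝ σ) z w u) (fderiv ℝ σ z v) +
      g (σ z) (fderiv ℝ σ z u) (fderiv ℝ (fderiv ℝ σ) z w v) := by
    intro u v w
    rw [← fderiv_apply_apply hg', ← fderiv_pullback hg hσ hσ']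
    rw [Filter.EventuallyEq.fderiv_eq (hpull.mono fun x hx => hx u v)]
  rw [← sub_eq_zero]
  refine hnd _ fun w => ?_
  have h1 := hΓ' u v w
  rw [hpull.self_of_nhds] at h1
  have h2 := hΓ (fderiv ℝ σ z u) (fderiv ℝ σ z v) (fderiv ℝ σ z w)
  simp only [map_sub, map_add, _root_.sub_apply, _root_.add_apply, h1, h2, hD]
  rw [hsymm v u, hsymm w u, hsymm w v, hgs (fderiv ℝ σ z v), hgs (fderiv ℝ σ z w),
    hgs (fderiv ℝ σ z u)]
  ring

/-- The curvature `u ↦ R(u, v) w` of a connection `Γ` with derivative `D`. -/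
def curvature (Γ : V →L[ℝ] V →L[ℝ] V)
    (D : V →L[ℝ] V →L[ℝ] V →L[ℝ] V) (v w : V) : V →ₗ[ℝ] V where
  toFun u := D u v w - D v u w + Γ u (Γ v w) - Γ v (Γ u w)
  map_add' a b := by
    simp only [map_add, _root_.add_apply]
    abel
  map_smul' a b := by
    simp only [map_smul, _root_.smul_apply, RingHom.id_apply, smul_add, smul_sub]

/-- Differentiate the transformation law of the connection and antisymmetrize in the first two
arguments. The third derivatives of `σ` cancel by symmetry, and the terms with second derivatives
cancel against those produced by the quadratic part of the curvature. -/
theorem curvature_law {Γ Γ' : V → V →L[ℝ] V →L[ℝ] V} {σ : V → V}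
    {z : V} (hΓ : DifferentiableAt ℝ Γ (σ z)) (hΓ' : DifferentiableAt ℝ Γ' z)
    (hσ : DifferentiableAt ℝ σ z) (hσ' : DifferentiableAt ℝ (fderiv ℝ σ) z)
    (hσ'' : DifferentiableAt ℝ (fderiv ℝ (fderiv ℝ σ)) z)
    (hsymm : ∀ u v, fderiv ℝ (fderiv ℝ σ) z u v = fderiv ℝ (fderiv ℝ σ) z v u)
    (hsymm' : ∀ u v, fderiv ℝ (fderiv ℝ (fderiv ℝ σ)) z u v =
      fderiv ℝ (fderiv ℝ (fderiv ℝ σ)) z v u)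
    (hlaw : ∀ᶠ x in 𝓝 z, ∀ u v, fderiv ℝ σ x (Γ' x u v) =
      Γ (σ x) (fderiv ℝ σ x u) (fderiv ℝ σ x v) + fderiv ℝ (fderiv ℝ σ) x u v) (u v w : V) :
    fderiv ℝ σ z (curvature (Γ' z) (fderiv ℝ Γ' z) v w u) =
      curvature (Γ (σ z)) (fderiv ℝ Γ (σ z)) (fderiv ℝ σ z v) (fderiv ℝ σ z w)
        (fderiv ℝ σ z u) := by
  have hD : ∀ u v w, fderiv ℝ (fderiv ℝ σ) z u (Γ' z v w) +
      fderiv ℝ σ z (fderiv ℝ Γ' z u v w) =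
      fderiv ℝ Γ (σ z) (fderiv ℝ σ z u) (fderiv ℝ σ z v) (fderiv ℝ σ z w) +
      Γ (σ z) (fderiv ℝ (fderiv ℝ σ) z u v) (fderiv ℝ σ z w) +
      Γ (σ z) (fderiv ℝ σ z v) (fderiv ℝ (fderiv ℝ σ) z u w) +
      fderiv ℝ (fderiv ℝ (fderiv ℝ σ)) z u v w := by
    intro u v w
    have h0 := hasFDerivAt_apply_apply hΓ'.hasFDerivAt v w
    have h1 := HasFDerivAt.clm_apply (c := fderiv ℝ σ) (u := fun x => Γ' x v w) hσ'.hasFDerivAt h0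
    have h2 := Filter.EventuallyEq.fderiv_eq (𝕜 := ℝ) (hlaw.mono fun x hx => hx v w)
    rw [HasFDerivAt.fderiv h1, fderiv_fun_add (differentiableAt_pullback hΓ hσ hσ' v w)
      (hasFDerivAt_apply_apply hσ''.hasFDerivAt v w).differentiableAt] at h2
    have h3 := congrArg (fun A : V →L[ℝ] V => A u) h2
    simp only [_root_.add_apply, fderiv_pullback hΓ hσ hσ', fderiv_apply_apply hσ''] at h3
    rw [← h3]
    simp
    abel
  have hz := hlaw.self_of_nhds
  have e1 := fun u v w => eq_sub_of_add_eq' (hD u v w)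
  simp only [curvature, LinearMap.coe_mk, AddHom.coe_mk, map_sub, map_add, hz, e1]
  rw [hsymm v u, hsymm' v u]
  abel

/-- The chain rule applied twice produces the extra term `dφ (D²σ(u, v))`. The inhomogeneous term in
the law of the connection removes it. -/
theorem hessian_law {φ : V → ℝ} {σ : V → V} {z : V}
    {Γ Γ' : V →L[ℝ] V →L[ℝ] V}
    (hφ : ∀ᶠ x in 𝓝 z, DifferentiableAt ℝ φ (σ x))
    (hφ' : DifferentiableAt ℝ (fderiv ℝ φ) (σ z))
    (hσ : ∀ᶠ x in 𝓝 z, DifferentiableAt ℝ σ x) (hσ' : DifferentiableAt ℝ (fderiv ℝ σ) z)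
    (hlaw : ∀ u v, fderiv ℝ σ z (Γ' u v) =
      Γ (fderiv ℝ σ z u) (fderiv ℝ σ z v) + fderiv ℝ (fderiv ℝ σ) z u v) (u v : V) :
    fderiv ℝ (fderiv ℝ (fun x => φ (σ x))) z u v - fderiv ℝ (fun x => φ (σ x)) z (Γ' u v) =
      fderiv ℝ (fderiv ℝ φ) (σ z) (fderiv ℝ σ z u) (fderiv ℝ σ z v) -
        fderiv ℝ φ (σ z) (Γ (fderiv ℝ σ z u) (fderiv ℝ σ z v)) := by
  have h1 : ∀ᶠ x in 𝓝 z, fderiv ℝ (fun x => φ (σ x)) x = (fderiv ℝ φ (σ x)).comp (fderiv ℝ σ x) := by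
    filter_upwards [hφ, hσ] with x hx hx'
    exact (hx.hasFDerivAt.comp x hx'.hasFDerivAt).fderiv
  have h2 : HasFDerivAt (fun x => (fderiv ℝ φ (σ x)).comp (fderiv ℝ σ x)) _ z :=
    HasFDerivAt.clm_comp (hφ'.hasFDerivAt.comp z hσ.self_of_nhds.hasFDerivAt) hσ'.hasFDerivAt
  rw [Filter.EventuallyEq.fderiv_eq h1, h2.fderiv, h1.self_of_nhds]
  simp [hlaw]
  ring

end Laws

theorem trace_coord (A : Coord →ₗ[ℝ] Coord) : LinearMap.trace ℝ Coord A = ∑ γ, A (dir γ) γ := by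
  rw [LinearMap.trace_eq_matrix_trace ℝ (EuclideanSpace.basisFun (Fin 4) ℝ).toBasis A, Matrix.trace]
  simp [LinearMap.toMatrix_apply, dir]

/-- In finite dimension the right inverse `K` is two-sided, so the endomorphisms are conjugate and
have equal traces. This turns `curvature_law` into the covariance of the Ricci tensor. -/
theorem trace_eq_of_intertwine {A A' S K : Coord →ₗ[ℝ] Coord} (hK : S * K = 1)
    (h : S * A' = A * S) : ∑ γ, A' (dir γ) γ = ∑ γ, A (dir γ) γ := by
  have hK' : K * S = 1 := mul_eq_one_comm.1 hK
  rw [← trace_coord, ← trace_coord]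
  have e : A = S * A' * K := by rw [h, mul_assoc, hK, mul_one]
  rw [e, LinearMap.trace_mul_comm, ← mul_assoc, hK', one_mul]

/-- The contraction is the trace of `A⁻¹ Bᵀ`, in which the factors `T` cancel cyclically. -/
theorem contraction_congr {A B T : Matrix (Fin 4) (Fin 4) ℝ} (hT : IsUnit T.det) :
    ∑ α, ∑ β, (T * A * T.transpose)⁻¹ α β * (T * B * T.transpose) α β =
      ∑ α, ∑ β, A⁻¹ α β * B α β := by
  have key : ∀ X Y : Matrix (Fin 4) (Fin 4) ℝ,
      ∑ α, ∑ β, X α β * Y α β = (X * Y.transpose).trace := fun X Y => by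
    simp [Matrix.trace, Matrix.mul_apply]
  have h2 : T.transpose⁻¹ * T.transpose = 1 := Matrix.nonsing_inv_mul _ (by simpa using hT)
  rw [key, key, Matrix.mul_inv_rev, Matrix.mul_inv_rev, Matrix.transpose_mul, Matrix.transpose_mul,
    Matrix.transpose_transpose]
  rw [show T.transpose⁻¹ * (A⁻¹ * T⁻¹) * (T * (B.transpose * T.transpose)) =
    T.transpose⁻¹ * ((A⁻¹ * (T⁻¹ * T) * B.transpose) * T.transpose) by
      simp only [Matrix.mul_assoc]]
  rw [Matrix.trace_mul_comm, Matrix.mul_assoc, Matrix.mul_nonsing_inv _ (by simpa using hT),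
    Matrix.mul_one, Matrix.nonsing_inv_mul _ hT, Matrix.mul_one]

/-! ### The metric and the connection of a section as fields of bilinear maps -/

section Bilinear

set_option synthInstance.maxHeartbeats 400000
set_option maxHeartbeats 1000000

variable {F : Type*} [NormedAddCommGroup F] [NormedSpace ℝ F]

theorem differentiableAt_smulRight {V G : Type*} [NormedAddCommGroup V] [NormedSpace ℝ V]
    [NormedAddCommGroup G] [NormedSpace ℝ G] (A : V →L[ℝ] ℝ) {f : V → G} {z : V}
    (hf : DifferentiableAt ℝ f z) :
    DifferentiableAt ℝ (fun x => (A.smulRight (f x) : V →L[ℝ] G)) z :=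
  ((ContinuousLinearMap.smulRightL ℝ V G A).differentiableAt (x := f z)).comp z hf

/-- The bilinear map with prescribed values on the coordinate vectors. -/
def bilin (B : Fin 4 → Fin 4 → F) : Coord →L[ℝ] Coord →L[ℝ] F :=
  ∑ α, ∑ β, (EuclideanSpace.proj α : Coord →L[ℝ] ℝ).smulRight
    ((EuclideanSpace.proj β : Coord →L[ℝ] ℝ).smulRight (B α β))

theorem bilin_apply (B : Fin 4 → Fin 4 → F) (u v : Coord) :
    bilin B u v = ∑ α, ∑ β, u α • v β • B α β := by
  simp [bilin]

theorem bilin_dir (B : Fin 4 → Fin 4 → F) (α β : Fin 4) : bilin B (dir α) (dir β) = B α β := by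
  simp [bilin_apply, dir, ite_smul]

theorem differentiableAt_bilin {B : Coord → Fin 4 → Fin 4 → F} {z : Coord}
    (hB : ∀ α β, DifferentiableAt ℝ (fun x => B x α β) z) :
    DifferentiableAt ℝ (fun x => bilin (B x)) z :=
  DifferentiableAt.fun_sum (𝕜 := ℝ) (E := Coord) (F := Coord →L[ℝ] Coord →L[ℝ] F)
    (A := fun α x => ∑ β, (EuclideanSpace.proj α : Coord →L[ℝ] ℝ).smulRight
      ((EuclideanSpace.proj β : Coord →L[ℝ] ℝ).smulRight (B x α β))) fun α _ =>
    DifferentiableAt.fun_sum (𝕜 := ℝ) (E := Coord) (F := Coord →L[ℝ] Coord →L[ℝ] F)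
      (A := fun β x => (EuclideanSpace.proj α : Coord →L[ℝ] ℝ).smulRight
        ((EuclideanSpace.proj β : Coord →L[ℝ] ℝ).smulRight (B x α β))) fun β _ => by
      have h := differentiableAt_smulRight (EuclideanSpace.proj β : Coord →L[ℝ] ℝ) (hB α β)
      exact differentiableAt_smulRight (EuclideanSpace.proj α : Coord →L[ℝ] ℝ) h

theorem fderiv_bilin_dir {B : Coord → Fin 4 → Fin 4 → F} {z : Coord}
    (hB : ∀ α β, DifferentiableAt ℝ (fun x => B x α β) z) (w : Coord) (α β : Fin 4) :
    fderiv ℝ (fun x => bilin (B x)) z w (dir α) (dir β) = fderiv ℝ (fun x => B x α β) z w := by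
  rw [← fderiv_apply_apply (differentiableAt_bilin hB)]
  simp only [bilin_dir]

theorem coord_induction {p : Coord → Prop} (hd : ∀ α, p (dir α)) (h0 : p 0)
    (ha : ∀ u v, p u → p v → p (u + v)) (hs : ∀ (t : ℝ) u, p u → p (t • u)) (u : Coord) : p u := by
  rw [eq_sum_dir u]
  exact Finset.sum_induction _ p ha h0 fun α _ => hs _ _ (hd α)

theorem IsChristoffel.of_dir {g : Coord →L[ℝ] Coord →L[ℝ] ℝ}
    {D : Coord →L[ℝ] Coord →L[ℝ] Coord →L[ℝ] ℝ} {Γ : Coord →L[ℝ] Coord →L[ℝ] Coord}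
    (h : ∀ α β γ, g (Γ (dir α) (dir β)) (dir γ) =
      1 / 2 * (D (dir α) (dir β) (dir γ) + D (dir β) (dir γ) (dir α) -
        D (dir γ) (dir α) (dir β))) : IsChristoffel g D Γ := by
  intro u v w
  induction u using coord_induction with
  | h0 => simp
  | ha a b h1 h2 =>
    simp only [map_add, _root_.add_apply]
    linear_combination h1 + h2
  | hs t a h1 =>
    simp only [map_smul, _root_.smul_apply, smul_eq_mul]
    linear_combination t * h1
  | hd α =>
    induction v using coord_induction with
    | h0 => simp
    | ha a b h1 h2 =>
      simp only [map_add, _root_.add_apply]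
      linear_combination h1 + h2
    | hs t a h1 =>
      simp only [map_smul, _root_.smul_apply, smul_eq_mul]
      linear_combination t * h1
    | hd β =>
      induction w using coord_induction with
      | h0 => simp
      | ha a b h1 h2 =>
        simp only [map_add, _root_.add_apply]
        linear_combination h1 + h2
      | hs t a h1 =>
        simp only [map_smul, _root_.smul_apply, smul_eq_mul]
        linear_combination t * h1
      | hd γ => exact h α β γ

theorem map_dir (σ : Coord → Coord) (z : Coord) (α : Fin 4) :
    fderiv ℝ σ z (dir α) = ∑ κ, jacobian σ z α κ • dir κ := eq_sum_dir _

theorem bilinear_jacobian (f : Coord →ₗ[ℝ] Coord →ₗ[ℝ] ℝ) (σ : Coord → Coord) (z : Coord)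
    (α β : Fin 4) : f (fderiv ℝ σ z (dir α)) (fderiv ℝ σ z (dir β)) =
      (jacobian σ z * Matrix.of (fun κ l => f (dir κ) (dir l)) * (jacobian σ z).transpose) α β := by
  rw [map_dir, map_dir]
  simp only [map_sum, map_smul, LinearMap.sum_apply, LinearMap.smul_apply, smul_eq_mul,
    Matrix.mul_apply, Matrix.transpose_apply, Matrix.of_apply, Finset.sum_mul, Finset.mul_sum]
  exact Finset.sum_congr rfl fun _ _ => Finset.sum_congr rfl fun _ _ => by ring

end Bilinear

/-- The metric of a section, as a field of bilinear forms. -/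
def metricForm (s : Coord → Comp → ℝ) (z : Coord) : Coord →L[ℝ] Coord →L[ℝ] ℝ :=
  bilin fun α β => metric (jet 0 s z) α β

/-- The Levi-Civita connection of a section, as a field of bilinear maps. -/
def connection (s : Coord → Comp → ℝ) (z : Coord) : Coord →L[ℝ] Coord →L[ℝ] Coord :=
  bilin fun α β => ∑ γ, christoffel γ α β (z, jet 1 s z) • dir γ

theorem metric_jet_apply (k : ℕ) (s : Coord → Comp → ℝ) (z : Coord) (α β : Fin 4) :
    metric (jet k s z) α β = s z (Sum.inl (sym α β)) := jet_at_zero k s z _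

theorem dmetric_jet (s : Coord → Comp → ℝ) (z : Coord) (α β μ : Fin 4) :
    dmetric (jet 1 s z) α β μ = pd μ (fun w => s w (Sum.inl (sym α β))) z := jet_at_one 0 s z μ _

theorem connection_dir (s : Coord → Comp → ℝ) (z : Coord) (α β γ : Fin 4) :
    connection s z (dir α) (dir β) γ = christoffel γ α β (z, jet 1 s z) := by
  rw [connection, bilin_dir]
  simp [dir, Pi.single_apply]

section Section

set_option synthInstance.maxHeartbeats 400000
set_option maxHeartbeats 1000000

variable {W : Set Coord} {s : Coord → Comp → ℝ}

theorem differentiableAt_metricForm (hW : IsOpen W)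
    (hs : ∀ c, ContDiffOn ℝ ∞ (fun w => s w c) W) {z : Coord} (hz : z ∈ W) :
    DifferentiableAt ℝ (metricForm s) z := by
  refine differentiableAt_bilin fun α β => ?_
  simp only [metric_jet_apply]
  exact contDiffOn_diffAt (hs _) hW hz

theorem fderiv_metricForm (hW : IsOpen W) (hs : ∀ c, ContDiffOn ℝ ∞ (fun w => s w c) W)
    {z : Coord} (hz : z ∈ W) (α β μ : Fin 4) :
    fderiv ℝ (metricForm s) z (dir μ) (dir α) (dir β) = dmetric (jet 1 s z) α β μ := by
  rw [dmetric_jet]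
  refine (fderiv_bilin_dir (fun α β => ?_) (dir μ) α β).trans ?_
  · simp only [metric_jet_apply]
    exact contDiffOn_diffAt (hs _) hW hz
  · simp only [metric_jet_apply, pd]

theorem contDiffOn_christoffel_jet (hW : IsOpen W)
    (hs : ∀ c, ContDiffOn ℝ ∞ (fun w => s w c) W)
    (hL : ∀ x ∈ W, IsLorentzian (metric (jet 0 s x))) (γ α β : Fin 4) :
    ContDiffOn ℝ ∞ (fun w => christoffel γ α β (w, jet 1 s w)) W :=
  contDiffOn_comp_jet hW hs (fun w hw => show IsLorentzian (metric (jet 1 s w)) from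
    metric_jet 0 1 s w ▸ hL w hw) (contDiffOn_christoffel γ α β)

theorem differentiableAt_connection_aux (hW : IsOpen W)
    (hs : ∀ c, ContDiffOn ℝ ∞ (fun w => s w c) W)
    (hL : ∀ x ∈ W, IsLorentzian (metric (jet 0 s x))) {z : Coord} (hz : z ∈ W) (α β : Fin 4) :
    DifferentiableAt ℝ (fun w => ∑ γ, christoffel γ α β (w, jet 1 s w) • dir γ) z :=
  DifferentiableAt.fun_sum fun γ _ =>
    (contDiffOn_diffAt (contDiffOn_christoffel_jet hW hs hL γ α β) hW hz).smul_const _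

theorem differentiableAt_connection (hW : IsOpen W)
    (hs : ∀ c, ContDiffOn ℝ ∞ (fun w => s w c) W)
    (hL : ∀ x ∈ W, IsLorentzian (metric (jet 0 s x))) {z : Coord} (hz : z ∈ W) :
    DifferentiableAt ℝ (connection s) z :=
  differentiableAt_bilin (differentiableAt_connection_aux hW hs hL hz)

theorem fderiv_connection (hW : IsOpen W) (hs : ∀ c, ContDiffOn ℝ ∞ (fun w => s w c) W)
    (hL : ∀ x ∈ W, IsLorentzian (metric (jet 0 s x))) {z : Coord} (hz : z ∈ W)
    (γ α β μ : Fin 4) : fderiv ℝ (connection s) z (dir μ) (dir α) (dir β) γ =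
      totalDeriv μ (christoffel γ α β) (z, jet 2 s z) := by
  have hd := fun γ => contDiffOn_diffAt (contDiffOn_christoffel_jet hW hs hL γ α β) hW hz
  have h1 : fderiv ℝ (connection s) z (dir μ) (dir α) (dir β) =
      fderiv ℝ (fun w => ∑ γ, christoffel γ α β (w, jet 1 s w) • dir γ) z (dir μ) :=
    fderiv_bilin_dir (differentiableAt_connection_aux hW hs hL hz) (dir μ) α β
  have hz' : (z, jet 1 s z) ∈ lorentzDomain 1 :=
    show IsLorentzian (metric (jet 1 s z)) from metric_jet 0 1 s z ▸ hL z hz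
  rw [h1, totalDeriv_jet hW hs hz
    (contDiffOn_diffAt (contDiffOn_christoffel γ α β) (isOpen_lorentzDomain 1) hz'),
    fderiv_fun_sum fun γ _ => (hd γ).smul_const _]
  simp only [fderiv_smul_const (hd _)]
  simp [dir, Pi.single_apply, pd]

/-- Lowering the upper index cancels the inverse metric in the definition of the Christoffel
symbols. The defining formula, which makes sense without coordinates, is what `christoffel_law`
needs. -/
theorem isChristoffel_connection (hW : IsOpen W) (hs : ∀ c, ContDiffOn ℝ ∞ (fun w => s w c) W)
    {z : Coord} (hz : z ∈ W) (hL : IsLorentzian (metric (jet 0 s z))) :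
    IsChristoffel (metricForm s z) (fderiv ℝ (metricForm s) z) (connection s z) := by
  refine IsChristoffel.of_dir fun α β l => ?_
  rw [fderiv_metricForm hW hs hz, fderiv_metricForm hW hs hz, fderiv_metricForm hW hs hz]
  have e : metricForm s z (connection s z (dir α) (dir β)) (dir l) =
      ∑ ρ, christoffel ρ α β (z, jet 1 s z) * metric (jet 1 s z) ρ l := by
    rw [metricForm, bilin_apply]
    simp only [connection_dir, metric_jet 0 1]
    simp [dir]
  have hi : (metric (jet 1 s z)) * (metric (jet 1 s z))⁻¹ = 1 :=
    Matrix.mul_nonsing_inv _ (metric_det_ne_zero (metric_jet 0 1 s z ▸ hL)).isUnit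
  have hi' : ∀ κ, ∑ ρ, (metric (jet 1 s z))⁻¹ ρ κ * metric (jet 1 s z) ρ l =
      if l = κ then 1 else 0 := by
    intro κ
    have h := congrFun (congrFun hi l) κ
    rw [Matrix.mul_apply, Matrix.one_apply] at h
    rw [← h]
    refine Finset.sum_congr rfl fun ρ _ => ?_
    rw [mul_comm, ← congrFun (congrFun (metric_transpose (jet 1 s z)) l) ρ, Matrix.transpose_apply]
  rw [e]
  have e2 : ∑ ρ, christoffel ρ α β (z, jet 1 s z) * metric (jet 1 s z) ρ l =
      1 / 2 * ∑ κ, (∑ ρ, (metric (jet 1 s z))⁻¹ ρ κ * metric (jet 1 s z) ρ l) *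
        (dmetric (jet 1 s z) β κ α + dmetric (jet 1 s z) κ α β - dmetric (jet 1 s z) α β κ) := by
    simp only [christoffel, Finset.mul_sum, Finset.sum_mul]
    rw [Finset.sum_comm]
    exact Finset.sum_congr rfl fun _ _ => Finset.sum_congr rfl fun _ _ => by ring
  rw [e2]
  simp [hi']

end Section

/-! ### Invariance of the Lagrangian density -/

/-- The scalars `R`, `X` and `□φ` all contract a bilinear form with the inverse metric, up to a
constant. Their invariance reduces to the pullback law of that form. -/
theorem contraction_apply (f : Coord →ₗ[ℝ] Coord →ₗ[ℝ] ℝ) {f' : Coord →ₗ[ℝ] Coord →ₗ[ℝ] ℝ}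
    {σ : Coord → Coord} {z : Coord} (hT : IsUnit (jacobian σ z).det)
    (hf : ∀ α β, f' (dir α) (dir β) = f (fderiv ℝ σ z (dir α)) (fderiv ℝ σ z (dir β)))
    (A : Matrix (Fin 4) (Fin 4) ℝ) :
    ∑ α, ∑ β, (jacobian σ z * A * (jacobian σ z).transpose)⁻¹ α β * f' (dir α) (dir β) =
      ∑ α, ∑ β, A⁻¹ α β * f (dir α) (dir β) := by
  simp only [hf, bilinear_jacobian]
  exact contraction_congr hT

theorem dir_apply (α β : Fin 4) : dir α β = if β = α then 1 else 0 := by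
  simp [dir]

theorem two_le_infty : (2 : ℕ∞ω) ≤ ∞ := ENat.LEInfty.out

/-! ### The Ricci tensor, the Hessian and the kinetic term of a section as bilinear forms. -/

section Forms

set_option synthInstance.maxHeartbeats 400000
set_option maxHeartbeats 1000000

/-- The Ricci form of a connection with a given derivative. -/
def ricciForm (Γ : Coord →L[ℝ] Coord →L[ℝ] Coord)
    (D : Coord →L[ℝ] Coord →L[ℝ] Coord →L[ℝ] Coord) : Coord →ₗ[ℝ] Coord →ₗ[ℝ] ℝ :=
  LinearMap.mk₂ ℝ (fun v w => ∑ γ, curvature Γ D v w (dir γ) γ)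
    (fun a b w => by
      rw [← Finset.sum_add_distrib]
      refine Finset.sum_congr rfl fun γ _ => ?_
      simp only [curvature, LinearMap.coe_mk, AddHom.coe_mk, map_add, _root_.add_apply,
        PiLp.add_apply, PiLp.sub_apply]
      ring)
    (fun t a w => by
      rw [Finset.smul_sum]
      refine Finset.sum_congr rfl fun γ _ => ?_
      simp only [curvature, LinearMap.coe_mk, AddHom.coe_mk, map_smul, _root_.smul_apply,
        PiLp.add_apply, PiLp.sub_apply, PiLp.smul_apply, smul_eq_mul]
      ring)
    (fun v a b => by
      rw [← Finset.sum_add_distrib]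
      refine Finset.sum_congr rfl fun γ _ => ?_
      simp only [curvature, LinearMap.coe_mk, AddHom.coe_mk, map_add, PiLp.add_apply,
        PiLp.sub_apply]
      ring)
    (fun t v a => by
      rw [Finset.smul_sum]
      refine Finset.sum_congr rfl fun γ _ => ?_
      simp only [curvature, LinearMap.coe_mk, AddHom.coe_mk, map_smul, PiLp.add_apply,
        PiLp.sub_apply, PiLp.smul_apply, smul_eq_mul]
      ring)

/-- The Hessian `D(u, v) - d(Γ(u, v))` of a function with first and second derivatives `d`, `D`. -/
def hessianForm (Γ : Coord →L[ℝ] Coord →L[ℝ] Coord) (d : Coord →L[ℝ] ℝ)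
    (D : Coord →L[ℝ] Coord →L[ℝ] ℝ) : Coord →ₗ[ℝ] Coord →ₗ[ℝ] ℝ :=
  LinearMap.mk₂ ℝ (fun u v => D u v - d (Γ u v))
    (fun a b w => by simp only [map_add, _root_.add_apply]; ring)
    (fun t a w => by simp only [map_smul, _root_.smul_apply, smul_eq_mul]; ring)
    (fun v a b => by simp only [map_add]; ring)
    (fun t v a => by simp only [map_smul, smul_eq_mul]; ring)

theorem connection_dir_left (s : Coord → Comp → ℝ) (z : Coord) (μ γ : Fin 4) (y : Coord) :
    connection s z (dir μ) y γ = ∑ δ, y δ * christoffel γ μ δ (z, jet 1 s z) := by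
  conv_lhs => rw [eq_sum_dir y]
  simp only [map_sum, map_smul, WithLp.ofLp_sum, WithLp.ofLp_smul, Finset.sum_apply, Pi.smul_apply,
    smul_eq_mul, connection_dir]

variable {W : Set Coord} {s : Coord → Comp → ℝ}

theorem ricci_jet (hW : IsOpen W) (hs : ∀ c, ContDiffOn ℝ ∞ (fun w => s w c) W)
    (hL : ∀ x ∈ W, IsLorentzian (metric (jet 0 s x))) {z : Coord} (hz : z ∈ W) (α β : Fin 4) :
    ricci α β (z, jet 2 s z) =
      ricciForm (connection s z) (fderiv ℝ (connection s) z) (dir α) (dir β) := by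
  simp only [ricciForm, LinearMap.mk₂_apply, curvature, LinearMap.coe_mk, AddHom.coe_mk,
    PiLp.add_apply, PiLp.sub_apply, fderiv_connection hW hs hL hz, connection_dir_left,
    ricci, trunc_jet one_le_two, dir_apply, ite_mul, one_mul, zero_mul, Finset.sum_ite_eq',
    Finset.mem_univ, if_true]
  simp only [Finset.sum_add_distrib, Finset.sum_sub_distrib]
  -- The quadratic terms agree once the two summation indices exchange their roles.
  rw [Finset.sum_comm (f := fun γ δ => christoffel γ α β (z, jet 1 s z) * _),
    Finset.sum_comm (f := fun γ δ => christoffel γ δ β (z, jet 1 s z) * _)]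
  ring

theorem dAlembertian_jet (hW : IsOpen W) (hs : ∀ c, ContDiffOn ℝ ∞ (fun w => s w c) W)
    {z : Coord} (hz : z ∈ W) :
    dAlembertian (z, jet 2 s z) = ∑ μ, ∑ ν, (metric (jet 0 s z))⁻¹ μ ν *
      hessianForm (connection s z) (fderiv ℝ (fun w => s w (Sum.inr ())) z)
        (fderiv ℝ (fderiv ℝ (fun w => s w (Sum.inr ()))) z) (dir μ) (dir ν) := by
  have hd : DifferentiableAt ℝ (fderiv ℝ (fun w => s w (Sum.inr ()))) z :=
    contDiffOn_diffAt ((hs (Sum.inr ())).fderiv_of_isOpen hW (m := ∞) (by simp)) hW hz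
  have h1 : ∀ μ ν, fderiv ℝ (fderiv ℝ (fun w => s w (Sum.inr ()))) z (dir μ) (dir ν) =
      (jet 2 s z).at (one μ + one ν) (Sum.inr ()) := by
    intro μ ν
    rw [jet_at_two 0 hW hs hz, pd_comm hW (hs _) ν μ hz]
    change _ = fderiv ℝ (fun w => fderiv ℝ (fun w => s w (Sum.inr ())) w (dir ν)) z (dir μ)
    rw [fderiv_clm_apply hd (differentiableAt_const _)]
    simp
  have h2 : ∀ y : Coord, fderiv ℝ (fun w => s w (Sum.inr ())) z y =
      ∑ γ, y γ * (jet 2 s z).at (one γ) (Sum.inr ()) := by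
    intro y
    conv_lhs => rw [eq_sum_dir y]
    simp only [map_sum, map_smul, smul_eq_mul, jet_at_one, pd]
  simp only [dAlembertian, hessianForm, LinearMap.mk₂_apply, h1, h2, connection_dir,
    trunc_jet one_le_two, metric_jet 2 0]

theorem kinetic_jet (k : ℕ) (s : Coord → Comp → ℝ) (z : Coord) :
    kinetic (jet (k + 1) s z) = -(1 / 2) * ∑ μ, ∑ ν, (metric (jet 0 s z))⁻¹ μ ν *
      (LinearMap.mul ℝ ℝ).compl₁₂ (fderiv ℝ (fun w => s w (Sum.inr ())) z : Coord →ₗ[ℝ] ℝ)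
        (fderiv ℝ (fun w => s w (Sum.inr ())) z : Coord →ₗ[ℝ] ℝ) (dir μ) (dir ν) := by
  simp only [kinetic, metric_jet (k + 1) 0, jet_at_one, pd, LinearMap.compl₁₂_apply,
    LinearMap.mul_apply', ContinuousLinearMap.coe_coe, mul_assoc]

end Forms

/-! ### The metric, the connection and the Ricci tensor under a coordinate change. -/

section Pull

set_option synthInstance.maxHeartbeats 400000
set_option maxHeartbeats 1000000

variable {U W : Set Coord} {σ : Coord → Coord} {s : Coord → Comp → ℝ}

theorem metricForm_pull (σ : Coord → Coord) (s : Coord → Comp → ℝ) (z u v : Coord) :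
    metricForm (pull σ s) z u v =
      metricForm s (σ z) (fderiv ℝ σ z u) (fderiv ℝ σ z v) := by
  induction u using coord_induction with
  | h0 => simp
  | ha a b h1 h2 => simp only [map_add, _root_.add_apply, h1, h2]
  | hs t a h1 => simp only [map_smul, _root_.smul_apply, h1]
  | hd α =>
    induction v using coord_induction with
    | h0 => simp
    | ha a b h1 h2 => simp only [map_add, h1, h2]
    | hs t a h1 => simp only [map_smul, h1]
    | hd β =>
      rw [metricForm, bilin_dir, metric_jet_apply, pull_sym, metricForm, bilin_apply]
      simp only [metric_jet_apply, smul_eq_mul, mul_assoc]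

theorem metric_pull (k : ℕ) (σ : Coord → Coord) (s : Coord → Comp → ℝ) (z : Coord) :
    metric (jet k (pull σ s) z) =
      jacobian σ z * metric (jet 0 s (σ z)) * (jacobian σ z).transpose := by
  ext α β
  rw [metric_jet_apply, pull_sym]
  simp only [metric_jet_apply, jacobian, Matrix.mul_apply, Matrix.of_apply, Matrix.transpose_apply,
    Finset.sum_mul]
  rw [Finset.sum_comm]
  exact Finset.sum_congr rfl fun _ _ => Finset.sum_congr rfl fun _ _ => by ring

theorem jacobian_det (σ : Coord → Coord) (z : Coord) :
    (jacobian σ z).det = (fderiv ℝ σ z).det := by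
  rw [← jac_det, ← Matrix.det_transpose]
  rfl

theorem isLorentzian_pull {z : Coord} (hd : (fderiv ℝ σ z).det ≠ 0)
    (hL : IsLorentzian (metric (jet 0 s (σ z)))) :
    IsLorentzian (metric (jet 0 (pull σ s) z)) :=
  isLorentzian_congr ((Matrix.isUnit_iff_isUnit_det _).2 (by
    rw [jacobian_det]
    exact hd.isUnit)) (metric_pull 0 σ s z) hL

theorem exists_rightInverse {z : Coord} (hd : (fderiv ℝ σ z).det ≠ 0) :
    ∃ K : Coord →ₗ[ℝ] Coord, (fderiv ℝ σ z : Coord →ₗ[ℝ] Coord) * K = 1 :=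
  ((LinearMap.isUnit_iff_isUnit_det _).2 hd.isUnit).exists_right_inv

theorem connection_pull (hU : IsOpen U) (hW : IsOpen W) (hσ : ContDiffOn ℝ ∞ σ U)
    (hm : MapsTo σ U W) (hs : ∀ c, ContDiffOn ℝ ∞ (fun w => s w c) W)
    (hL : ∀ x ∈ W, IsLorentzian (metric (jet 0 s x))) {z : Coord} (hz : z ∈ U)
    (hd : (fderiv ℝ σ z).det ≠ 0) (u v : Coord) :
    fderiv ℝ σ z (connection (pull σ s) z u v) =
      connection s (σ z) (fderiv ℝ σ z u) (fderiv ℝ σ z v) + fderiv ℝ (fderiv ℝ σ) z u v := by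
  have hs' := pull_contDiffOn hU hσ hm hs
  have hσ' := hσ.fderiv_of_isOpen hU (m := ∞) (by simp)
  have hgs : ∀ u v, metricForm s (σ z) u v = metricForm s (σ z) v u := by
    intro u v
    simp only [metricForm, bilin_apply]
    rw [Finset.sum_comm]
    refine Finset.sum_congr rfl fun α _ => Finset.sum_congr rfl fun β _ => ?_
    simp only [metric_jet_apply, sym_comm β α, smul_eq_mul]
    ring
  refine christoffel_law (differentiableAt_metricForm hW hs (hm hz))
    (differentiableAt_metricForm hU hs' hz) (contDiffOn_diffAt hσ hU hz)
    (contDiffOn_diffAt hσ' hU hz)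
    ((hσ.contDiffAt (hU.mem_nhds hz)).isSymmSndFDerivAt (by simpa using two_le_infty)) hgs (fun u hu => ?_)
    (Filter.Eventually.of_forall fun x u v => metricForm_pull σ s x u v)
    (isChristoffel_connection hW hs (hm hz) (hL _ (hm hz)))
    (isChristoffel_connection hU hs' hz (isLorentzian_pull hd (hL _ (hm hz)))) u v
  -- Nondegeneracy: `K` exhibits every coordinate vector as a value of `dσ`, so `u` is orthogonal to
  -- all of them and lies in the kernel of an invertible metric.
  obtain ⟨K, hK⟩ := exists_rightInverse hd
  have hu' : Matrix.vecMul (u : Fin 4 → ℝ) (metric (jet 0 s (σ z))) = 0 := by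
    ext β
    have h := hu (K (dir β))
    rw [show fderiv ℝ σ z (K (dir β)) = dir β from LinearMap.congr_fun hK (dir β), metricForm,
      bilin_apply] at h
    simpa [Matrix.vecMul, dotProduct, dir] using h
  have h0 := Matrix.eq_zero_of_vecMul_eq_zero (metric_det_ne_zero (hL _ (hm hz))) hu'
  ext i
  exact congrFun h0 i

/-- The Ricci form is the trace of `u ↦ R(u, v) w`. By `curvature_law` the differential of `σ`
intertwines these endomorphisms for the two connections. -/
theorem ricci_pull (hU : IsOpen U) (hW : IsOpen W) (hσ : ContDiffOn ℝ ∞ σ U)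
    (hm : MapsTo σ U W) (hs : ∀ c, ContDiffOn ℝ ∞ (fun w => s w c) W)
    (hL : ∀ x ∈ W, IsLorentzian (metric (jet 0 s x))) (hd : ∀ z ∈ U, (fderiv ℝ σ z).det ≠ 0)
    {z : Coord} (hz : z ∈ U) (α β : Fin 4) :
    ricciForm (connection (pull σ s) z) (fderiv ℝ (connection (pull σ s)) z) (dir α) (dir β) =
      ricciForm (connection s (σ z)) (fderiv ℝ (connection s) (σ z)) (fderiv ℝ σ z (dir α))
        (fderiv ℝ σ z (dir β)) := by
  have hs' := pull_contDiffOn hU hσ hm hs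
  have hσ' := hσ.fderiv_of_isOpen hU (m := ∞) (by simp)
  have hσ'' := hσ'.fderiv_of_isOpen hU (m := ∞) (by simp)
  obtain ⟨K, hK⟩ := exists_rightInverse (hd z hz)
  refine trace_eq_of_intertwine hK (LinearMap.ext fun u => ?_)
  exact curvature_law (differentiableAt_connection hW hs hL (hm hz))
    (differentiableAt_connection hU hs' (fun x hx => isLorentzian_pull (hd x hx) (hL _ (hm hx))) hz)
    (contDiffOn_diffAt hσ hU hz) (contDiffOn_diffAt hσ' hU hz) (contDiffOn_diffAt hσ'' hU hz)
    ((hσ.contDiffAt (hU.mem_nhds hz)).isSymmSndFDerivAt (by simpa using two_le_infty))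
    (fun u v => (hσ'.contDiffAt (hU.mem_nhds hz)).isSymmSndFDerivAt (by simpa using two_le_infty) u v)
    (Filter.eventually_of_mem (hU.mem_nhds hz) fun x hx =>
      connection_pull hU hW hσ hm hs hL hx (hd x hx)) u (dir α) (dir β)

end Pull

/-! ### Invariance of the scalars and of the Lagrangian density. -/

section Invariance

variable {U W : Set Coord} {σ : Coord → Coord} {s : Coord → Comp → ℝ}

theorem scalarCurvature_pull (hU : IsOpen U) (hW : IsOpen W) (hσ : ContDiffOn ℝ ∞ σ U)
    (hm : MapsTo σ U W) (hs : ∀ c, ContDiffOn ℝ ∞ (fun w => s w c) W)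
    (hL : ∀ x ∈ W, IsLorentzian (metric (jet 0 s x))) (hd : ∀ z ∈ U, (fderiv ℝ σ z).det ≠ 0)
    {z : Coord} (hz : z ∈ U) :
    scalarCurvature (z, jet 2 (pull σ s) z) = scalarCurvature (σ z, jet 2 s (σ z)) := by
  have hs' := pull_contDiffOn hU hσ hm hs
  have hT : IsUnit (jacobian σ z).det := by
    rw [jacobian_det]
    exact (hd z hz).isUnit
  simp only [scalarCurvature, ricci_jet hW hs hL (hm hz), metric_jet 2 0,
    ricci_jet hU hs' (fun x hx => isLorentzian_pull (hd x hx) (hL _ (hm hx))) hz, metric_pull]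
  exact contraction_apply _ hT (ricci_pull hU hW hσ hm hs hL hd hz) _

theorem fderiv_scalar_pull (hU : IsOpen U) (hW : IsOpen W) (hσ : ContDiffOn ℝ ∞ σ U)
    (hm : MapsTo σ U W) (hs : ∀ c, ContDiffOn ℝ ∞ (fun w => s w c) W) {z : Coord} (hz : z ∈ U)
    (u : Coord) : fderiv ℝ (fun w => pull σ s w (Sum.inr ())) z u =
      fderiv ℝ (fun w => s w (Sum.inr ())) (σ z) (fderiv ℝ σ z u) := by
  have h := (contDiffOn_diffAt (hs (Sum.inr ())) hW (hm hz)).hasFDerivAt.comp z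
    (contDiffOn_diffAt hσ hU hz).hasFDerivAt
  exact congrArg (fun A : Coord →L[ℝ] ℝ => A u) h.fderiv

theorem kinetic_pull (hU : IsOpen U) (hW : IsOpen W) (hσ : ContDiffOn ℝ ∞ σ U)
    (hm : MapsTo σ U W) (hs : ∀ c, ContDiffOn ℝ ∞ (fun w => s w c) W) {z : Coord} (hz : z ∈ U)
    (hd : (fderiv ℝ σ z).det ≠ 0) (k : ℕ) :
    kinetic (jet (k + 1) (pull σ s) z) = kinetic (jet (k + 1) s (σ z)) := by
  have hT : IsUnit (jacobian σ z).det := by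
    rw [jacobian_det]
    exact hd.isUnit
  rw [kinetic_jet, kinetic_jet, metric_pull]
  congr 1
  refine contraction_apply _ hT (fun α β => ?_) _
  simp only [LinearMap.compl₁₂_apply, LinearMap.mul_apply', ContinuousLinearMap.coe_coe,
    fderiv_scalar_pull hU hW hσ hm hs hz]

theorem dAlembertian_pull (hU : IsOpen U) (hW : IsOpen W) (hσ : ContDiffOn ℝ ∞ σ U)
    (hm : MapsTo σ U W) (hs : ∀ c, ContDiffOn ℝ ∞ (fun w => s w c) W)
    (hL : ∀ x ∈ W, IsLorentzian (metric (jet 0 s x))) {z : Coord} (hz : z ∈ U)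
    (hd : (fderiv ℝ σ z).det ≠ 0) :
    dAlembertian (z, jet 2 (pull σ s) z) = dAlembertian (σ z, jet 2 s (σ z)) := by
  have hs' := pull_contDiffOn hU hσ hm hs
  have hT : IsUnit (jacobian σ z).det := by
    rw [jacobian_det]
    exact hd.isUnit
  have hσ' := hσ.fderiv_of_isOpen hU (m := ∞) (by simp)
  rw [dAlembertian_jet hU hs' hz, dAlembertian_jet hW hs (hm hz), metric_pull]
  refine contraction_apply _ hT (fun α β => ?_) _
  exact hessian_law (φ := fun w => s w (Sum.inr ())) (σ := σ)
    (Filter.eventually_of_mem (hU.mem_nhds hz) fun x hx =>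
      contDiffOn_diffAt (hs (Sum.inr ())) hW (hm hx))
    (contDiffOn_diffAt ((hs (Sum.inr ())).fderiv_of_isOpen hW (m := ∞) (by simp)) hW (hm hz))
    (Filter.eventually_of_mem (hU.mem_nhds hz) fun x hx => contDiffOn_diffAt hσ hU hx)
    (contDiffOn_diffAt hσ' hU hz) (connection_pull hU hW hσ hm hs hL hz hd) (dir α) (dir β)

/-- The determinant of the metric acquires the square of the Jacobian determinant. Its root is the
Jacobian determinant itself because the latter is positive. -/
theorem volume_pull (k : ℕ) (σ : Coord → Coord) (s : Coord → Comp → ℝ) {z : Coord}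
    (hd : 0 < (fderiv ℝ σ z).det) : √|(metric (jet k (pull σ s) z)).det| =
      (fderiv ℝ σ z).det * √|(metric (jet k s (σ z))).det| := by
  rw [metric_pull, Matrix.det_mul, Matrix.det_mul, Matrix.det_transpose, jacobian_det,
    metric_jet k 0, mul_right_comm, abs_mul, Real.sqrt_mul (abs_nonneg _), abs_mul_self,
    Real.sqrt_mul_self hd.le]

/-- The claim concerns single jets, but tensor calculus needs sections. Each jet is represented by
its polynomial section, restricted to the open set where the metric is Lorentzian, and the pullback
laws apply there. -/
theorem isInvariantUnder_lagrangian (G : ℝ) (G₂ G₃ : ℝ × ℝ → ℝ) (hU : IsOpen U)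
    (hσ : ContDiffOn ℝ ∞ σ U) (hd : ∀ z ∈ U, 0 < (fderiv ℝ σ z).det) :
    IsInvariantUnder (lagrangian G G₂ G₃) σ U := by
  intro z hz v hv
  have hjs : ∀ k ≤ 2, jet k (poly (σ z) v) (σ z) = trunc k v := fun k hk => by
    rw [← trunc_jet hk, jet_poly]
  rw [jetChange_apply hU hσ 2 hz]
  have hW : IsOpen {x | IsLorentzian (metric (jet 0 (poly (σ z) v) x))} :=
    isOpen_isLorentzian.preimage ((metric_continuous 0).comp (continuousOn_univ.1
      (jet_contDiffOn isOpen_univ (poly_contDiffOn _ _ univ) 0).continuousOn))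
  have hU' := hσ.continuousOn.isOpen_inter_preimage hU hW
  have hs : ∀ c, ContDiffOn ℝ ∞ (fun w => poly (σ z) v w c)
      {x | IsLorentzian (metric (jet 0 (poly (σ z) v) x))} := poly_contDiffOn _ _ _
  have hz' : z ∈ U ∩ σ ⁻¹' {x | IsLorentzian (metric (jet 0 (poly (σ z) v) x))} := ⟨hz, by
    rw [mem_preimage, mem_ofPred_eq, hjs 0 (by simp), metric_trunc]
    exact hv⟩
  have hσ' := hσ.mono (t := U ∩ σ ⁻¹' {x | IsLorentzian (metric (jet 0 (poly (σ z) v) x))})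
    inter_subset_left
  have hd' := fun x (hx : x ∈ U ∩ σ ⁻¹' {x | IsLorentzian (metric (jet 0 (poly (σ z) v) x))}) =>
    (hd x hx.1).ne'
  have hm : MapsTo σ (U ∩ σ ⁻¹' {x | IsLorentzian (metric (jet 0 (poly (σ z) v) x))})
    {x | IsLorentzian (metric (jet 0 (poly (σ z) v) x))} := fun x hx => hx.2
  have hφ : scalarField (jet 2 (pull σ (poly (σ z) v)) z) =
      scalarField (jet 2 (poly (σ z) v) (σ z)) := by
    rw [scalarField, scalarField, jet_at_zero, jet_at_zero]
    rfl
  have hv' : lagrangian G G₂ G₃ (σ z, v) = lagrangian G G₂ G₃ (σ z, jet 2 (poly (σ z) v) (σ z)) := by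
    rw [jet_poly]
  rw [hv']
  simp only [lagrangian, volume_pull 2 σ _ (hd z hz), hφ,
    kinetic_pull hU' hW hσ' hm hs hz' (hd z hz).ne' 1,
    dAlembertian_pull hU' hW hσ' hm hs (fun x hx => hx) hz' (hd z hz).ne',
    scalarCurvature_pull hU' hW hσ' hm hs (fun x hx => hx) hd' hz']
  ring

end Invariance

/-! ### The momenta as functions of the first jet -/

section Momentum

variable {U W : Set Coord} {σ τ : Coord → Coord}

theorem trunc_jetChange (hU : IsOpen U) (hσ : ContDiffOn ℝ ∞ σ U) {k l : ℕ} (h : l ≤ k)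
    {z : Coord} (hz : z ∈ U) (v : JetFib k) :
    trunc l (jetChange k σ z v) = jetChange l σ z (trunc l v) := by
  rw [jetChange_apply hU hσ k hz, trunc_jet h]
  conv_rhs => rw [← jet_poly (σ z) v, trunc_jet h]
  exact (jetChange_jet hU isOpen_univ hσ (mapsTo_univ _ _) (poly_contDiffOn _ _ _) l hz).symm

theorem trunc_trunc_self {k l : ℕ} (h : l ≤ k) (u : JetFib l) : trunc l (trunc k u) = u := by
  rw [trunc_trunc h, trunc_self]

/-- The momenta of the jets in whose coordinates the derivatives of order two and three vanish. -/
def momentum (L : Coord × JetFib 2 → ℝ) (u : JetFib 1) : MomFib := legendre L (0, trunc 3 u)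

variable {L : Coord × JetFib 2 → ℝ} {B : JetFib 0 → JetFib 2 → ℝ}

theorem contDiffOn_legendre (hL : ContDiffOn ℝ ∞ L (lorentzDomain 2)) :
    ContDiffOn ℝ ∞ (legendre L) (lorentzDomain 3) := by
  have hd := contDiffOn_dL (isOpen_lorentzDomain 2) hL
  rw [contDiffOn_pi]
  rintro ⟨μ | m, c⟩
  · exact (contDiffOn_comp_trunc (hd _ c)).sub
      (ContDiffOn.sum fun ν _ => contDiffOn_const.mul (contDiffOn_totalDeriv ν (hd _ c)))
  · exact contDiffOn_comp_trunc (hd _ c)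

theorem contDiffOn_momentum (hL : ContDiffOn ℝ ∞ L (lorentzDomain 2)) :
    ContDiffOn ℝ ∞ (momentum L) {u | IsLorentzian (metric u)} := by
  have h : ContDiff ℝ ∞ fun u : JetFib 1 => ((0 : Coord), truncL 1 3 u) :=
    contDiff_const.prodMk (truncL 1 3).contDiff
  refine (contDiffOn_legendre hL).comp h.contDiffOn fun u hu => ?_
  change IsLorentzian (metric (trunc 3 u))
  rw [metric_trunc]
  exact hu

/-- Extending `u` by zero is not compatible with changes of coordinates: the transformed three-jet
may have nonzero higher derivatives. They are irrelevant by `legendre_eq`, so the covariance for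
three-jets descends to first jets. -/
theorem momentum_jetChange (hA : IsAffineInSecond L B)
    (hL : ContDiffOn ℝ ∞ L (lorentzDomain 2)) (hU : IsOpen U) (hW : IsOpen W)
    (hσ : ContDiffOn ℝ ∞ σ U) (hτ : ContDiffOn ℝ ∞ τ W) (hm : MapsTo σ U W)
    (hm' : MapsTo τ W U) (hi : EqOn (fun w => τ (σ w)) id U) (hi' : EqOn (fun x => σ (τ x)) id W)
    (hinv : IsInvariantUnder L σ U) {z : Coord} (hz : z ∈ U) {u : JetFib 1}
    (hu : IsLorentzian (metric u)) :
    momentum L (jetChange 1 σ z u) = momChange σ τ z (momentum L u) := by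
  have hu' : IsLorentzian (metric (trunc 3 u)) := by rwa [metric_trunc]
  have h := legendre_covariant hL hU hW hσ hτ hm hm' hi hi' hinv hz hu'
  rw [hA.legendre_eq hL z (isLorentzian_jetChange hU hW hσ hτ hm hi 3 hz hu'),
    hA.legendre_eq hL (σ z) hu', trunc_jetChange hU hσ (by norm_num) hz,
    trunc_trunc_self (by norm_num)] at h
  exact h

end Momentum

/-! ### The global maps between jets and multimomenta, and the charts of these spaces. -/

section Maps

variable (M : Type*) [TopologicalSpace M] [ChartedSpace Coord M] [IsManifold (𝓡 4) ∞ M]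

/-- The map `E` from first jets to momenta commutes with the changes of coordinates. -/
def IsCovariant (E : JetFib 1 → MomFib) : Prop :=
  ∀ (e e' : atlas Coord M) (x : M), x ∈ e.1.source → x ∈ e'.1.source → ∀ u : JetFib 1,
    IsLorentzian (metric u) →
      E ((jetCore M 1).coordChange e e' x u) = (momCore M).coordChange e e' x (E u)

variable {M} in
theorem isCovariant_momentum {L : Coord × JetFib 2 → ℝ} {B : JetFib 0 → JetFib 2 → ℝ}
    (hA : IsAffineInSecond L B) (hL : ContDiffOn ℝ ∞ L (lorentzDomain 2))
    (hinv : ∀ e e' : atlas Coord M, IsInvariantUnder L (trans M e e') (overlap M e e' e')) :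
    IsCovariant M (momentum L) := by
  intro e e' x hx hx' u hu
  have hi : ∀ e e' : atlas Coord M, EqOn (fun w => trans M e' e (trans M e e' w)) id
      (overlap M e e' e') := fun e e' w hw => by
    rw [trans_trans e e' e ⟨hw.1, hw.2.1, e.1.map_target hw.1⟩]
    exact trans_self e hw.1
  have hm : ∀ e e' : atlas Coord M, MapsTo (trans M e e') (overlap M e e' e') (overlap M e' e e) :=
    fun e e' w hw => mem_overlap hw.2.1 (e.1.map_target hw.1) (e.1.map_target hw.1)
  exact momentum_jetChange hA hL (isOpen_overlap e' e e) (isOpen_overlap e e' e')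
    (trans_contDiffOn e' e e) (trans_contDiffOn e e' e') (hm e' e) (hm e e') (hi e' e) (hi e e')
    (hinv e' e) (mem_overlap hx' hx hx) hu

/-- The projection `π^k_1` onto the first jets. -/
def jetProj (k : ℕ) (j : jetSpace M k) : jetSpace M 1 :=
  ⟨⟨j.1.1, trunc 1 (show JetFib k from j.1.2)⟩, by
    change IsLorentzian (metric (trunc 1 (show JetFib k from j.1.2)))
    rw [metric_trunc]
    exact j.2⟩

/-- The section of the multimomentum bundle over the first jets given by `E`. -/
def momSection (E : JetFib 1 → MomFib) (j : jetSpace M 1) : momSpace M :=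
  ⟨⟨j.1.1, (j.1.2, E (show JetFib 1 from j.1.2))⟩, j.2⟩

/-- The projection of the multimomentum bundle onto the first jets. -/
def momBase (q : momSpace M) : jetSpace M 1 := ⟨momProj M q.1, q.2⟩

/-- Both the higher derivatives and the coordinates of the base point drop out of the momenta, so
one function of the fibre coordinates of the first jet serves over all of `M`. -/
theorem legendreMap_eq {L : Coord × JetFib 2 → ℝ} {B : JetFib 0 → JetFib 2 → ℝ}
    (hA : IsAffineInSecond L B) (hL : ContDiffOn ℝ ∞ L (lorentzDomain 2)) :
    legendreMap M L = momSection M (momentum L) ∘ jetProj M 3 := by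
  funext j
  have h := hA.legendre_eq hL (chartAt Coord j.1.1 j.1.1) (v := (show JetFib 3 from j.1.2)) j.2
  refine Subtype.ext ?_
  change (⟨j.1.1, (_, legendre L (chartAt Coord j.1.1 j.1.1, _))⟩ : MomTotal M) = _
  rw [h]
  rfl

theorem jetProj_surjective {k : ℕ} (hk : 1 ≤ k) : Function.Surjective (jetProj M k) := by
  intro j
  refine ⟨⟨⟨j.1.1, trunc k (show JetFib 1 from j.1.2)⟩, ?_⟩, ?_⟩
  · change IsLorentzian (metric (trunc k (show JetFib 1 from j.1.2)))
    rw [metric_trunc]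
    exact j.2
  · refine Subtype.ext ?_
    change (⟨j.1.1, trunc 1 (trunc k (show JetFib 1 from j.1.2))⟩ :
      TotalSpace (JetFib 1) (jetCore M 1).Fiber) = j.1
    rw [trunc_trunc_self hk]

/-- The chart of the base at `x`. -/
def index (x : M) : atlas Coord M := ⟨chartAt Coord x, chart_mem_atlas Coord x⟩

/-- The fibre component of `q` is stored in the preferred chart of its own base point; the chart at
`p` therefore applies a change of coordinates. Smoothness of fibrewise maps thus requires
covariance. -/
theorem jetSpace_chartAt_apply (k : ℕ) (p q : jetSpace M k) :
    chartAt (ModelProd Coord (JetFib k)) p q = (chartAt Coord p.1.1 q.1.1,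
      (jetCore M k).coordChange (index M q.1.1) (index M p.1.1) q.1.1 q.1.2) := rfl

theorem jetSpace_mem_chartAt_source (k : ℕ) (p q : jetSpace M k) :
    q ∈ (chartAt (ModelProd Coord (JetFib k)) p).source ↔
      q.1.1 ∈ (chartAt Coord p.1.1).source := by
  rw [TopologicalSpace.Opens.chartAt_eq, OpenPartialHomeomorph.subtypeRestr_source,
    FiberBundle.chartedSpace_chartAt]
  simp only [mem_preimage, mfld_simps]
  exact ⟨fun h => h.1, fun h => ⟨h, h⟩⟩

theorem momSpace_chartAt_apply (p q : momSpace M) :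
    chartAt (ModelProd Coord (JetFib 1 × MomFib)) p q = (chartAt Coord p.1.1 q.1.1,
      ((jetCore M 1).coordChange (index M q.1.1) (index M p.1.1) q.1.1 q.1.2.1,
        (momCore M).coordChange (index M q.1.1) (index M p.1.1) q.1.1 q.1.2.2)) := rfl

theorem momSpace_mem_chartAt_source (p q : momSpace M) :
    q ∈ (chartAt (ModelProd Coord (JetFib 1 × MomFib)) p).source ↔
      q.1.1 ∈ (chartAt Coord p.1.1).source := by
  rw [TopologicalSpace.Opens.chartAt_eq, OpenPartialHomeomorph.subtypeRestr_source,
    FiberBundle.chartedSpace_chartAt]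
  simp only [mem_preimage, mfld_simps]
  exact ⟨fun h => h.1.1, fun h => ⟨⟨h, h⟩, h⟩⟩

end Maps

/-! ### Charts, immersions and submersions -/

section Charts

variable {E H : Type*} [NormedAddCommGroup E] [NormedSpace ℝ E] [TopologicalSpace H]
  {I : ModelWithCorners ℝ E H} {N : Type*} [TopologicalSpace N] [ChartedSpace H N]
  {E' : Type*} {H' : Type*} [NormedAddCommGroup E'] [NormedSpace ℝ E'] [TopologicalSpace H']
  {I' : ModelWithCorners ℝ E' H'} {N' : Type*} [TopologicalSpace N'] [ChartedSpace H' N']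
  {F : Type*} [NormedAddCommGroup F] [NormedSpace ℝ F]

theorem isImmersion_of_charts {f : N → N'} (A : (E × F) ≃L[ℝ] E')
    (h : ∀ x, ∃ φ ∈ IsManifold.maximalAtlas I ∞ N, ∃ ψ ∈ IsManifold.maximalAtlas I' ∞ N',
      x ∈ φ.source ∧ ∀ y ∈ φ.source, f y ∈ ψ.source ∧ I' (ψ (f y)) = A (I (φ y), 0)) :
    IsImmersion I I' ∞ f := by
  refine IsImmersionOfComplement.isImmersion (F := F) fun x => ?_
  obtain ⟨φ, hφ, ψ, hψ, hx, hφψ⟩ := h x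
  refine IsImmersionAtOfComplement.mk_of_charts A φ ψ hx (hφψ x hx).1 hφ hψ
    (fun y hy => (hφψ y hy).1) fun z hz => ?_
  have hs := (φ.extend I).map_target hz
  rw [φ.extend_source] at hs
  have h2 := (hφψ _ hs).2
  have h3 : I (φ ((φ.extend I).symm z)) = z := (φ.extend I).right_inv hz
  rw [h3] at h2
  exact h2

theorem isSubmersion_of_charts {f : N → N'} (A : E ≃L[ℝ] E' × F)
    (h : ∀ x, ∃ φ ∈ IsManifold.maximalAtlas I ∞ N, ∃ ψ ∈ IsManifold.maximalAtlas I' ∞ N',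
      x ∈ φ.source ∧ ∀ y ∈ φ.source, f y ∈ ψ.source ∧ I' (ψ (f y)) = (A (I (φ y))).1) :
    IsSubmersion I I' ∞ f := by
  refine IsSubmersionOfComplement.isSubmersion (F := F) fun x => ?_
  obtain ⟨φ, hφ, ψ, hψ, hx, hφψ⟩ := h x
  refine IsSubmersionAtOfComplement.mk_of_charts A φ ψ hx (hφψ x hx).1 hφ hψ
    (fun y hy => (hφψ y hy).1) fun z hz => ?_
  have hs := (φ.extend I).map_target hz
  rw [φ.extend_source] at hs
  have h2 := (hφψ _ hs).2
  have h3 : I (φ ((φ.extend I).symm z)) = z := (φ.extend I).right_inv hz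
  rw [h3] at h2
  exact h2

/-- Used to adapt charts to a submanifold: with a shear for the image of the Legendre map and with a
translation for its fibres. -/
theorem trans_mem_maximalAtlas {ψ : OpenPartialHomeomorph N H}
    (hψ : ψ ∈ IsManifold.maximalAtlas I ∞ N) {s : OpenPartialHomeomorph H H}
    (hs : ContDiffOn ℝ ∞ (I ∘ s ∘ I.symm) (I.symm ⁻¹' s.source ∩ range I))
    (hs' : ContDiffOn ℝ ∞ (I ∘ s.symm ∘ I.symm) (I.symm ⁻¹' s.target ∩ range I)) :
    ψ ≫ₕ s ∈ IsManifold.maximalAtlas I ∞ N := by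
  have hG : s ∈ contDiffGroupoid ∞ I := by
    rw [contDiffGroupoid, mem_groupoid_of_pregroupoid]
    exact ⟨hs, hs'⟩
  intro e he
  have h := hψ e he
  rw [OpenPartialHomeomorph.trans_symm_eq_symm_trans_symm, OpenPartialHomeomorph.trans_assoc,
    ← OpenPartialHomeomorph.trans_assoc e.symm]
  exact ⟨(contDiffGroupoid ∞ I).trans ((contDiffGroupoid ∞ I).symm hG) h.1,
    (contDiffGroupoid ∞ I).trans h.2 hG⟩

end Charts

/-! ### Transport of charts along a homeomorphism -/

section Transport

variable {E H : Type*} [NormedAddCommGroup E] [NormedSpace ℝ E] [TopologicalSpace H]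
  (I : ModelWithCorners ℝ E H) [I.Boundaryless]
  {E' : Type*} [NormedAddCommGroup E'] [NormedSpace ℝ E'] (A : E ≃L[ℝ] E')
  {N R : Type*} [TopologicalSpace N] [TopologicalSpace R] (h : N ≃ₜ R)

/-- The chart of `R` which corresponds to a chart of `N`. -/
def transportChart (c : OpenPartialHomeomorph N H) : OpenPartialHomeomorph R E' :=
  h.symm.toOpenPartialHomeomorph ≫ₕ c ≫ₕ
    (I.toHomeomorph.trans A.toHomeomorph).toOpenPartialHomeomorph

theorem transportChart_apply (c : OpenPartialHomeomorph N H) (q : R) :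
    transportChart I A h c q = A (I (c (h.symm q))) := rfl

theorem mem_transportChart_source (c : OpenPartialHomeomorph N H) (q : R) :
    q ∈ (transportChart I A h c).source ↔ h.symm q ∈ c.source := by
  simp [transportChart]

variable [ChartedSpace H N]

/-- The charts of `R` which correspond to the charts of `N`. -/
@[reducible]
def transportCharts : ChartedSpace E' R where
  atlas := transportChart I A h '' atlas H N
  chartAt q := transportChart I A h (chartAt H (h.symm q))
  mem_chart_source _ := (mem_transportChart_source I A h _ _).2 (mem_chart_source H _)
  chart_mem_atlas _ := ⟨_, chart_mem_atlas H _, rfl⟩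

variable [IsManifold I ∞ N]

/-- The transition maps are the old ones, read in the model vector space and conjugated by the
linear equivalence `A`. -/
theorem isManifold_transport :
    letI := transportCharts I A h
    IsManifold 𝓘(ℝ, E') ∞ R := by
  let := transportCharts I A h
  refine isManifold_of_contDiffOn _ _ _ ?_
  rintro _ _ ⟨c, hc, rfl⟩ ⟨c', hc', rfl⟩
  have h1 := I.contDiffOn_extendCoordChange (n := ∞) (IsManifold.subset_maximalAtlas hc)
    (IsManifold.subset_maximalAtlas hc')
  refine (A.contDiff.comp_contDiffOn (h1.comp A.symm.contDiff.contDiffOn (fun y hy => ?_))).congr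
    fun y hy => ?_
  · have hr : ∃ z, I z = A.symm y := I.toHomeomorph.surjective _
    simpa [transportChart, hr] using hy
  · simp [transportChart]

theorem contMDiff_transport :
    letI := transportCharts I A h
    ContMDiff I 𝓘(ℝ, E') ∞ h := by
  let := transportCharts I A h
  have := isManifold_transport I A h
  intro x
  have h1 := contMDiffOn_symm_of_mem_maximalAtlas (IsManifold.subset_maximalAtlas
    (I := 𝓘(ℝ, E')) (n := ∞) (mem_image_of_mem (transportChart I A h) (chart_mem_atlas H x)))
  have h2 : ContMDiffOn I 𝓘(ℝ, E') ∞ (fun y => A (I (chartAt H x y))) (chartAt H x).source :=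
    (A.contDiff.contMDiff.comp I.contMDiff).comp_contMDiffOn contMDiffOn_chart
  have h3 := h1.comp h2 fun y hy => by simpa [transportChart] using (chartAt H x).map_source hy
  refine (h3.congr fun y hy => ?_).contMDiffAt ((chartAt H x).open_source.mem_nhds
    (mem_chart_source H x))
  simp [transportChart, (chartAt H x).left_inv hy]

theorem contMDiff_transport_symm :
    letI := transportCharts I A h
    ContMDiff 𝓘(ℝ, E') I ∞ h.symm := by
  let := transportCharts I A h
  have := isManifold_transport I A h
  intro q
  set c := chartAt H (h.symm q) with hc
  have hm : transportChart I A h c ∈ IsManifold.maximalAtlas 𝓘(ℝ, E') ∞ R :=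
    IsManifold.subset_maximalAtlas (mem_image_of_mem _ (chart_mem_atlas H _))
  have h1 := contMDiffOn_of_mem_maximalAtlas hm
  have h2 : ContMDiffOn 𝓘(ℝ, E') I ∞ (fun y => c.symm (I.symm (A.symm y)))
      (transportChart I A h c).target := by
    refine contMDiffOn_chart_symm.comp (I.contMDiffOn_symm.comp
      A.symm.contDiff.contMDiff.contMDiffOn fun y hy => ?_) fun y hy => ?_
    · simp [I.range_eq_univ]
    · simpa [transportChart] using hy
  have h3 := h2.comp h1 fun y hy => (transportChart I A h c).map_source hy
  refine (h3.congr fun y hy => ?_).contMDiffAt ((transportChart I A h c).open_source.mem_nhds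
    ((mem_transportChart_source I A h c q).2 (mem_chart_source H _)))
  have hy' := (mem_transportChart_source I A h c y).1 hy
  simp [transportChart, c.left_inv hy']

/-- The transport of charts along a homeomorphism makes it a diffeomorphism. -/
def transportDiffeomorph :
    letI := transportCharts I A h
    N ≃ₘ^∞⟮I, 𝓘(ℝ, E')⟯ R :=
  letI := transportCharts I A h
  { h.toEquiv with
    contMDiff_toFun := contMDiff_transport I A h
    contMDiff_invFun := contMDiff_transport_symm I A h }

end Transport

/-- Points over distinct base points are separated in the base; points over the same base point are
separated in a common trivialization. -/
theorem fiberBundle_t2Space {B F : Type*} [TopologicalSpace B] [TopologicalSpace F] [T2Space B]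
    [T2Space F] (V : B → Type*) [TopologicalSpace (TotalSpace F V)] [∀ x, TopologicalSpace (V x)]
    [FiberBundle F V] : T2Space (TotalSpace F V) := by
  refine ⟨fun p q hpq => ?_⟩
  have hc := FiberBundle.continuous_proj F V
  by_cases h : p.1 = q.1
  · let t := trivializationAt F V p.1
    have hp : p ∈ t.source := t.mem_source.2 (mem_baseSet_trivializationAt F V p.1)
    have hq : q ∈ t.source := t.mem_source.2 (h ▸ mem_baseSet_trivializationAt F V p.1)
    obtain ⟨u, v, hu, hv, hpu, hqv, huv⟩ := t2_separation (t.injOn.ne hp hq hpq)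
    exact ⟨_, _, t.continuousOn.isOpen_inter_preimage t.open_source hu,
      t.continuousOn.isOpen_inter_preimage t.open_source hv, ⟨hp, hpu⟩, ⟨hq, hqv⟩,
      (huv.preimage t).mono inter_subset_right inter_subset_right⟩
  · obtain ⟨u, v, hu, hv, hpu, hqv, huv⟩ := t2_separation h
    exact ⟨_, _, hu.preimage hc, hv.preimage hc, hpu, hqv, huv.preimage _⟩

/-! ### The section of the multimomentum bundle -/

section ShearChart

variable {E : JetFib 1 → MomFib}

/-- The coordinates of multimomenta in which the graph of `E` is flat. -/
def shear (hE : ContDiffOn ℝ ∞ E {u | IsLorentzian (metric u)}) :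
    OpenPartialHomeomorph (ModelProd Coord (JetFib 1 × MomFib))
      (ModelProd Coord (JetFib 1 × MomFib)) where
  toFun q := (q.1, (q.2.1, q.2.2 - E q.2.1))
  invFun q := (q.1, (q.2.1, q.2.2 + E q.2.1))
  source := {q | IsLorentzian (metric q.2.1)}
  target := {q | IsLorentzian (metric q.2.1)}
  map_source' _ hq := hq
  map_target' _ hq := hq
  left_inv' q _ := by simp
  right_inv' q _ := by simp
  open_source := isOpen_isLorentzian.preimage
    ((metric_continuous 1).comp (continuous_fst.comp continuous_snd))
  open_target := isOpen_isLorentzian.preimage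
    ((metric_continuous 1).comp (continuous_fst.comp continuous_snd))
  continuousOn_toFun := continuousOn_fst.prodMk ((continuousOn_fst.comp continuousOn_snd
    (mapsTo_univ _ _)).prodMk ((continuousOn_snd.comp continuousOn_snd (mapsTo_univ _ _)).sub
      (hE.continuousOn.comp (continuousOn_fst.comp continuousOn_snd (mapsTo_univ _ _))
        fun _ hq => hq)))
  continuousOn_invFun := continuousOn_fst.prodMk ((continuousOn_fst.comp continuousOn_snd
    (mapsTo_univ _ _)).prodMk ((continuousOn_snd.comp continuousOn_snd (mapsTo_univ _ _)).add
      (hE.continuousOn.comp (continuousOn_fst.comp continuousOn_snd (mapsTo_univ _ _))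
        fun _ hq => hq)))

variable {M : Type*} [TopologicalSpace M] [ChartedSpace Coord M] [IsManifold (𝓡 4) ∞ M]

theorem chart_trans_shear_mem_maximalAtlas (hE : ContDiffOn ℝ ∞ E {u | IsLorentzian (metric u)})
    (p : momSpace M) :
    chartAt (ModelProd Coord (JetFib 1 × MomFib)) p ≫ₕ shear hE ∈
      IsManifold.maximalAtlas ((𝓡 4).prod 𝓘(ℝ, JetFib 1 × MomFib)) ∞ (momSpace M) := by
  have h : ContDiffOn ℝ ∞ (fun q : Coord × (JetFib 1 × MomFib) => E q.2.1)
      {q | IsLorentzian (metric q.2.1)} :=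
    hE.comp (contDiff_fst.comp contDiff_snd).contDiffOn fun _ hq => hq
  refine trans_mem_maximalAtlas (IsManifold.chart_mem_maximalAtlas p) ?_ ?_
  · change ContDiffOn ℝ ∞ (fun q : Coord × (JetFib 1 × MomFib) =>
      (q.1, (q.2.1, q.2.2 - E q.2.1))) _
    exact contDiffOn_fst.prodMk ((contDiff_fst.comp contDiff_snd).contDiffOn.prodMk
      ((contDiff_snd.comp contDiff_snd).contDiffOn.sub (h.mono fun q hq => hq.1)))
  · change ContDiffOn ℝ ∞ (fun q : Coord × (JetFib 1 × MomFib) =>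
      (q.1, (q.2.1, q.2.2 + E q.2.1))) _
    exact contDiffOn_fst.prodMk ((contDiff_fst.comp contDiff_snd).contDiffOn.prodMk
      ((contDiff_snd.comp contDiff_snd).contDiffOn.add (h.mono fun q hq => hq.1)))

/-- The section is defined at each point in the preferred chart of that point. Covariance makes it
the graph of the same function `E` in any one fixed chart. -/
theorem momSection_chart (hcov : IsCovariant M E) {p q : jetSpace M 1}
    (hq : q ∈ (chartAt (ModelProd Coord (JetFib 1)) p).source) :
    chartAt (ModelProd Coord (JetFib 1 × MomFib)) (momSection M E p) (momSection M E q) =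
      ((chartAt (ModelProd Coord (JetFib 1)) p q).1,
        ((chartAt (ModelProd Coord (JetFib 1)) p q).2,
          E (chartAt (ModelProd Coord (JetFib 1)) p q).2)) := by
  rw [jetSpace_mem_chartAt_source] at hq
  rw [momSpace_chartAt_apply, jetSpace_chartAt_apply]
  have h := hcov (index M q.1.1) (index M p.1.1) q.1.1 (mem_chart_source Coord q.1.1) hq
    (show JetFib 1 from q.1.2) q.2
  exact Prod.ext rfl (Prod.ext rfl h.symm)

theorem isLorentzian_chart {k : ℕ} {p q : jetSpace M k}
    (hq : q ∈ (chartAt (ModelProd Coord (JetFib k)) p).source) :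
    IsLorentzian (metric (chartAt (ModelProd Coord (JetFib k)) p q).2) := by
  rw [jetSpace_mem_chartAt_source] at hq
  exact isLorentzian_coordChange k (index M q.1.1) (index M p.1.1)
    (mem_chart_source Coord q.1.1) hq q.2

theorem momSection_mem_chart_source {p q : jetSpace M 1}
    (hq : q ∈ (chartAt (ModelProd Coord (JetFib 1)) p).source) :
    momSection M E q ∈
      (chartAt (ModelProd Coord (JetFib 1 × MomFib)) (momSection M E p)).source := by
  rw [momSpace_mem_chartAt_source]
  exact (jetSpace_mem_chartAt_source M 1 p q).1 hq

theorem momSection_shear (hE : ContDiffOn ℝ ∞ E {u | IsLorentzian (metric u)})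
    (hcov : IsCovariant M E) {p q : jetSpace M 1}
    (hq : q ∈ (chartAt (ModelProd Coord (JetFib 1)) p).source) :
    momSection M E q ∈ (chartAt (ModelProd Coord (JetFib 1 × MomFib)) (momSection M E p) ≫ₕ
        shear hE).source ∧
      (chartAt (ModelProd Coord (JetFib 1 × MomFib)) (momSection M E p) ≫ₕ shear hE)
        (momSection M E q) = ((chartAt (ModelProd Coord (JetFib 1)) p q).1,
          ((chartAt (ModelProd Coord (JetFib 1)) p q).2, 0)) := by
  constructor
  · rw [OpenPartialHomeomorph.trans_source]
    refine ⟨momSection_mem_chart_source hq, ?_⟩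
    rw [mem_preimage, momSection_chart hcov hq]
    exact isLorentzian_chart hq
  · rw [OpenPartialHomeomorph.trans_apply, momSection_chart hcov hq]
    simp [shear]

theorem momSection_continuous (hE : ContDiffOn ℝ ∞ E {u | IsLorentzian (metric u)})
    (hcov : IsCovariant M E) : Continuous (momSection M E) := by
  rw [continuous_iff_continuousAt]
  intro p
  set c := chartAt (ModelProd Coord (JetFib 1)) p
  have hc : c.source ∈ 𝓝 p := c.open_source.mem_nhds (mem_chart_source _ p)
  refine ((chartAt (ModelProd Coord (JetFib 1 × MomFib)) (momSection M E p) ≫ₕ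
    shear hE).continuousAt_iff_continuousAt_comp_left (Filter.mem_of_superset hc fun q hq =>
      (momSection_shear hE hcov hq).1)).2 ?_
  have h1 : ContinuousAt (fun q => ((c q).1, ((c q).2, (0 : MomFib)))) p := by
    have h2 := c.continuousAt (mem_chart_source _ p)
    exact h2.fst.prodMk (h2.snd.prodMk continuousAt_const)
  exact h1.congr (Filter.eventually_of_mem hc fun q hq => (momSection_shear hE hcov hq).2.symm)

theorem momBase_continuous : Continuous (momBase M) :=
  ((momProj_continuous M).comp continuous_subtype_val).subtype_mk _

theorem jetProj_chart {k : ℕ} (hk : 1 ≤ k) {p q : jetSpace M k}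
    (hq : q ∈ (chartAt (ModelProd Coord (JetFib k)) p).source) :
    jetProj M k q ∈ (chartAt (ModelProd Coord (JetFib 1)) (jetProj M k p)).source ∧
      chartAt (ModelProd Coord (JetFib 1)) (jetProj M k p) (jetProj M k q) =
        ((chartAt (ModelProd Coord (JetFib k)) p q).1,
          trunc 1 (chartAt (ModelProd Coord (JetFib k)) p q).2) := by
  rw [jetSpace_mem_chartAt_source] at hq
  refine ⟨(jetSpace_mem_chartAt_source M 1 _ _).2 hq, ?_⟩
  rw [jetSpace_chartAt_apply, jetSpace_chartAt_apply]
  have h := trunc_jetChange (isOpen_overlap (index M p.1.1) (index M q.1.1) (index M q.1.1))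
    (trans_contDiffOn (index M p.1.1) (index M q.1.1) (index M q.1.1)) hk
    (mem_overlap hq (mem_chart_source Coord q.1.1) (mem_chart_source Coord q.1.1))
    (show JetFib k from q.1.2)
  exact Prod.ext rfl h.symm

end ShearChart

instance {M : Type*} [TopologicalSpace M] [ChartedSpace Coord M] [IsManifold (𝓡 4) ∞ M]
    [T2Space M] : T2Space (MomTotal M) :=
  fiberBundle_t2Space (F := JetFib 1 × MomFib) ((jetCore M 1).Fiber ×ᵇ (momCore M).Fiber)

section Range

variable {M : Type*} [TopologicalSpace M] [ChartedSpace Coord M] [IsManifold (𝓡 4) ∞ M]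
  {E : JetFib 1 → MomFib} {F : jetSpace M 3 → momSpace M}

theorem momSection_mem_range (hF : F = momSection M E ∘ jetProj M 3) (u : jetSpace M 1) :
    momSection M E u ∈ range F := by
  have h13 : 1 ≤ 3 := by norm_num
  obtain ⟨j, hj⟩ := jetProj_surjective M h13 u
  exact ⟨j, by rw [hF, Function.comp_apply, hj]⟩

/-- The first jets are homeomorphic to the image of a map which factors through the section `E`. -/
def homeoRange (hE : ContDiffOn ℝ ∞ E {u | IsLorentzian (metric u)}) (hcov : IsCovariant M E)
    (hF : F = momSection M E ∘ jetProj M 3) : jetSpace M 1 ≃ₜ range F where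
  toFun u := ⟨momSection M E u, momSection_mem_range hF u⟩
  invFun q := momBase M q.1
  left_inv _ := rfl
  right_inv := by
    rintro ⟨_, j, rfl⟩
    subst hF
    rfl
  continuous_toFun := (momSection_continuous hE hcov).subtype_mk _
  continuous_invFun := (momBase_continuous (M := M)).comp continuous_subtype_val

/-- The image of a section `s` of a projection `b` is the set where `s ∘ b` agrees with the
identity, and this is closed in a Hausdorff space. -/
theorem isClosed_range_of_factor [T2Space M]
    (hE : ContDiffOn ℝ ∞ E {u | IsLorentzian (metric u)}) (hcov : IsCovariant M E)
    (hF : F = momSection M E ∘ jetProj M 3) : IsClosed (range F) := by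
  have h : range F = {q | momSection M E (momBase M q) = q} := by
    ext q
    constructor
    · rintro ⟨j, rfl⟩
      subst hF
      rfl
    · intro hq
      rw [← show momSection M E (momBase M q) = q from hq]
      exact momSection_mem_range hF _
  rw [h]
  exact isClosed_eq ((momSection_continuous hE hcov).comp (momBase_continuous (M := M)))
    continuous_id

end Range

/-! ### Almost-regularity -/

section Regularity

variable {M : Type*} [TopologicalSpace M] [ChartedSpace Coord M] [IsManifold (𝓡 4) ∞ M]
  {E : JetFib 1 → MomFib} {F : jetSpace M 3 → momSpace M}

/-- The dimension of the space of first jets. -/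
abbrev jetDim : ℕ := Module.finrank ℝ (Coord × JetFib 1)

/-- The charts of the image of a map which factors through the section `E`. -/
@[reducible]
def rangeCharts (hE : ContDiffOn ℝ ∞ E {u | IsLorentzian (metric u)}) (hcov : IsCovariant M E)
    (hF : F = momSection M E ∘ jetProj M 3) :
    ChartedSpace (EuclideanSpace ℝ (Fin jetDim)) (range F) :=
  transportCharts ((𝓡 4).prod 𝓘(ℝ, JetFib 1)) toEuclidean (homeoRange hE hcov hF)

theorem chart_mem_maximalAtlas_range (hE : ContDiffOn ℝ ∞ E {u | IsLorentzian (metric u)})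
    (hcov : IsCovariant M E) (hF : F = momSection M E ∘ jetProj M 3) (p : jetSpace M 1) :
    letI := rangeCharts hE hcov hF
    transportChart ((𝓡 4).prod 𝓘(ℝ, JetFib 1)) toEuclidean (homeoRange hE hcov hF)
      (chartAt (ModelProd Coord (JetFib 1)) p) ∈ IsManifold.maximalAtlas (𝓡 jetDim) ∞ (range F) := by
  let := rangeCharts hE hcov hF
  have := isManifold_transport ((𝓡 4).prod 𝓘(ℝ, JetFib 1)) toEuclidean (homeoRange hE hcov hF)
  exact IsManifold.subset_maximalAtlas (mem_image_of_mem _ (chart_mem_atlas _ p))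

/-- In a sheared chart the section is `u ↦ (u, 0)`, already the normal form of an immersion. The
linear equivalence only regroups the three factors. -/
theorem isSubmanifoldWith_range (hE : ContDiffOn ℝ ∞ E {u | IsLorentzian (metric u)})
    (hcov : IsCovariant M E) (hF : F = momSection M E ∘ jetProj M 3) :
    IsSubmanifoldWith ((𝓡 4).prod 𝓘(ℝ, JetFib 1 × MomFib)) (range F) jetDim
      (rangeCharts hE hcov hF) := by
  let := rangeCharts hE hcov hF
  refine ⟨isManifold_transport _ _ _, ?_, Topology.IsEmbedding.subtypeVal⟩
  refine isImmersion_of_charts (((toEuclidean (E := Coord × JetFib 1)).symm.prodCongr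
    (ContinuousLinearEquiv.refl ℝ MomFib)).trans
      (ContinuousLinearEquiv.prodAssoc ℝ Coord (JetFib 1) MomFib)) fun q => ?_
  obtain ⟨p, rfl⟩ := (homeoRange hE hcov hF).surjective q
  refine ⟨_, chart_mem_maximalAtlas_range hE hcov hF p, _,
    chart_trans_shear_mem_maximalAtlas hE (momSection M E p), ?_, fun q hq => ?_⟩
  · rw [mem_transportChart_source, Homeomorph.symm_apply_apply]
    exact mem_chart_source _ p
  · obtain ⟨u, rfl⟩ := (homeoRange hE hcov hF).surjective q
    rw [mem_transportChart_source, Homeomorph.symm_apply_apply] at hq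
    have h := momSection_shear hE hcov hq
    refine ⟨h.1, ?_⟩
    rw [transportChart_apply, Homeomorph.symm_apply_apply]
    refine h.2.trans ?_
    simp

/-- The splitting of the fibre of `k`-jets by the projection onto the first jets. -/
def jetSplit : JetFib 3 ≃L[ℝ] JetFib 1 × (truncL 3 1).ker :=
  ContinuousLinearEquiv.equivOfRightInverse (truncL 3 1) (truncL 1 3)
    fun u => trunc_trunc_self (by norm_num) u

/-- The charts of the image come from those of `J¹π`, so in charts the map is the linear projection
of three-jets onto first jets, with kernel split off by `jetSplit`. -/
theorem isSubmersion_rangeFactorization (hE : ContDiffOn ℝ ∞ E {u | IsLorentzian (metric u)})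
    (hcov : IsCovariant M E) (hF : F = momSection M E ∘ jetProj M 3) :
    letI := rangeCharts hE hcov hF
    IsSubmersion ((𝓡 4).prod 𝓘(ℝ, JetFib 3)) (𝓡 jetDim) ∞ (rangeFactorization F) := by
  let := rangeCharts hE hcov hF
  refine isSubmersion_of_charts ((((ContinuousLinearEquiv.refl ℝ Coord).prodCongr jetSplit).trans
    (ContinuousLinearEquiv.prodAssoc ℝ Coord (JetFib 1) (truncL 3 1).ker).symm).trans
      ((toEuclidean (E := Coord × JetFib 1)).prodCongr
        (ContinuousLinearEquiv.refl ℝ (truncL 3 1).ker))) fun j => ?_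
  have h13 : 1 ≤ 3 := by norm_num
  have hj : ∀ j, (homeoRange hE hcov hF).symm (rangeFactorization F j) = jetProj M 3 j := by
    intro j
    subst hF
    rfl
  refine ⟨_, IsManifold.chart_mem_maximalAtlas j, _,
    chart_mem_maximalAtlas_range hE hcov hF (jetProj M 3 j), mem_chart_source _ j,
    fun j' hj' => ?_⟩
  have h := jetProj_chart h13 hj'
  rw [mem_transportChart_source, transportChart_apply, hj]
  refine ⟨h.1, ?_⟩
  rw [h.2]
  rfl

/-- The affine coordinates of the fibre through `j` of the projection onto the first jets. -/
def fibreMap (j : jetSpace M 3) (w : (truncL 3 1).ker) : jetSpace M 3 :=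
  ⟨⟨j.1.1, (show JetFib 3 from j.1.2) + w.1⟩, by
    change IsLorentzian (metric ((show JetFib 3 from j.1.2) + w.1))
    rw [metric_add_of_trunc (l := 1) _ (show trunc 1 w.1 = 0 from w.2)]
    exact j.2⟩

theorem isEmbedding_fibreMap (j : jetSpace M 3) : Topology.IsEmbedding (fibreMap j) := by
  have h : Topology.IsEmbedding (Subtype.val ∘ fibreMap j) :=
    ((FiberBundle.totalSpaceMk_isEmbedding (JetFib 3) (jetCore M 3).Fiber j.1.1).comp
      (Homeomorph.addLeft (show JetFib 3 from j.1.2)).isEmbedding).comp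
        Topology.IsEmbedding.subtypeVal
  exact (Topology.IsEmbedding.subtypeVal.of_comp_iff).1 h

/-- The projection to `J¹π` recovers the first jet from its momentum, so two points of `J³π` have
the same image exactly when their first jets agree, that is, when they lie over one point of `M` and
differ by an element of the kernel of the truncation. -/
theorem range_fibreMap (hF : F = momSection M E ∘ jetProj M 3) (j : jetSpace M 3) :
    range (fibreMap j) = F ⁻¹' {F j} := by
  ext j'
  constructor
  · rintro ⟨w, rfl⟩
    subst hF
    rw [mem_preimage, mem_singleton_iff, Function.comp_apply, Function.comp_apply]
    congr 1
    refine Subtype.ext ?_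
    change (⟨j.1.1, trunc 1 ((show JetFib 3 from j.1.2) + w.1)⟩ :
      TotalSpace (JetFib 1) (jetCore M 1).Fiber) = ⟨j.1.1, trunc 1 (show JetFib 3 from j.1.2)⟩
    rw [trunc_add, show trunc 1 w.1 = 0 from w.2, add_zero]
  · intro h
    rw [mem_preimage, mem_singleton_iff, hF] at h
    have h1 : jetProj M 3 j' = jetProj M 3 j := congrArg (momBase M) h
    have h2 := congrArg Subtype.val h1
    obtain ⟨⟨x, v⟩, hv⟩ := j
    obtain ⟨⟨x', v'⟩, hv'⟩ := j'
    obtain rfl : x' = x := congrArg TotalSpace.proj h2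
    have h3 : trunc 1 (show JetFib 3 from v') = trunc 1 (show JetFib 3 from v) :=
      eq_of_heq (TotalSpace.mk.inj h2).2
    refine ⟨⟨(show JetFib 3 from v') - (show JetFib 3 from v), ?_⟩, ?_⟩
    · change trunc 1 ((show JetFib 3 from v') - (show JetFib 3 from v)) = 0
      rw [trunc_sub, h3, sub_self]
    · refine Subtype.ext ?_
      change (⟨x', (show JetFib 3 from v) + ((show JetFib 3 from v') -
        (show JetFib 3 from v))⟩ : TotalSpace (JetFib 3) (jetCore M 3).Fiber) = ⟨x', v'⟩
      rw [add_sub_cancel]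

/-- The fibre through `j` is homeomorphic to a vector space. -/
def homeoFibre (hF : F = momSection M E ∘ jetProj M 3) (j : jetSpace M 3) :
    (truncL 3 1).ker ≃ₜ ↥(F ⁻¹' {F j}) :=
  (isEmbedding_fibreMap j).toHomeomorph.trans (Homeomorph.setCongr (range_fibreMap hF j))

theorem isConnected_fibre (hF : F = momSection M E ∘ jetProj M 3) (j : jetSpace M 3) :
    IsConnected (F ⁻¹' {F j}) := by
  rw [← range_fibreMap hF j]
  exact isConnected_range (isEmbedding_fibreMap j).continuous

theorem chart_trans_add_mem_maximalAtlas {k : ℕ} (p : jetSpace M k) (a : Coord × JetFib k) :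
    chartAt (ModelProd Coord (JetFib k)) p ≫ₕ (show OpenPartialHomeomorph
      (ModelProd Coord (JetFib k)) (ModelProd Coord (JetFib k)) from
        (Homeomorph.addRight a).toOpenPartialHomeomorph) ∈
      IsManifold.maximalAtlas ((𝓡 4).prod 𝓘(ℝ, JetFib k)) ∞ (jetSpace M k) := by
  refine trans_mem_maximalAtlas (IsManifold.chart_mem_maximalAtlas p) ?_ ?_
  · change ContDiffOn ℝ ∞ (fun q : Coord × JetFib k => q + a) _
    exact contDiffOn_id.add contDiffOn_const
  · change ContDiffOn ℝ ∞ (fun q : Coord × JetFib k => q + -a) _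
    exact contDiffOn_id.add contDiffOn_const

theorem fibreMap_chart (j : jetSpace M 3) (w : (truncL 3 1).ker) :
    chartAt (ModelProd Coord (JetFib 3)) j (fibreMap j w) =
      (chartAt Coord j.1.1 j.1.1, (show JetFib 3 from j.1.2) + w.1) := by
  rw [jetSpace_chartAt_apply]
  exact Prod.ext rfl ((jetCore M 3).coordChange_self _ _ (mem_chart_source Coord j.1.1) _)

/-- The chart at `j`, translated so that `j` goes to the origin, maps the fibre into `0 × ker`. The
fibre is an affine space over this kernel and takes its charts from it. -/
theorem isSubmanifold_fibre (hF : F = momSection M E ∘ jetProj M 3) (j : jetSpace M 3) :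
    IsSubmanifold ((𝓡 4).prod 𝓘(ℝ, JetFib 3)) (F ⁻¹' {F j}) := by
  let K := (truncL 3 1).ker
  refine ⟨_, transportCharts 𝓘(ℝ, K) (toEuclidean (E := K)) (homeoFibre hF j), ?_⟩
  let := transportCharts 𝓘(ℝ, K) (toEuclidean (E := K)) (homeoFibre hF j)
  have hm := isManifold_transport 𝓘(ℝ, K) (toEuclidean (E := K)) (homeoFibre hF j)
  refine ⟨hm, ?_, Topology.IsEmbedding.subtypeVal⟩
  -- The normal form of an immersion lists the kernel first and the complement second, while the
  -- model space lists the base, then the first jets, then the kernel. The equivalence swaps and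
  -- regroups, and `jetSplit.symm` reassembles a three-jet.
  refine isImmersion_of_charts (F := Coord × JetFib 1)
    ((((ContinuousLinearEquiv.prodComm ℝ _ _).trans
      (ContinuousLinearEquiv.prodAssoc ℝ Coord (JetFib 1) _)).trans
        ((ContinuousLinearEquiv.refl ℝ Coord).prodCongr
          ((ContinuousLinearEquiv.refl ℝ (JetFib 1)).prodCongr (toEuclidean (E := K)).symm))).trans
      ((ContinuousLinearEquiv.refl ℝ Coord).prodCongr jetSplit.symm)) fun q => ?_
  refine ⟨_, IsManifold.chart_mem_maximalAtlas q, _, chart_trans_add_mem_maximalAtlas j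
    (-(chartAt Coord j.1.1 j.1.1, (show JetFib 3 from j.1.2))), mem_chart_source _ q,
    fun q' _ => ?_⟩
  obtain ⟨w, rfl⟩ := (homeoFibre hF j).surjective q'
  constructor
  · rw [OpenPartialHomeomorph.trans_source]
    exact ⟨(jetSpace_mem_chartAt_source M 3 j (fibreMap j w)).2 (mem_chart_source Coord j.1.1),
      mem_univ _⟩
  · refine (congrArg (fun y : Coord × JetFib 3 =>
      y + -(chartAt Coord j.1.1 j.1.1, (show JetFib 3 from j.1.2))) (fibreMap_chart j w)).trans ?_
    change _ = ((0 : Coord), jetSplit.symm ((0 : JetFib 1), (toEuclidean (E := K)).symm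
      (toEuclidean ((homeoFibre hF j).symm (homeoFibre hF j w)))))
    rw [Homeomorph.symm_apply_apply, ContinuousLinearEquiv.symm_apply_apply]
    refine Prod.ext (add_neg_cancel _) ?_
    change (show JetFib 3 from j.1.2) + w.1 + -(show JetFib 3 from j.1.2) =
      truncL 1 3 (0 : JetFib 1) + w.1
    rw [map_zero, zero_add]
    abel

theorem isAlmostRegularWith_of_factor [T2Space M]
    (hE : ContDiffOn ℝ ∞ E {u | IsLorentzian (metric u)}) (hcov : IsCovariant M E)
    (hF : F = momSection M E ∘ jetProj M 3) :
    IsAlmostRegularWith ((𝓡 4).prod 𝓘(ℝ, JetFib 3)) ((𝓡 4).prod 𝓘(ℝ, JetFib 1 × MomFib)) F jetDim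
      (rangeCharts hE hcov hF) :=
  ⟨isClosed_range_of_factor hE hcov hF, isSubmanifoldWith_range hE hcov hF,
    isSubmersion_rangeFactorization hE hcov hF,
    fun j => ⟨isConnected_fibre hF j, isSubmanifold_fibre hF j⟩⟩

theorem isInvariantUnder_trans (hM : IsOrientedAtlas M) (G : ℝ) (G₂ G₃ : ℝ × ℝ → ℝ)
    (e e' : atlas Coord M) :
    IsInvariantUnder (lagrangian G G₂ G₃) (trans M e e') (overlap M e e' e') := by
  refine isInvariantUnder_lagrangian G G₂ G₃ (isOpen_overlap e e' e') (trans_contDiffOn e e' e')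
    fun z hz => ?_
  refine hM e.1 e.2 e'.1 e'.2 z ?_
  rw [OpenPartialHomeomorph.trans_source]
  exact ⟨hz.1, hz.2.1⟩

end Regularity

end

end Horndeski

theorem mainTheorem4 (M : Type*) [TopologicalSpace M] [ChartedSpace Horndeski.Coord M]
    [IsManifold (𝓡 4) ∞ M] [T2Space M] [SecondCountableTopology M]
    (hM : Horndeski.IsOrientedAtlas M) (G : ℝ) (hG : 0 < G) (G₂ G₃ : ℝ × ℝ → ℝ)
    (hG₂ : ContDiff ℝ ∞ G₂) (hG₃ : ContDiff ℝ ∞ G₃) (hX : ∀ p, fderiv ℝ G₃ p (0, 1) = 0) :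
    ∃ (d : ℕ) (cs : ChartedSpace (EuclideanSpace ℝ (Fin d))
        (range (Horndeski.legendreMap M (Horndeski.lagrangian G G₂ G₃)))),
      Horndeski.IsAlmostRegularWith ((𝓡 4).prod 𝓘(ℝ, Horndeski.JetFib 3))
        ((𝓡 4).prod 𝓘(ℝ, Horndeski.JetFib 1 × Horndeski.MomFib))
        (Horndeski.legendreMap M (Horndeski.lagrangian G G₂ G₃)) d cs ∧
      Nonempty (Horndeski.jetSpace M 1 ≃ₘ^∞⟮(𝓡 4).prod 𝓘(ℝ, Horndeski.JetFib 1), 𝓡 d⟯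
        range (Horndeski.legendreMap M (Horndeski.lagrangian G G₂ G₃))) := by
  have hL := Horndeski.contDiffOn_lagrangian G hG₂ hG₃
  have hA := Horndeski.isAffineInSecond_lagrangian G G₂ hG₃ hX
  have hE := Horndeski.contDiffOn_momentum hL
  have hcov := Horndeski.isCovariant_momentum hA hL (Horndeski.isInvariantUnder_trans hM G G₂ G₃)
  have hF := Horndeski.legendreMap_eq M hA hL
  exact ⟨_, Horndeski.rangeCharts hE hcov hF,
    Horndeski.isAlmostRegularWith_of_factor hE hcov hF,
    -- The charts of the image were transported from `J¹π` along the section, so the section is a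
    -- diffeomorphism onto it by construction.
    ⟨Horndeski.transportDiffeomorph _ _ _⟩⟩
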